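/- **Setting.** Consider the driven Frenkel–Kontorova chain $$\dot u_j(t)=W'(u_{j+1}-u_j)-W'(u_j-u_{j-1})+V'(u_j)+f(t),\qquad j\in\mathbb Z,$$ where $W$ is $C^2$ with $W''\ge\delta>0$ for some $\delta>0$, $V$ is $C^2$ and $1$-periodic, and either $f$ is constant (DC case), or $f$ is $1$-periodic and $W,V,f$ are real analytic (AC case). A configuration $u=(u_j)_{j\in\mathbb Z}$ has *bounded width* with *mean spacing* $\rho$ if for some $K$ and all $m,n\in\mathbb Z$, $|u_m-u_n-(m-n)\rho|\le K$. Let $\widetilde{\mathcal X}$ be the space of all configurations of bounded width with the topology of pointwise convergence, $\mathcal X$ its quotient under $u\sim u+n$, $n\in\mathbb Z$, and $\mathcal X_\rho\subset\mathcal X$ the set of classes with mean spacing $\rho$. Let $(S_mu)_j=u_{j-m}$, let $T_t$, $t\ge 0$, be the time evolution (from time $0$ to time $t$) on $\mathcal X$, and $S=S_1$, $T=T_1$. For $x\in\mathcal X$, let $\widetilde\omega(x)$ be the smallest closed subset of $\mathcal X$ such that for every open $U\supset\widetilde\omega(x)$ the proportion of the pairs $(m,n)$, $0\le m\le N$, $-N\le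 n\le N$, with $T_mS_nx\in U$ tends to $1$ as $N\to\infty$. Let $$\mathcal A=\mathrm{Cl}_{\mathcal X}\Big(\bigcup_{x\in\mathcal X}\widetilde\omega(x)\Big),\qquad \mathcal A_\rho=\mathrm{Cl}_{\mathcal X_\rho}\Big(\bigcup_{x\in\mathcal X_\rho}\widetilde\omega(x)\Big)$$ be the space-time attractors of the dynamics on $\mathcal X$ and on $\mathcal X_\rho$. Two distinct configurations $u,v$ *intersect* if $(v_{j+1}-u_{j+1})(v_j-u_j)\le 0$ for some $j$, that is, if their graphs (the piecewise linear interpolations of $j\mapsto u_j$, $j\mapsto v_j$) meet; their intersections are the points where the graphs meet. The chain is in the *depinned phase* for $\rho\in\mathbb R$ if there is an $S,T$-invariant Borel probability measure $\mu$ on $\mathcal X_\rho$ such that no two configurations (representatives in $\widetilde{\mathcal X}$ of elements) in its support intersect, and $u\mapsto u_0 \bmod 1$ maps the support of $\mu$ onto $\mathbb R/\mathbb Z$. **Corollary.** Assume that the chain is in the depinned phase for $\rho\in\mathbb R$. Then no configuration in $\mathcal A$ intersects a configuration in $\mathcal A_\rho$ more than once: if $u,v\in\widetilde{\mathcal X}$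 are distinct, the class of $u$ is in $\mathcal A_\rho$ and the class of $v$ is in $\mathcal A$, then the graphs of $u$ and $v$ meet in at most one point. -/

import Mathlib

open Set Filter Topology MeasureTheory

namespace FrenkelKontorova

/-! ### The model -/

/-- Standing assumptions. `W` is `C²` with `W'' ≥ δ > 0`, `V` is `C²` and `1`-periodic. The force `f`
is either constant (DC), or `1`-periodic, and then `W`, `V`, `f` are real analytic (AC). -/
structure StandingAssumptions (W V f : ℝ → ℝ) : Prop where
  contDiff_W : ContDiff ℝ 2 W
  convex_W : ∃ δ : ℝ, 0 < δ ∧ ∀ p : ℝ, δ ≤ deriv (deriv W) p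
  contDiff_V : ContDiff ℝ 2 V
  periodic_V : ∀ x : ℝ, V (x + 1) = V x
  driving : (∃ c : ℝ, ∀ t : ℝ, f t = c) ∨
    ((∀ t : ℝ, f (t + 1) = f t) ∧ AnalyticOnNhd ℝ W univ ∧ AnalyticOnNhd ℝ V univ ∧
      AnalyticOnNhd ℝ f univ)

/-! ### Configurations -/

/-- `u` is of bounded width with mean spacing `ρ`. -/
def HasBoundedWidth (ρ : ℝ) (u : ℤ → ℝ) : Prop :=
  ∃ K : ℝ, ∀ m n : ℤ, |u m - u n - ((m : ℝ) - (n : ℝ)) * ρ| ≤ K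

/-- The space of configurations of bounded width, with the topology of pointwise convergence. -/
abbrev Config : Type := {u : ℤ → ℝ // ∃ ρ : ℝ, HasBoundedWidth ρ u}

lemma HasBoundedWidth.shift {ρ : ℝ} {u : ℤ → ℝ} (h : HasBoundedWidth ρ u) (m : ℤ) :
    HasBoundedWidth ρ (fun j => u (j - m)) := by
  obtain ⟨K, hK⟩ := h
  refine ⟨K, fun a b => ?_⟩
  have := hK (a - m) (b - m)
  push_cast at this
  simpa using this

/-- The spatial translation `(S_m u)_j = u_{j-m}`. -/
def shift (m : ℤ) (u : Config) : Config :=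
  ⟨fun j => u.1 (j - m), u.2.imp fun _ h => h.shift m⟩

/-- `u ∼ u + n` for integers `n`. -/
def translationSetoid : Setoid Config where
  r u v := ∃ n : ℤ, ∀ j : ℤ, v.1 j = u.1 j + n
  iseqv :=
    { refl := fun _ => ⟨0, fun _ => by simp⟩
      symm := fun ⟨n, h⟩ => ⟨-n, fun j => by rw [h j]; push_cast; ring⟩
      trans := fun ⟨n, h⟩ ⟨k, h'⟩ => ⟨n + k, fun j => by rw [h' j, h j]; push_cast; ring⟩ }

/-- The quotient `𝒳` of the space of configurations of bounded width by integer translations. -/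
def Chain : Type := Quotient translationSetoid

/-- The class of a configuration in `𝒳`. -/
def toChain (u : Config) : Chain := Quotient.mk translationSetoid u

/-- The quotient topology. -/
instance : TopologicalSpace Chain :=
  inferInstanceAs (TopologicalSpace (Quotient translationSetoid))

instance : MeasurableSpace Chain := borel Chain

instance : BorelSpace Chain := ⟨rfl⟩

/-- The set `𝒳_ρ` of classes of configurations with mean spacing `ρ`. -/
def chainsOfSpacing (ρ : ℝ) : Set Chain :=
  {x | ∃ u : Config, toChain u = x ∧ HasBoundedWidth ρ u.1}

/-- The spatial translation `S_m` on `𝒳`. -/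
def chainShift (m : ℤ) : Chain → Chain :=
  Quotient.map (shift m) fun _ _ ⟨n, h⟩ => ⟨n, fun j => h (j - m)⟩

/-- The projection `π₀ u = u_0 mod 1`. -/
def proj₀ : Chain → UnitAddCircle :=
  Quotient.lift (fun u : Config => ((u.1 0 : ℝ) : UnitAddCircle)) fun u v ⟨n, h⟩ => by
    have hn : ((n : ℝ) : UnitAddCircle) = 0 := by
      rw [AddCircle.coe_eq_zero_iff]
      exact ⟨n, by simp⟩
    simp only [h 0, AddCircle.coe_add, hn, add_zero]

/-! ### Dynamics -/

/-- `U` solves `u_j' = W'(u_{j+1} - u_j) - W'(u_j - u_{j-1}) + V'(u_j) + f(t)` on `[0, ∞)`, as an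
ordinary differential equation in `u(0) + ℓ^∞(ℤ)`: the displacement `u(t) - u(0)` is bounded,
uniformly for `t` in bounded intervals. -/
def IsSolution (W V f : ℝ → ℝ) (U : ℝ → Config) : Prop :=
  (∀ t : ℝ, 0 ≤ t → ∀ j : ℤ,
    HasDerivWithinAt (fun s => (U s).1 j)
      (deriv W ((U t).1 (j + 1) - (U t).1 j) - deriv W ((U t).1 j - (U t).1 (j - 1))
        + deriv V ((U t).1 j) + f t) (Ici 0) t) ∧
  ∀ τ : ℝ, ∃ C : ℝ, ∀ t ∈ Icc 0 τ, ∀ j : ℤ, |(U t).1 j - (U 0).1 j| ≤ C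

open Classical in
/-- The configuration at time `t` of the solution that starts at `u` at time `0`. Under the standing
assumptions this solution exists and is unique (the other branch is never used). -/
noncomputable def flow (W V f : ℝ → ℝ) (t : ℝ) (u : Config) : Config :=
  if h : ∃ U : ℝ → Config, IsSolution W V f U ∧ U 0 = u then h.choose t else u

/-- The time evolution `T_t` on `𝒳` (the flow commutes with integer translations, so the choice of a
representative does not matter). -/
noncomputable def chainFlow (W V f : ℝ → ℝ) (t : ℝ) (x : Chain) : Chain :=
  toChain (flow W V f t (Quotient.out x))

/-! ### The space-time attractor -/

open Classical in
/-- The proportion of the pairs `(m, n)`, `0 ≤ m ≤ N`, `-N ≤ n ≤ N`, with `T_m S_n x ∈ U`. -/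
noncomputable def visitRatio (W V f : ℝ → ℝ) (x : Chain) (U : Set Chain) (N : ℕ) : ℝ :=
  (((Finset.range (N + 1) ×ˢ Finset.Icc (-(N : ℤ)) (N : ℤ)).filter
      fun p : ℕ × ℤ => chainFlow W V f (p.1 : ℝ) (chainShift p.2 x) ∈ U).card : ℝ)
    / (((N : ℝ) + 1) * (2 * (N : ℝ) + 1))

/-- The weak `ω`-limit set: the smallest closed set such that, for each of its open neighbourhoods
`U`, the proportion of visits to `U` tends to `1`. -/
def weakOmegaLimit (W V f : ℝ → ℝ) (x : Chain) : Set Chain :=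
  ⋂₀ {F | IsClosed F ∧
    ∀ U : Set Chain, IsOpen U → F ⊆ U → Tendsto (visitRatio W V f x U) atTop (𝓝 1)}

/-- The space-time attractor `𝒜`. -/
def attractor (W V f : ℝ → ℝ) : Set Chain :=
  closure (⋃ x : Chain, weakOmegaLimit W V f x)

/-- The space-time attractor `𝒜_ρ` of the dynamics on `𝒳_ρ` (the closure is taken within `𝒳_ρ`). -/
def attractorOfSpacing (W V f : ℝ → ℝ) (ρ : ℝ) : Set Chain :=
  closure (⋃ x ∈ chainsOfSpacing ρ, weakOmegaLimit W V f x) ∩ chainsOfSpacing ρ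

/-! ### Intersections -/

/-- Two different configurations intersect. -/
def Intersect (u v : Config) : Prop :=
  u ≠ v ∧ ∃ j : ℤ, (v.1 (j + 1) - u.1 (j + 1)) * (v.1 j - u.1 j) ≤ 0

/-- The graph of a configuration: its piecewise linear interpolation. -/
noncomputable def graph (u : Config) (x : ℝ) : ℝ :=
  u.1 ⌊x⌋ + Int.fract x * (u.1 (⌊x⌋ + 1) - u.1 ⌊x⌋)

/-- The (abscissas of the) points where the graphs of `u` and `v` meet. -/
def intersections (u v : Config) : Set ℝ := {x | graph u x = graph v x}

/-- Two different configurations intersect if and only if their graphs meet. -/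
lemma intersect_iff (u v : Config) : Intersect u v ↔ u ≠ v ∧ (intersections u v).Nonempty := by
  refine and_congr_right fun _ => ⟨fun ⟨j, hj⟩ => ?_, fun ⟨x, hx⟩ => ⟨⌊x⌋, ?_⟩⟩
  · set a := v.1 j - u.1 j with ha
    set b := v.1 (j + 1) - u.1 (j + 1) with hb
    by_cases h1 : b = 0
    · refine ⟨(j + 1 : ℤ), ?_⟩
      simp only [intersections, graph, mem_ofPred_eq, Int.floor_intCast, Int.fract_intCast]
      linarith
    by_cases h0 : a = b
    · rw [h0] at hj
      exact absurd (mul_self_eq_zero.1 (le_antisymm hj (mul_self_nonneg b))) h1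
    have hab : a - b ≠ 0 := sub_ne_zero.2 h0
    have hsq : 0 < (a - b) ^ 2 := by positivity
    have hs : a / (a - b) = (a * (a - b)) / (a - b) ^ 2 := by field_simp
    have hs0 : 0 ≤ a / (a - b) := by
      rw [hs]; apply div_nonneg _ hsq.le; nlinarith [sq_nonneg a]
    have hs1 : a / (a - b) < 1 := by
      rw [hs, div_lt_one hsq]
      have : 0 < b ^ 2 := by positivity
      nlinarith
    have hfl : ⌊(j : ℝ) + a / (a - b)⌋ = j := by
      rw [Int.floor_eq_iff]; constructor <;> linarith
    have hfr : Int.fract ((j : ℝ) + a / (a - b)) = a / (a - b) := by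
      rw [Int.fract, hfl]; ring
    refine ⟨(j : ℝ) + a / (a - b), ?_⟩
    simp only [intersections, graph, mem_ofPred_eq, hfl, hfr]
    have : a / (a - b) * (a - b) = a := div_mul_cancel₀ _ hab
    have h2 : a - b = v.1 j - u.1 j - (v.1 (j + 1) - u.1 (j + 1)) := by rw [ha, hb]
    generalize a / (a - b) = r at *
    rw [h2] at this
    linarith
  · have h0 := Int.fract_nonneg x
    have h1 := Int.fract_lt_one x
    simp only [intersections, graph, mem_ofPred_eq] at hx
    generalize Int.fract x = r at *
    generalize hp : v.1 ⌊x⌋ - u.1 ⌊x⌋ = a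
    generalize hq : v.1 (⌊x⌋ + 1) - u.1 (⌊x⌋ + 1) = b
    have h : (1 - r) * a + r * b = 0 := by rw [← hp, ← hq]; linarith
    have : (1 - r) * (b * a) = - (r * b ^ 2) := by linear_combination b * h
    have h3 : 0 ≤ r * b ^ 2 := by positivity
    by_contra hc
    push Not at hc
    nlinarith [mul_pos (sub_pos.2 h1) hc]

/-! ### Synchronized measures and the depinned phase -/

/-- A synchronized measure with mean spacing `ρ`: an `S, T`-invariant Borel probability measure on
`𝒳_ρ` such that no two configurations in its support intersect. -/
structure IsSynchronizedMeasure (W V f : ℝ → ℝ) (ρ : ℝ) (μ : Measure Chain) : Prop where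
  isProbability : IsProbabilityMeasure μ
  spacing : ∀ᵐ x ∂μ, x ∈ chainsOfSpacing ρ
  invariant_shift : MeasurePreserving (chainShift 1) μ μ
  invariant_flow : MeasurePreserving (chainFlow W V f 1) μ μ
  not_intersect : ∀ u v : Config, toChain u ∈ μ.support → toChain v ∈ μ.support → ¬ Intersect u v

/-- The depinned phase for the mean spacing `ρ`. -/
def IsDepinned (W V f : ℝ → ℝ) (ρ : ℝ) : Prop :=
  ∃ μ : Measure Chain, IsSynchronizedMeasure W V f ρ μ ∧ proj₀ '' μ.support = univ

end FrenkelKontorova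

/-! The support of a synchronized measure that projects onto the circle is a totally ordered family
of configurations, one through each value at each site (`exists_foliation`). Recording at each site
the leaf through the value of a configuration gives its labels (`Foliation.lab`). The difference
between a configuration and the leaf `s` has at each site the sign of the label minus `s`. So it
suffices that elements of the attractor on `𝒳_ρ` are leaves, and that elements of `𝒜` have strictly
monotone or constant labels.

The equation is cooperative, so labels measured against the moving leaves behave as under a
diffusion: each is drawn into the range of its neighbours. This is made exact by discretizing. An
Euler step at the even sites, then at the odd sites, moves every label within the hull of the
neighbouring labels (`IsFoliated.hullStep_eulerOn`), and the scheme converges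
(`Foliation.exists_hull_approx`). Hence monotone labels stay monotone, and the total variation of
labels on a window does not grow, up to a small error per site and a boundary term.

A strict interior extremum of the labels is levelled in a short time by strict comparison
(`Foliation.exists_levelling`), which costs a definite amount of variation
(`Foliation.exists_tv_step`). The amount is uniform in space and time, because translations and the
time-one map act on the leaf space by maps that preserve the measure, and such maps are
equicontinuous (`massGroup_equicontinuous`). The variation on a window of size `N` is initially
`O(N)`, so over `N` periods there are only `o(N²)` visits to a suitable neighbourhood of a
configuration with non-monotone labels (`Foliation.exists_open_zeroDensity`). By compactness each
point of a weak ω-limit set is the time-one image of a configuration with monotone labels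
(`Foliation.exists_monotonic_preimage`).

For mean spacing `ρ` the labels are bounded, so monotone labels have boundedly many jumps of a given
size. Such jumps then have density zero, and the limit points are leaves
(`Foliation.eq_leaf_of_mem_weakOmegaLimit`). For `𝒜` it remains to exclude two equal labels beside a
different one, also after taking the closure, where mean spacing and width are not controlled. There
a local, quantitative argument backward in time applies (`exists_not_flat`): the different label
would make the nearer of the two equal labels cross the leaf earlier, and the coupling would then
push the farther one to the other side, against monotonicity. -/

namespace FrenkelKontorova

/-! ### A maximum principle on the lattice -/

/-- Maximum principle for differential inequalities on a set `J` of sites, with a weight `A` that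
at most doubles from a site to its neighbours. -/
theorem lattice_max_principle {J : Set ℤ} {w w' : ℝ → ℤ → ℝ} {L T B : ℝ} (hL : 0 ≤ L)
    {A : ℤ → ℝ} (hA0 : ∀ j, 0 ≤ A j) (hA : ∀ j ∈ J, A (j + 1) ≤ 2 * A j ∧ A (j - 1) ≤ 2 * A j)
    (hc : ∀ j ∈ J, ContinuousOn (fun s => w s j) (Icc 0 T))
    (hd : ∀ j ∈ J, ∀ t ∈ Ico 0 T, HasDerivWithinAt (fun s => w s j) (w' t j) (Ici t) t)
    (hw' : ∀ j ∈ J, ∀ t ∈ Ico 0 T, 0 ≤ w t j →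
      w' t j ≤ L * (max (w t (j - 1)) 0 + max (w t (j + 1)) 0 + w t j))
    (h0 : ∀ j ∈ J, w 0 j ≤ A j)
    (hout : ∀ j, j ∉ J → ∀ t ∈ Icc 0 T, w t j ≤ A j * Real.exp ((5 * L + 1) * t))
    (hB : ∀ t ∈ Icc 0 T, ∀ j, w t j ≤ B) :
    ∀ t ∈ Icc 0 T, ∀ j, w t j ≤ A j * Real.exp ((5 * L + 1) * t) := by
  set C := 5 * L + 1 with hC
  have hCpos : 0 < C := by positivity
  set B₁ := max B 1 with hB₁
  have hB₁pos : 0 < B₁ := lt_of_lt_of_le one_pos (le_max_right _ _)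
  -- On an infinite lattice a maximum need not be attained, so the bound is proved with a slack that
  -- is halved at each stage. Where the bound with the halved slack is touched, the neighbours obey
  -- the previous one; as `A` at most doubles, they are at most twice the touching value. The growth
  -- rate is thus at most `5L`, less than `C`.
  have key : ∀ n : ℕ, ∀ t ∈ Icc 0 T, ∀ j, w t j ≤ (A j + B₁ / 2 ^ n) * Real.exp (C * t) := by
    intro n
    induction n with
    | zero =>
      intro t ht j
      have h1 : 1 ≤ Real.exp (C * t) := Real.one_le_exp (mul_nonneg hCpos.le ht.1)
      have h2 : w t j ≤ B₁ := (hB t ht j).trans (le_max_left _ _)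
      have h3 := hA0 j
      simp only [pow_zero, div_one]
      nlinarith [mul_nonneg (add_nonneg h3 hB₁pos.le) (sub_nonneg.2 h1)]
    | succ n ih =>
      intro t ht j
      have hκ : 0 < B₁ / 2 ^ n := by positivity
      have hκ2 : B₁ / 2 ^ (n + 1) = B₁ / 2 ^ n / 2 := by rw [pow_succ]; field_simp
      rw [hκ2]
      generalize B₁ / 2 ^ n = κ at *
      by_cases hj : j ∈ J
      · have hBd : ∀ x, HasDerivAt (fun x => (A j + κ / 2) * Real.exp (C * x))
            ((A j + κ / 2) * (C * Real.exp (C * x))) x := by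
          intro x
          have := ((hasDerivAt_id x).const_mul C).exp.const_mul (A j + κ / 2)
          simpa [mul_comm] using this
        refine image_le_of_deriv_right_lt_deriv_boundary (f' := fun t => w' t j) (hc j hj) (hd j hj)
          ?_ hBd ?_ ht
        · have := h0 j hj
          simp only [mul_zero, Real.exp_zero, mul_one]
          linarith
        · intro x hx hwx
          have hE := Real.exp_pos (C * x)
          have hAj := hA0 j
          have hpos : 0 < (A j + κ / 2) * Real.exp (C * x) := by positivity
          have hx' : x ∈ Icc 0 T := ⟨hx.1, hx.2.le⟩
          have h1 := hw' j hj x hx (by rw [hwx]; exact hpos.le)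
          have h2 : max (w x (j - 1)) 0 ≤ (2 * A j + κ) * Real.exp (C * x) := by
            refine max_le ((ih x hx' (j - 1)).trans ?_) (by positivity)
            have := (hA j hj).2
            gcongr
          have h3 : max (w x (j + 1)) 0 ≤ (2 * A j + κ) * Real.exp (C * x) := by
            refine max_le ((ih x hx' (j + 1)).trans ?_) (by positivity)
            have := (hA j hj).1
            gcongr
          have h4 : w' x j ≤ L * (5 * ((A j + κ / 2) * Real.exp (C * x))) := by
            refine h1.trans (mul_le_mul_of_nonneg_left ?_ hL)
            rw [hwx]; linarith
          calc w' x j ≤ L * (5 * ((A j + κ / 2) * Real.exp (C * x))) := h4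
            _ < C * ((A j + κ / 2) * Real.exp (C * x)) := by rw [hC]; linarith
            _ = _ := by ring
      · refine (hout j hj t ht).trans ?_
        gcongr
        linarith
  intro t ht j
  have hlim : Tendsto (fun n : ℕ => (A j + B₁ / 2 ^ n) * Real.exp (C * t)) atTop
      (𝓝 ((A j + 0) * Real.exp (C * t))) := by
    refine Tendsto.mul_const _ (tendsto_const_nhds.add ?_)
    exact tendsto_const_nhds.div_atTop (tendsto_pow_atTop_atTop_of_one_lt one_lt_two)
  rw [add_zero] at hlim
  exact ge_of_tendsto' hlim fun n => key n t ht j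

/-! ### The lattice equation with general nonlinearities -/

/-- The right-hand side of the equation at the site `j`. -/
def force (g ψ : ℝ → ℝ) (c : ℝ) (u : ℤ → ℝ) (j : ℤ) : ℝ :=
  g (u (j + 1) - u j) - g (u j - u (j - 1)) + ψ (u j) + c

/-- Solutions on the time interval `[0, T]`, with locally bounded displacement. -/
structure SolvesOn (g ψ f : ℝ → ℝ) (T : ℝ) (U : ℝ → ℤ → ℝ) : Prop where
  hderiv : ∀ t ∈ Icc 0 T, ∀ j,
    HasDerivWithinAt (fun s => U s j) (force g ψ (f t) (U t) j) (Icc 0 T) t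
  bdd : ∃ C, ∀ t ∈ Icc 0 T, ∀ j, |U t j - U 0 j| ≤ C

/-- A monotone Lipschitz interaction and a Lipschitz on-site force. -/
structure MonoLip (g ψ : ℝ → ℝ) (L : ℝ) : Prop where
  nonneg : 0 ≤ L
  mono : Monotone g
  lip : ∀ p q, q ≤ p → g p - g q ≤ L * (p - q)
  lip_site : ∀ p q, |ψ p - ψ q| ≤ L * |p - q|

variable {g ψ f : ℝ → ℝ} {L T : ℝ} {U V : ℝ → ℤ → ℝ}

/-- Monotonicity makes the increment nonpositive when `p ≤ q`. This one-sided form is what makes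
differences of solutions satisfy a cooperative inequality. -/
lemma MonoLip.sub_le (h : MonoLip g ψ L) (p q : ℝ) : g p - g q ≤ L * max (p - q) 0 := by
  rcases le_total q p with hqp | hqp
  · rw [max_eq_left (by linarith)]; exact h.lip p q hqp
  · rw [max_eq_right (by linarith)]
    have := h.mono hqp
    linarith

lemma MonoLip.abs_sub_le (h : MonoLip g ψ L) (p q : ℝ) : |g p - g q| ≤ L * |p - q| := by
  rw [abs_le]
  have h1 := h.sub_le p q
  have h2 := h.sub_le q p
  have h3 : max (p - q) 0 ≤ |p - q| := max_le (le_abs_self _) (abs_nonneg _)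
  have h4 : max (q - p) 0 ≤ |p - q| := max_le (by rw [abs_sub_comm]; exact le_abs_self _) (abs_nonneg _)
  have h5 := mul_le_mul_of_nonneg_left h3 h.nonneg
  have h6 := mul_le_mul_of_nonneg_left h4 h.nonneg
  constructor <;> linarith

/-- Cooperativity: a nonnegative difference can be pushed up only by itself and by the positive
parts of the neighbouring differences. This is the differential inequality required by
`lattice_max_principle`. -/
lemma MonoLip.force_sub_le (h : MonoLip g ψ L) (c : ℝ) (u v : ℤ → ℝ) (j : ℤ) (hj : 0 ≤ u j - v j) :
    force g ψ c u j - force g ψ c v j ≤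
      L * (max (u (j - 1) - v (j - 1)) 0 + max (u (j + 1) - v (j + 1)) 0 + (u j - v j)) := by
  have h1 := h.sub_le (u (j + 1) - u j) (v (j + 1) - v j)
  have h2 := h.sub_le (v j - v (j - 1)) (u j - u (j - 1))
  have h3 := (abs_le.1 (h.lip_site (u j) (v j))).2
  rw [abs_of_nonneg hj] at h3
  have h4 : max (u (j + 1) - u j - (v (j + 1) - v j)) 0 ≤ max (u (j + 1) - v (j + 1)) 0 :=
    max_le_max (by linarith) le_rfl
  have h5 : max (v j - v (j - 1) - (u j - u (j - 1))) 0 ≤ max (u (j - 1) - v (j - 1)) 0 :=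
    max_le_max (by linarith) le_rfl
  have h6 := mul_le_mul_of_nonneg_left h4 h.nonneg
  have h7 := mul_le_mul_of_nonneg_left h5 h.nonneg
  unfold force
  linarith

lemma SolvesOn.continuousOn (hU : SolvesOn g ψ f T U) (j : ℤ) :
    ContinuousOn (fun s => U s j) (Icc 0 T) :=
  fun t ht => (hU.hderiv t ht j).continuousWithinAt

lemma SolvesOn.deriv_right (hU : SolvesOn g ψ f T U) {t : ℝ} (ht : t ∈ Ico 0 T) (j : ℤ) :
    HasDerivWithinAt (fun s => U s j) (force g ψ (f t) (U t) j) (Ici t) t :=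
  (hU.hderiv t ⟨ht.1, ht.2.le⟩ j).mono_of_mem_nhdsWithin
    (mem_nhdsWithin_of_mem_nhds_inter ht) where
  mem_nhdsWithin_of_mem_nhds_inter {t : ℝ} (ht : t ∈ Ico 0 T) : Icc 0 T ∈ 𝓝[Ici t] t :=
    mem_of_superset (Icc_mem_nhdsGE ht.2) (Icc_subset_Icc_left ht.1)

lemma SolvesOn.mono (hU : SolvesOn g ψ f T U) {T' : ℝ} (hT : T' ≤ T) : SolvesOn g ψ f T' U where
  hderiv t ht j := (hU.hderiv t ⟨ht.1, ht.2.trans hT⟩ j).mono (Icc_subset_Icc_right hT)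
  bdd := hU.bdd.imp fun _ h t ht => h t ⟨ht.1, ht.2.trans hT⟩

/-- Comparison of two solutions with a weight, on a set `J` of sites. -/
theorem SolvesOn.sub_le_of_weight (h : MonoLip g ψ L) (hU : SolvesOn g ψ f T U)
    (hV : SolvesOn g ψ f T V) {J : Set ℤ} {A : ℤ → ℝ} {B : ℝ} (hA0 : ∀ j, 0 ≤ A j)
    (hA : ∀ j ∈ J, A (j + 1) ≤ 2 * A j ∧ A (j - 1) ≤ 2 * A j)
    (h0 : ∀ j ∈ J, U 0 j - V 0 j ≤ A j)
    (hout : ∀ j, j ∉ J → ∀ t ∈ Icc 0 T, U t j - V t j ≤ A j * Real.exp ((5 * L + 1) * t))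
    (hB : ∀ j, U 0 j - V 0 j ≤ B) :
    ∀ t ∈ Icc 0 T, ∀ j, U t j - V t j ≤ A j * Real.exp ((5 * L + 1) * t) := by
  obtain ⟨C, hC⟩ := hU.bdd
  obtain ⟨D, hD⟩ := hV.bdd
  refine lattice_max_principle (w := fun t j => U t j - V t j)
    (w' := fun t j => force g ψ (f t) (U t) j - force g ψ (f t) (V t) j) (B := B + C + D) h.nonneg
    hA0 hA (fun j _ => (hU.continuousOn j).sub (hV.continuousOn j))
    (fun j _ t ht => (hU.deriv_right ht j).sub (hV.deriv_right ht j))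
    (fun j _ t _ hj => h.force_sub_le _ _ _ _ hj) h0 hout fun t ht j => ?_
  have h1 := (abs_le.1 (hC t ht j)).2
  have h2 := (abs_le.1 (hD t ht j)).1
  have h3 := hB j
  linarith

theorem SolvesOn.le_of_le (h : MonoLip g ψ L) (hU : SolvesOn g ψ f T U) (hV : SolvesOn g ψ f T V)
    (h0 : ∀ j, U 0 j ≤ V 0 j) : ∀ t ∈ Icc 0 T, ∀ j, U t j ≤ V t j := by
  intro t ht j
  have := SolvesOn.sub_le_of_weight h hU hV (J := univ) (A := fun _ => 0) (B := 0)
    (fun _ => le_rfl) (by simp) (fun j _ => by simpa using h0 j) (by simp)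
    (fun j => by simpa using h0 j) t ht j
  simpa using this

theorem SolvesOn.eq_of_eq (h : MonoLip g ψ L) (hU : SolvesOn g ψ f T U) (hV : SolvesOn g ψ f T V)
    (h0 : ∀ j, U 0 j = V 0 j) : ∀ t ∈ Icc 0 T, ∀ j, U t j = V t j := fun t ht j =>
  le_antisymm (SolvesOn.le_of_le h hU hV (fun j => (h0 j).le) t ht j)
    (SolvesOn.le_of_le h hV hU (fun j => (h0 j).ge) t ht j)

/-- The difference of ordered solutions decays at most exponentially. -/
theorem SolvesOn.exp_le_sub (h : MonoLip g ψ L) (hU : SolvesOn g ψ f T U)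
    (hV : SolvesOn g ψ f T V) (h0 : ∀ j, U 0 j ≤ V 0 j) {t : ℝ} (ht : t ∈ Icc 0 T) (j : ℤ) :
    (V 0 j - U 0 j) * Real.exp (-(4 * L) * t) ≤ V t j - U t j := by
  have hle := SolvesOn.le_of_le h hU hV h0
  have hcont : ContinuousOn (fun s => (U s j - V s j) * Real.exp (4 * L * s)) (Icc 0 T) :=
    ((hU.continuousOn j).sub (hV.continuousOn j)).mul (by fun_prop)
  have hanti : ∀ s ∈ Icc 0 T, (U s j - V s j) * Real.exp (4 * L * s) ≤ U 0 j - V 0 j := by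
    intro s hs
    refine image_le_of_deriv_right_le_deriv_boundary (f' := fun s =>
      (force g ψ (f s) (U s) j - force g ψ (f s) (V s) j) * Real.exp (4 * L * s) +
        (U s j - V s j) * (Real.exp (4 * L * s) * (4 * L))) (B' := fun _ => 0) hcont
      (fun x hx => ?_) (by simp) continuousOn_const
      (fun x _ => hasDerivWithinAt_const _ _ _) (fun x hx => ?_) hs
    · refine ((hU.deriv_right hx j).sub (hV.deriv_right hx j)).mul ?_
      have := ((hasDerivAt_id x).const_mul (4 * L)).exp
      simpa using this.hasDerivWithinAt
    · have hx' : x ∈ Icc 0 T := ⟨hx.1, hx.2.le⟩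
      have hj := hle x hx' j
      have h1 := h.sub_le (U x (j + 1) - U x j) (V x (j + 1) - V x j)
      have h2 := h.sub_le (V x j - V x (j - 1)) (U x j - U x (j - 1))
      have h3 := (abs_le.1 (h.lip_site (U x j) (V x j))).2
      rw [abs_of_nonpos (by linarith)] at h3
      have h4 : max (U x (j + 1) - U x j - (V x (j + 1) - V x j)) 0 ≤ V x j - U x j :=
        max_le (by linarith [hle x hx' (j + 1)]) (by linarith)
      have h5 : max (V x j - V x (j - 1) - (U x j - U x (j - 1))) 0 ≤ V x j - U x j :=
        max_le (by linarith [hle x hx' (j - 1)]) (by linarith)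
      have h6 := mul_le_mul_of_nonneg_left h4 h.nonneg
      have h7 := mul_le_mul_of_nonneg_left h5 h.nonneg
      have h8 : force g ψ (f x) (U x) j - force g ψ (f x) (V x) j ≤ 4 * L * (V x j - U x j) := by
        have : 0 ≤ L * (V x j - U x j) := mul_nonneg h.nonneg (by linarith)
        unfold force; linarith
      have h9 := Real.exp_pos (4 * L * x)
      nlinarith [mul_le_mul_of_nonneg_right h8 h9.le]
  have h1 := hanti t ht
  have h2 : Real.exp (4 * L * t) * Real.exp (-(4 * L) * t) = 1 := by
    rw [← Real.exp_add]; simp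
  have h3 := Real.exp_pos (-(4 * L) * t)
  have h4 := mul_le_mul_of_nonneg_right h1 h3.le
  rw [mul_assoc, h2, mul_one] at h4
  linarith

/-- The properties of `g = W'`, `ψ = V'` and `f` that are used. -/
structure Admissible (g ψ f : ℝ → ℝ) : Prop where
  slope : ∃ δ : ℝ, 0 < δ ∧ ∀ p q, q ≤ p → δ * (p - q) ≤ g p - g q
  lip : ∀ G : ℝ, ∃ L, 0 ≤ L ∧ ∀ p q, |p| ≤ G → |q| ≤ G → |g p - g q| ≤ L * |p - q|
  lip_site : ∃ L, 0 ≤ L ∧ ∀ p q, |ψ p - ψ q| ≤ L * |p - q|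
  periodic_site : ∀ x, ψ (x + 1) = ψ x
  cont : Continuous f
  periodic : ∀ t, f (t + 1) = f t

lemma deriv_periodic {φ : ℝ → ℝ} (h : ∀ x, φ (x + 1) = φ x) (x : ℝ) :
    deriv φ (x + 1) = deriv φ x := by
  rw [← deriv_comp_add_const]
  congr 1
  funext y
  exact h y

lemma exists_lipschitz_on_Icc {φ : ℝ → ℝ} (h : ContDiff ℝ 1 φ) (G : ℝ) :
    ∃ L, 0 ≤ L ∧ ∀ p q, |p| ≤ G → |q| ≤ G → |φ p - φ q| ≤ L * |p - q| := by
  obtain ⟨M, hM⟩ := (isCompact_Icc (a := -G) (b := G)).exists_bound_of_continuousOn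
    (f := deriv φ) (h.continuous_deriv le_rfl).continuousOn
  refine ⟨max M 0, le_max_right _ _, fun p q hp hq => ?_⟩
  have := (convex_Icc (-G) G).norm_image_sub_le_of_norm_deriv_le (f := φ) (C := max M 0)
    (fun x _ => (h.differentiable one_ne_zero).differentiableAt)
    (fun x hx => (hM x hx).trans (le_max_left _ _)) (abs_le.1 hq) (abs_le.1 hp)
  simpa using this

/-- A constant force is also `1`-periodic, so from here on the DC and AC cases are treated alike. -/
lemma StandingAssumptions.admissible {W V f : ℝ → ℝ} (hA : StandingAssumptions W V f) :
    Admissible (deriv W) (deriv V) f where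
  slope := by
    obtain ⟨δ, hδ, h⟩ := hA.convex_W
    refine ⟨δ, hδ, fun p q hqp => ?_⟩
    have hd : Differentiable ℝ (deriv W) :=
      (((contDiff_succ_iff_deriv (n := 1)).1 hA.contDiff_W).2.2).differentiable one_ne_zero
    exact mul_sub_le_image_sub_of_le_deriv hd h hqp
  lip G := exists_lipschitz_on_Icc ((contDiff_succ_iff_deriv (n := 1)).1 hA.contDiff_W).2.2 G
  lip_site := by
    have hC : ContDiff ℝ 1 (deriv V) := ((contDiff_succ_iff_deriv (n := 1)).1 hA.contDiff_V).2.2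
    have hper : Function.Periodic (deriv (deriv V)) 1 :=
      deriv_periodic (deriv_periodic hA.periodic_V)
    obtain ⟨M, hM⟩ := (isCompact_Icc (a := (0 : ℝ)) (b := 1)).exists_bound_of_continuousOn
      (f := deriv (deriv V)) (hC.continuous_deriv le_rfl).continuousOn
    have hM' : ∀ x, ‖deriv (deriv V) x‖ ≤ max M 0 := fun x => by
      obtain ⟨y, hy, hxy⟩ := hper.exists_mem_Ico₀ one_pos x
      rw [hxy]
      exact (hM y ⟨hy.1, hy.2.le⟩).trans (le_max_left _ _)
    refine ⟨max M 0, le_max_right _ _, fun p q => ?_⟩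
    have := convex_univ.norm_image_sub_le_of_norm_deriv_le (f := deriv V) (C := max M 0)
      (fun x _ => (hC.differentiable one_ne_zero).differentiableAt)
      (fun x _ => hM' x) (mem_univ q) (mem_univ p)
    simpa using this
  periodic_site := deriv_periodic hA.periodic_V
  cont := by
    rcases hA.driving with ⟨c, hc⟩ | ⟨-, -, -, hf⟩
    · rw [show f = fun _ => c from funext hc]; exact continuous_const
    · exact continuousOn_univ.1 hf.continuousOn
  periodic := by
    rcases hA.driving with ⟨c, hc⟩ | ⟨h, -⟩
    · intro t; rw [hc, hc]
    · exact h

variable {g ψ f : ℝ → ℝ} {L T : ℝ} {U V : ℝ → ℤ → ℝ}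

lemma exists_bound_of_periodic {φ : ℝ → ℝ} (hφ : Continuous φ) (h : ∀ x, φ (x + 1) = φ x) :
    ∃ M, 0 ≤ M ∧ ∀ x, |φ x| ≤ M := by
  obtain ⟨M, hM⟩ := (isCompact_Icc (a := (0 : ℝ)) (b := 1)).exists_bound_of_continuousOn
    (f := φ) hφ.continuousOn
  refine ⟨max M 0, le_max_right _ _, fun x => ?_⟩
  obtain ⟨y, hy, hxy⟩ := Function.Periodic.exists_mem_Ico₀ (f := φ) h one_pos x
  rw [hxy]
  exact (hM y ⟨hy.1, hy.2.le⟩).trans (le_max_left _ _)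

lemma continuous_of_lip {φ : ℝ → ℝ} (h : ∀ p q, |φ p - φ q| ≤ L * |p - q|) : Continuous φ :=
  (LipschitzWith.of_dist_le' (K := L) fun p q => by simpa [Real.dist_eq] using h p q).continuous

lemma Admissible.exists_site_bound (h : Admissible g ψ f) : ∃ M, 0 ≤ M ∧ ∀ x, |ψ x| ≤ M := by
  obtain ⟨L, -, hL⟩ := h.lip_site
  exact exists_bound_of_periodic (continuous_of_lip hL) h.periodic_site

lemma Admissible.strictMono (h : Admissible g ψ f) : StrictMono g := by
  obtain ⟨δ, hδ, h⟩ := h.slope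
  intro q p hqp
  have := h p q hqp.le
  have : 0 < δ * (p - q) := mul_pos hδ (sub_pos.2 hqp)
  linarith

/-! ### Truncation of the interaction -/

/-- The interaction frozen outside `[-G, G]`. -/
noncomputable def trunc (G : ℝ) (g : ℝ → ℝ) (p : ℝ) : ℝ := g (max (-G) (min G p))

lemma trunc_of_abs_le {G p : ℝ} (h : |p| ≤ G) : trunc G g p = g p := by
  have := abs_le.1 h
  rw [trunc, min_eq_right this.2, max_eq_right this.1]

lemma abs_clamp_le {G : ℝ} (hG : 0 ≤ G) (p : ℝ) : |max (-G) (min G p)| ≤ G :=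
  abs_le.2 ⟨le_max_left _ _, max_le (by linarith) (min_le_left _ _)⟩

/-- Clamping is monotone and `1`-Lipschitz, so a Lipschitz bound on `[-G, G]` becomes global. This
gives access to comparison and to Picard–Lindelöf, although `g` is only locally Lipschitz; the
truncation is not felt by solutions whose gaps are at most `G`. -/
lemma Admissible.exists_monoLip (h : Admissible g ψ f) {G : ℝ} (hG : 0 ≤ G) :
    ∃ L, MonoLip (trunc G g) ψ L := by
  obtain ⟨L₁, hL₁, h₁⟩ := h.lip G
  obtain ⟨L₂, hL₂, h₂⟩ := h.lip_site
  refine ⟨max L₁ L₂, hL₁.trans (le_max_left _ _), fun p q hpq => h.strictMono.monotone ?_,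
    fun p q hqp => ?_, fun p q => (h₂ p q).trans ?_⟩
  · exact max_le_max le_rfl (min_le_min le_rfl hpq)
  · refine (le_abs_self _).trans ((h₁ _ _ (abs_clamp_le hG p) (abs_clamp_le hG q)).trans ?_)
    gcongr
    · exact le_max_left _ _
    · refine (abs_max_sub_max_le_max _ _ _ _).trans (max_le (by simpa using hqp) ?_)
      refine (abs_min_sub_min_le_max _ _ _ _).trans (max_le (by simpa using hqp) ?_)
      rw [abs_of_nonneg (by linarith)]
  · gcongr; exact le_max_right _ _

lemma Admissible.exists_trunc_bound (h : Admissible g ψ f) {G : ℝ} (hG : 0 ≤ G) :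
    ∃ M, 0 ≤ M ∧ ∀ p, |trunc G g p| ≤ M := by
  refine ⟨max |g G| |g (-G)|, by positivity, fun p => ?_⟩
  have h1 := abs_le.1 (abs_clamp_le hG p)
  exact abs_le_max_abs_abs (h.strictMono.monotone h1.1) (h.strictMono.monotone h1.2) |>.trans
    (by rw [max_comm])

lemma force_trunc {G c : ℝ} {u : ℤ → ℝ} (hu : ∀ j, |u (j + 1) - u j| ≤ G) (j : ℤ) :
    force (trunc G g) ψ c u j = force g ψ c u j := by
  have := hu (j - 1)
  rw [sub_add_cancel] at this
  rw [force, force, trunc_of_abs_le (hu j), trunc_of_abs_le this]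

lemma solvesOn_trunc_iff {G : ℝ} (hU : ∀ t ∈ Icc 0 T, ∀ j, |U t (j + 1) - U t j| ≤ G) :
    SolvesOn (trunc G g) ψ f T U ↔ SolvesOn g ψ f T U :=
  ⟨fun h => ⟨fun t ht j => by rw [← force_trunc (hU t ht)]; exact h.hderiv t ht j, h.bdd⟩,
    fun h => ⟨fun t ht j => by rw [force_trunc (hU t ht)]; exact h.hderiv t ht j, h.bdd⟩⟩

/-! ### Existence -/

/-- Picard–Lindelöf for the displacement `U - u` in `ℓ^∞(ℤ)`: the field is bounded there, and
`5L`-Lipschitz, with `2L` from each of the two bonds and `L` from the site force. -/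
theorem exists_solvesOn (h : MonoLip g ψ L) {M : ℝ} (hg : ∀ p, |g p| ≤ M) (hψ : ∀ p, |ψ p| ≤ M)
    (hf : Continuous f) (hT : 0 ≤ T) (u : ℤ → ℝ) : ∃ U, SolvesOn g ψ f T U ∧ U 0 = u := by
  obtain ⟨N, hN⟩ := (isCompact_Icc (a := (0 : ℝ)) (b := T)).exists_bound_of_continuousOn
    (f := f) hf.continuousOn
  have hM : 0 ≤ M := (abs_nonneg _).trans (hg 0)
  have hN0 : 0 ≤ N := (norm_nonneg _).trans (hN 0 ⟨le_rfl, hT⟩)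
  have hbd : ∀ (c : ℝ) (v : ℤ → ℝ) (j : ℤ), ‖force g ψ c v j‖ ≤ 3 * M + |c| := by
    intro c v j
    have h1 := abs_le.1 (hg (v (j + 1) - v j))
    have h2 := abs_le.1 (hg (v j - v (j - 1)))
    have h3 := abs_le.1 (hψ (v j))
    have h4 := neg_abs_le c
    have h5 := le_abs_self c
    rw [Real.norm_eq_abs, abs_le, force]
    constructor <;> linarith [h1.1, h1.2, h2.1, h2.2, h3.1, h3.2]
  let F : ℝ → BoundedContinuousFunction ℤ ℝ → BoundedContinuousFunction ℤ ℝ := fun t x =>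
    BoundedContinuousFunction.ofNormedAddCommGroupDiscrete (fun j => force g ψ (f t) (fun i => u i + x i) j)
      (3 * M + |f t|) (hbd _ _)
  -- The radius of the ball is the speed bound times `T`, so that one application covers all of `[0,
  -- T]`.
  have hP : IsPicardLindelof F (tmin := 0) (tmax := T) ⟨0, le_rfl, hT⟩ 0
      (Real.toNNReal ((3 * M + N) * T)) 0 (Real.toNNReal (3 * M + N)) (Real.toNNReal (5 * L)) := by
    refine ⟨fun t _ => LipschitzWith.lipschitzOnWith ?_, fun x _ => ?_, fun t ht x _ => ?_, ?_⟩
    · refine LipschitzWith.of_dist_le_mul fun x y => ?_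
      rw [Real.coe_toNNReal _ (by have := h.nonneg; positivity), BoundedContinuousFunction.dist_le
        (by have := h.nonneg; positivity)]
      intro j
      have hxy : ∀ i, |x i - y i| ≤ dist x y := fun i => by
        rw [← Real.dist_eq]; exact BoundedContinuousFunction.dist_coe_le_dist i
      have h1 := h.abs_sub_le (u (j + 1) + x (j + 1) - (u j + x j)) (u (j + 1) + y (j + 1) - (u j + y j))
      have h2 := h.abs_sub_le (u j + x j - (u (j - 1) + x (j - 1))) (u j + y j - (u (j - 1) + y (j - 1)))
      have h3 := h.lip_site (u j + x j) (u j + y j)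
      have e1 : |u (j + 1) + x (j + 1) - (u j + x j) - (u (j + 1) + y (j + 1) - (u j + y j))| ≤
          2 * dist x y := by
        have := abs_le.1 (hxy (j + 1)); have := abs_le.1 (hxy j)
        rw [abs_le]; constructor <;> linarith
      have e2 : |u j + x j - (u (j - 1) + x (j - 1)) - (u j + y j - (u (j - 1) + y (j - 1)))| ≤
          2 * dist x y := by
        have := abs_le.1 (hxy (j - 1)); have := abs_le.1 (hxy j)
        rw [abs_le]; constructor <;> linarith
      have e3 : |u j + x j - (u j + y j)| ≤ dist x y := by
        simpa using hxy j
      have f1 := abs_le.1 (h1.trans (mul_le_mul_of_nonneg_left e1 h.nonneg))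
      have f2 := abs_le.1 (h2.trans (mul_le_mul_of_nonneg_left e2 h.nonneg))
      have f3 := abs_le.1 (h3.trans (mul_le_mul_of_nonneg_left e3 h.nonneg))
      change dist (force g ψ (f t) (fun i => u i + x i) j) (force g ψ (f t) (fun i => u i + y i) j) ≤ _
      rw [Real.dist_eq, abs_le, force, force]
      constructor <;> linarith [f1.1, f1.2, f2.1, f2.2, f3.1, f3.2]
    · refine Continuous.continuousOn (continuous_iff_continuousAt.2 fun t => ?_)
      refine tendsto_iff_dist_tendsto_zero.2 (squeeze_zero (fun _ => dist_nonneg) (g := fun s => |f s - f t|)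
        (fun s => ?_) ?_)
      · rw [BoundedContinuousFunction.dist_le (abs_nonneg _)]
        intro j
        change dist (force g ψ (f s) (fun i => u i + x i) j) (force g ψ (f t) (fun i => u i + x i) j) ≤ _
        rw [Real.dist_eq, force, force]
        ring_nf
        exact le_rfl
      · have : Tendsto (fun s => |f s - f t|) (𝓝 t) (𝓝 |f t - f t|) :=
          ((hf.sub continuous_const).abs).tendsto t
        simpa using this
    · rw [Real.coe_toNNReal _ (by positivity), BoundedContinuousFunction.norm_le (by positivity)]
      have hNt : |f t| ≤ N := hN t ht
      exact fun j => (hbd (f t) (fun i => u i + x i) j).trans (by linarith)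
    · rw [Real.coe_toNNReal _ (by positivity), Real.coe_toNNReal _ (by positivity)]
      simp [hT]
  obtain ⟨α, hα0, hα⟩ := hP.exists_eq_forall_mem_Icc_hasDerivWithinAt₀
  have hα0' : α 0 = 0 := hα0
  refine ⟨fun t j => u j + α t j, ⟨fun t ht j => ?_, ?_⟩, ?_⟩
  · have := ((BoundedContinuousFunction.evalCLM ℝ j).hasFDerivAt.comp_hasDerivWithinAt t (hα t ht)).const_add (u j)
    exact this
  · have hcont : ContinuousOn α (Icc 0 T) := fun t ht => (hα t ht).continuousWithinAt
    obtain ⟨C, hC⟩ := isCompact_Icc.exists_bound_of_continuousOn hcont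
    refine ⟨C, fun t ht j => ?_⟩
    have := (BoundedContinuousFunction.norm_coe_le_norm (α t) j).trans (hC t ht)
    simpa [hα0'] using this
  · funext j
    simp [hα0']

/-! ### Width -/

/-- Bounded width with an explicit bound. -/
def WidthLE (ρ K : ℝ) (u : ℤ → ℝ) : Prop :=
  ∀ m n : ℤ, |u m - u n - ((m : ℝ) - (n : ℝ)) * ρ| ≤ K

lemma WidthLE.gap {ρ K : ℝ} {u : ℤ → ℝ} (h : WidthLE ρ K u) (j : ℤ) :
    |u (j + 1) - u j| ≤ |ρ| + K := by
  have h1 := abs_le.1 (h (j + 1) j)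
  push_cast at h1
  have h2 := neg_abs_le ρ
  have h3 := le_abs_self ρ
  rw [abs_le]
  constructor <;> linarith [h1.1, h1.2]

lemma WidthLE.nonneg {ρ K : ℝ} {u : ℤ → ℝ} (h : WidthLE ρ K u) : 0 ≤ K :=
  (abs_nonneg _).trans (h 0 0)

lemma WidthLE.shift {ρ K : ℝ} {u : ℤ → ℝ} (h : WidthLE ρ K u) (m : ℤ) :
    WidthLE ρ K (fun j => u (j - m)) := fun a b => by
  have := h (a - m) (b - m)
  push_cast at this
  simpa using this

lemma WidthLE.add_const {ρ K : ℝ} {u : ℤ → ℝ} (h : WidthLE ρ K u) (c : ℝ) :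
    WidthLE ρ K (fun j => u j + c) := fun a b => by
  have := h a b
  simpa using this

lemma SolvesOn.shift (h : SolvesOn g ψ f T U) (m : ℤ) :
    SolvesOn g ψ f T (fun t j => U t (j - m)) where
  hderiv t ht j := by
    have := h.hderiv t ht (j - m)
    unfold force at this ⊢
    beta_reduce
    rw [show j + 1 - m = j - m + 1 by ring, show j - 1 - m = j - m - 1 by ring]
    exact this
  bdd := h.bdd.imp fun C hC t ht j => hC t ht (j - m)

lemma SolvesOn.add_int (h : SolvesOn g ψ f T U) (hψ : ∀ x, ψ (x + 1) = ψ x) (n : ℤ) :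
    SolvesOn g ψ f T (fun t j => U t j + n) where
  hderiv t ht j := by
    have := (h.hderiv t ht j).add_const (n : ℝ)
    have hper : ψ (U t j + n) = ψ (U t j) := by
      have := Function.Periodic.int_mul (f := ψ) (c := 1) hψ n (U t j)
      simpa using this
    unfold force at this ⊢
    rw [hper]
    simpa using this
  bdd := h.bdd.imp fun C hC t ht j => by simpa using hC t ht j

/-- A spatial translate of the solution starts below an integer translate of it, hence stays below.
Rounding to an integer costs the extra `1`, which does not accumulate in time. -/
theorem SolvesOn.widthLE (h : MonoLip g ψ L) (hψ : ∀ x, ψ (x + 1) = ψ x)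
    (hU : SolvesOn g ψ f T U) {ρ K : ℝ} (h0 : WidthLE ρ K (U 0)) {t : ℝ} (ht : t ∈ Icc 0 T) :
    WidthLE ρ (K + 1) (U t) := by
  have key : ∀ a b : ℤ, U t a - U t b ≤ ((a : ℝ) - b) * ρ + K + 1 := by
    intro a b
    set N : ℤ := ⌈((a : ℝ) - b) * ρ + K⌉ with hN
    have := SolvesOn.le_of_le h (hU.shift (b - a)) (hU.add_int hψ N) (fun j => ?_) t ht b
    · rw [sub_sub_cancel] at this
      have h1 := Int.ceil_lt_add_one (((a : ℝ) - b) * ρ + K)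
      rw [← hN] at h1
      linarith
    · have h1 := (abs_le.1 (h0 (j - (b - a)) j)).2
      have h2 := Int.le_ceil (((a : ℝ) - b) * ρ + K)
      rw [← hN] at h2
      push_cast at h1
      linarith
  intro a b
  have h1 := key a b
  have h2 := key b a
  rw [abs_le]
  constructor <;> linarith

section Solutions

variable {g ψ f : ℝ → ℝ} {L T : ℝ} {U V : ℝ → ℤ → ℝ}

lemma SolvesOn.exists_trunc (hU : SolvesOn g ψ f T U) {ρ K : ℝ} (hw : WidthLE ρ K (U 0)) :
    ∃ G₀, 0 ≤ G₀ ∧ ∀ G, G₀ ≤ G → SolvesOn (trunc G g) ψ f T U := by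
  obtain ⟨C, hC⟩ := hU.bdd
  refine ⟨max 0 (|ρ| + K + 2 * C), le_max_left _ _, fun G hG => ?_⟩
  refine (solvesOn_trunc_iff fun t ht j => le_trans ?_ ((le_max_right _ _).trans hG)).2 hU
  have h1 := abs_le.1 (hC t ht (j + 1))
  have h2 := abs_le.1 (hC t ht j)
  have h3 := abs_le.1 (hw.gap j)
  rw [abs_le]
  constructor <;> linarith [h1.1, h1.2, h2.1, h2.2, h3.1, h3.2]

lemma SolvesOn.exists_common_trunc (h : Admissible g ψ f) (hU : SolvesOn g ψ f T U)
    (hV : SolvesOn g ψ f T V) {ρ K ρ' K' : ℝ} (hw : WidthLE ρ K (U 0)) (hw' : WidthLE ρ' K' (V 0)) :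
    ∃ G L, MonoLip (trunc G g) ψ L ∧ SolvesOn (trunc G g) ψ f T U ∧
      SolvesOn (trunc G g) ψ f T V := by
  obtain ⟨G₁, h₁, hG₁⟩ := hU.exists_trunc hw
  obtain ⟨G₂, h₂, hG₂⟩ := hV.exists_trunc hw'
  obtain ⟨L, hL⟩ := h.exists_monoLip (h₁.trans (le_max_left G₁ G₂))
  exact ⟨_, L, hL, hG₁ _ (le_max_left _ _), hG₂ _ (le_max_right _ _)⟩

lemma SolvesOn.widthLE_of_admissible (h : Admissible g ψ f) (hU : SolvesOn g ψ f T U) {ρ K : ℝ}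
    (hw : WidthLE ρ K (U 0)) {t : ℝ} (ht : t ∈ Icc 0 T) : WidthLE ρ (K + 1) (U t) := by
  obtain ⟨G, h₁, hG⟩ := hU.exists_trunc hw
  obtain ⟨L, hL⟩ := h.exists_monoLip h₁
  exact (hG _ le_rfl).widthLE hL h.periodic_site hw ht

/-- In contrast to `SolvesOn.exists_trunc`, the cutoff depends only on the spacing and the initial
width, neither on `T` nor on the solution. Estimates uniform over configurations of a given width
rest on this. -/
lemma SolvesOn.trunc_of_width (h : Admissible g ψ f) (hU : SolvesOn g ψ f T U) {ρ K G : ℝ}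
    (hw : WidthLE ρ K (U 0)) (hG : |ρ| + K + 1 ≤ G) : SolvesOn (trunc G g) ψ f T U :=
  (solvesOn_trunc_iff fun _ ht j => ((hU.widthLE_of_admissible h hw ht).gap j).trans
    (by linarith)).2 hU

/-- Initial values of bounded width have solutions on all of `[0, ∞)`. -/
theorem Admissible.exists_global (h : Admissible g ψ f) {ρ K : ℝ} {u : ℤ → ℝ}
    (hu : WidthLE ρ K u) : ∃ U : ℝ → ℤ → ℝ, U 0 = u ∧ ∀ T, SolvesOn g ψ f T U := by
  have hG : 0 ≤ |ρ| + K + 1 := by have := hu.nonneg; positivity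
  set G := |ρ| + K + 1 with hGdef
  obtain ⟨L, hL⟩ := h.exists_monoLip hG
  obtain ⟨M₁, -, hM₁⟩ := h.exists_trunc_bound hG
  obtain ⟨M₂, -, hM₂⟩ := h.exists_site_bound
  have hex : ∀ T : ℝ, ∃ U, 0 ≤ T → SolvesOn (trunc G g) ψ f T U ∧ U 0 = u := fun T => by
    by_cases hT : 0 ≤ T
    · obtain ⟨U, hU⟩ := exists_solvesOn hL (M := max M₁ M₂) (fun p => (hM₁ p).trans (le_max_left _ _))
        (fun p => (hM₂ p).trans (le_max_right _ _)) h.cont hT u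
      exact ⟨U, fun _ => hU⟩
    · exact ⟨fun _ => u, fun h => absurd h hT⟩
  choose S hS using hex
  have hagree : ∀ T T' t, 0 ≤ t → t ≤ T → t ≤ T' → S T t = S T' t := by
    intro T T' t h0 h1 h2
    funext j
    have hT := hS T (h0.trans h1)
    have hT' := hS T' (h0.trans h2)
    exact SolvesOn.eq_of_eq hL (hT.1.mono h1) (hT'.1.mono h2) (fun j => by rw [hT.2, hT'.2]) t
      ⟨h0, le_rfl⟩ j
  have h00 : S (0 + 1) 0 = u := (hS (0 + 1) (by norm_num)).2
  refine ⟨fun t => S (t + 1) t, h00, fun T => ⟨fun t ht j => ?_, ?_⟩⟩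
  · have h1 := (hS (T + 1) (by linarith [ht.1, ht.2])).1
    have h0 := (hS (T + 1) (by linarith [ht.1, ht.2])).2
    have h2 := (h1.mono (by linarith : T ≤ T + 1)).hderiv t ht j
    have heq : ∀ s ∈ Icc 0 T, S (s + 1) s = S (T + 1) s := fun s hs =>
      hagree _ _ _ hs.1 (by linarith) (by linarith [hs.2])
    have hgap : ∀ j, |S (T + 1) t (j + 1) - S (T + 1) t j| ≤ G := fun j =>
      ((h1.widthLE hL h.periodic_site (h0 ▸ hu) ⟨ht.1, by linarith [ht.2]⟩).gap j).trans
        (by rw [hGdef]; linarith)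
    rw [force_trunc hgap] at h2
    rw [heq t ht]
    exact h2.congr (fun s hs => by rw [heq s hs]) (by rw [heq t ht])
  · rcases lt_or_ge T 0 with hT | hT
    · exact ⟨0, fun t ht => absurd (ht.1.trans ht.2) (not_le.2 hT)⟩
    · obtain ⟨C, hC⟩ := (hS T hT).1.bdd
      refine ⟨C, fun t ht j => ?_⟩
      rw [hagree (t + 1) T t ht.1 (by linarith) ht.2, hagree (0 + 1) T 0 le_rfl (by norm_num) hT]
      exact hC t ht j

end Solutions

/-! ### The flow -/

/-- Translation of a configuration by an integer. -/
def addInt (n : ℤ) (u : Config) : Config :=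
  ⟨fun j => u.1 j + n, u.2.imp fun _ ⟨K, hK⟩ => ⟨K, WidthLE.add_const hK _⟩⟩

@[simp] lemma addInt_apply (n : ℤ) (u : Config) (j : ℤ) : (addInt n u).1 j = u.1 j + n := rfl

@[simp] lemma shift_apply (n : ℤ) (u : Config) (j : ℤ) : (shift n u).1 j = u.1 (j - n) := rfl

lemma Config.exists_widthLE (u : Config) : ∃ ρ K, WidthLE ρ K u.1 := u.2

variable {W V f : ℝ → ℝ}

lemma IsSolution.solvesOn {U : ℝ → Config} (hU : IsSolution W V f U) (T : ℝ) :
    SolvesOn (deriv W) (deriv V) f T (fun t => (U t).1) where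
  hderiv t ht j := (hU.1 t ht.1 j).mono Icc_subset_Ici_self
  bdd := hU.2 T

lemma isSolution_of_solvesOn {U : ℝ → Config}
    (h : ∀ T, SolvesOn (deriv W) (deriv V) f T (fun t => (U t).1)) : IsSolution W V f U := by
  refine ⟨fun t ht j => ?_, fun T => (h T).bdd⟩
  refine ((h (t + 1)).hderiv t ⟨ht, by linarith⟩ j).mono_of_mem_nhdsWithin ?_
  have : Iio (t + 1) ∈ 𝓝 t := Iio_mem_nhds (by linarith)
  filter_upwards [self_mem_nhdsWithin, mem_nhdsWithin_of_mem_nhds this] with s hs hs'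
  exact ⟨hs, (le_of_lt hs')⟩

lemma exists_isSolution (hA : StandingAssumptions W V f) (u : Config) :
    ∃ U : ℝ → Config, IsSolution W V f U ∧ U 0 = u := by
  obtain ⟨ρ, K, hu⟩ := u.exists_widthLE
  obtain ⟨U, hU0, hU⟩ := hA.admissible.exists_global hu
  have hw : ∀ t, 0 ≤ t → WidthLE ρ (K + 1) (U t) := fun t ht =>
    (hU t).widthLE_of_admissible hA.admissible (hU0 ▸ hu) ⟨ht, le_rfl⟩
  let U' : ℝ → Config := fun t => ⟨U (max 0 t), ρ, K + 1, hw _ (le_max_left _ _)⟩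
  refine ⟨U', isSolution_of_solvesOn fun T => ⟨fun t ht j => ?_, ?_⟩, Subtype.ext ?_⟩
  · have := (hU T).hderiv t ht j
    have e : ∀ s ∈ Icc 0 T, (U' s).1 = U s := fun s hs => by simp [U', hs.1]
    rw [e t ht]
    exact this.congr (fun s hs => by rw [e s hs]) (by rw [e t ht])
  · obtain ⟨C, hC⟩ := (hU T).bdd
    refine ⟨C, fun t ht j => ?_⟩
    have := hC t ht j
    simpa [U', ht.1] using this
  · simp [U', hU0]

lemma flow_isSolution (hA : StandingAssumptions W V f) (u : Config) :
    IsSolution W V f (fun t => flow W V f t u) := by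
  have h := exists_isSolution hA u
  have : (fun t => flow W V f t u) = h.choose := by
    funext t
    rw [flow, dif_pos h]
  rw [this]
  exact h.choose_spec.1

@[simp] lemma flow_zero (u : Config) : flow W V f 0 u = u := by
  unfold flow
  split_ifs with h
  · exact h.choose_spec.2
  · rfl

lemma flow_solvesOn (hA : StandingAssumptions W V f) (u : Config) (T : ℝ) :
    SolvesOn (deriv W) (deriv V) f T (fun t => (flow W V f t u).1) :=
  (flow_isSolution hA u).solvesOn T

lemma flow_widthLE (hA : StandingAssumptions W V f) {u : Config} {ρ K : ℝ} (hu : WidthLE ρ K u.1)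
    {t : ℝ} (ht : 0 ≤ t) : WidthLE ρ (K + 1) (flow W V f t u).1 :=
  (flow_solvesOn hA u t).widthLE_of_admissible hA.admissible (by simpa using hu) ⟨ht, le_rfl⟩

lemma flow_solvesOn_trunc (hA : StandingAssumptions W V f) {u : Config} {ρ K G : ℝ}
    (hu : WidthLE ρ K u.1) (hG : |ρ| + K + 1 ≤ G) (T : ℝ) :
    SolvesOn (trunc G (deriv W)) (deriv V) f T (fun t => (flow W V f t u).1) :=
  (flow_solvesOn hA u T).trunc_of_width hA.admissible (by simpa using hu) hG

/-- The flow is picked by choice, so its equivariance under translations and the composition law at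
integer times are all derived from this uniqueness. -/
lemma SolvesOn.eq_flow (hA : StandingAssumptions W V f) {T : ℝ} {U : ℝ → ℤ → ℝ}
    (hU : SolvesOn (deriv W) (deriv V) f T U) {u : Config} (h0 : U 0 = u.1) {t : ℝ}
    (ht : t ∈ Icc 0 T) : U t = (flow W V f t u).1 := by
  obtain ⟨ρ, K, hu⟩ := u.exists_widthLE
  obtain ⟨G, L, hL, h1, h2⟩ := SolvesOn.exists_common_trunc hA.admissible hU (flow_solvesOn hA u T)
    (h0 ▸ hu) (by simpa using hu)
  funext j
  exact SolvesOn.eq_of_eq hL h1 h2 (fun j => by rw [h0]; simp) t ht j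

lemma flow_shift (hA : StandingAssumptions W V f) (u : Config) (m : ℤ) {t : ℝ} (ht : 0 ≤ t) :
    flow W V f t (shift m u) = shift m (flow W V f t u) := by
  refine Subtype.ext (SolvesOn.eq_flow hA ((flow_solvesOn hA u t).shift m) ?_ ⟨ht, le_rfl⟩).symm
  funext j
  simp

lemma flow_addInt (hA : StandingAssumptions W V f) (u : Config) (n : ℤ) {t : ℝ} (ht : 0 ≤ t) :
    flow W V f t (addInt n u) = addInt n (flow W V f t u) := by
  refine Subtype.ext (SolvesOn.eq_flow hA
    ((flow_solvesOn hA u t).add_int hA.admissible.periodic_site n) ?_ ⟨ht, le_rfl⟩).symm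
  funext j
  simp

lemma flow_add_nat (hA : StandingAssumptions W V f) (u : Config) (m : ℕ) {t : ℝ} (ht : 0 ≤ t) :
    flow W V f (t + m) u = flow W V f t (flow W V f m u) := by
  have hper : ∀ s, f (s + m) = f s := fun s => by
    have := Function.Periodic.nat_mul (f := f) (c := 1) hA.admissible.periodic m s
    simpa using this
  have hS := flow_solvesOn hA u (t + m)
  have : SolvesOn (deriv W) (deriv V) f t (fun s => (flow W V f (s + m) u).1) := by
    refine ⟨fun s hs j => ?_, ?_⟩
    · have h1 := hS.hderiv (s + m) ⟨by have := hs.1; positivity, by linarith [hs.2]⟩ j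
      rw [hper] at h1
      have h2 : HasDerivWithinAt (fun s : ℝ => s + m) 1 (Icc 0 t) s :=
        (hasDerivAt_id s).add_const _ |>.hasDerivWithinAt
      have h3 := h1.comp (h := fun s : ℝ => s + m) s h2 (fun r hr =>
        ⟨by have := hr.1; positivity, by linarith [hr.2]⟩)
      simpa using! h3
    · obtain ⟨C, hC⟩ := hS.bdd
      refine ⟨2 * C, fun s hs j => ?_⟩
      have h1 := abs_le.1 (hC (s + m) ⟨by have := hs.1; positivity, by linarith [hs.2]⟩ j)
      have h2 := abs_le.1 (hC (0 + m) ⟨by positivity, by linarith⟩ j)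
      beta_reduce at h1 h2 ⊢
      rw [abs_le]
      constructor <;> linarith [h1.1, h1.2, h2.1, h2.2]
  exact Subtype.ext (this.eq_flow hA (by rw [zero_add]) ⟨ht, le_rfl⟩)

lemma flow_nat_succ (hA : StandingAssumptions W V f) (u : Config) (m : ℕ) :
    flow W V f ((m + 1 : ℕ) : ℝ) u = flow W V f 1 (flow W V f m u) := by
  rw [Nat.cast_succ, add_comm]
  exact flow_add_nat hA u m zero_le_one

lemma flow_exp_le_sub (hA : StandingAssumptions W V f) {u v : Config} (h : ∀ j, u.1 j ≤ v.1 j)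
    {T : ℝ} : ∃ L, ∀ t ∈ Icc 0 T, ∀ j, (v.1 j - u.1 j) * Real.exp (-(4 * L) * t) ≤
      (flow W V f t v).1 j - (flow W V f t u).1 j := by
  obtain ⟨ρ, K, hu⟩ := u.exists_widthLE
  obtain ⟨ρ', K', hv⟩ := v.exists_widthLE
  obtain ⟨G, L, hL, h1, h2⟩ := SolvesOn.exists_common_trunc hA.admissible (flow_solvesOn hA u T)
    (flow_solvesOn hA v T) (by simpa using hu) (by simpa using hv)
  refine ⟨L, fun t ht j => ?_⟩
  simpa using SolvesOn.exp_le_sub hL h1 h2 (fun j => by simpa using h j) ht j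

lemma flow_lt (hA : StandingAssumptions W V f) {u v : Config} (h : ∀ j, u.1 j < v.1 j) {t : ℝ}
    (ht : 0 ≤ t) (j : ℤ) : (flow W V f t u).1 j < (flow W V f t v).1 j := by
  obtain ⟨L, hL⟩ := flow_exp_le_sub hA (fun j => (h j).le) (T := t)
  have h1 := hL t ⟨ht, le_rfl⟩ j
  have h2 : 0 < (v.1 j - u.1 j) * Real.exp (-(4 * L) * t) :=
    mul_pos (sub_pos.2 (h j)) (Real.exp_pos _)
  linarith

/-- Locality: solutions of the same mean spacing that are close on a large window stay close
in its interior. -/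
theorem exists_flow_close (hA : StandingAssumptions W V f) (ρ K T : ℝ) :
    ∃ C, 0 < C ∧ ∀ u v : Config, WidthLE ρ K u.1 → WidthLE ρ K v.1 → ∀ (R : ℕ) (ε : ℝ), 0 ≤ ε →
      (∀ j : ℤ, |j| ≤ R → |u.1 j - v.1 j| ≤ ε) → ∀ t ∈ Icc 0 T, ∀ j : ℤ,
        |(flow W V f t u).1 j - (flow W V f t v).1 j| ≤
          C * (ε + (ε + 2 * K) * (2 ^ j.natAbs / 2 ^ R)) := by
  rcases lt_or_ge T 0 with hT | hT
  · exact ⟨1, one_pos, fun _ _ _ _ _ _ _ _ t ht => absurd (ht.1.trans ht.2) (not_le.2 hT)⟩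
  set G := max 0 (|ρ| + K + 1) with hG
  obtain ⟨L, hL⟩ := hA.admissible.exists_monoLip (le_max_left 0 (|ρ| + K + 1))
  refine ⟨Real.exp ((5 * L + 1) * T), Real.exp_pos _, ?_⟩
  have key : ∀ u v : Config, WidthLE ρ K u.1 → WidthLE ρ K v.1 → ∀ (R : ℕ) (ε : ℝ), 0 ≤ ε →
      (∀ j : ℤ, |j| ≤ R → |u.1 j - v.1 j| ≤ ε) → ∀ t ∈ Icc 0 T, ∀ j : ℤ,
        (flow W V f t u).1 j - (flow W V f t v).1 j ≤
          Real.exp ((5 * L + 1) * T) * (ε + (ε + 2 * K) * (2 ^ j.natAbs / 2 ^ R)) := by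
    intro u v hu hv R ε hε h t ht j
    have hK := hu.nonneg
    have hdiff : ∀ j, u.1 j - v.1 j ≤ ε + 2 * K := fun j => by
      have h1 := (abs_le.1 (hu j 0)).2
      have h2 := (abs_le.1 (hv j 0)).1
      have h3 := (abs_le.1 (h 0 (by simp))).2
      linarith
    have hdouble : ∀ i j : ℤ, i.natAbs ≤ j.natAbs + 1 →
        ε + (ε + 2 * K) * (2 ^ i.natAbs / 2 ^ R) ≤ 2 * (ε + (ε + 2 * K) * (2 ^ j.natAbs / 2 ^ R)) := by
      intro i j hij
      have : (2 : ℝ) ^ i.natAbs ≤ 2 * 2 ^ j.natAbs := by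
        rw [← pow_succ']; exact pow_le_pow_right₀ one_le_two hij
      have h1 : (2 : ℝ) ^ i.natAbs / 2 ^ R ≤ 2 * (2 ^ j.natAbs / 2 ^ R) := by
        rw [← mul_div_assoc]; gcongr
      nlinarith [mul_le_mul_of_nonneg_left h1 (by positivity : 0 ≤ ε + 2 * K)]
    -- The weight dominates `ε` inside the window. Outside it exceeds `ε + 2K`, which bounds the
    -- difference of two configurations of the same spacing that are `ε`-close at the site `0`. It
    -- at most doubles from site to site.
    have := SolvesOn.sub_le_of_weight hL
      (flow_solvesOn_trunc hA hu (le_max_right 0 _) T) (flow_solvesOn_trunc hA hv (le_max_right 0 _) T)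
      (J := univ) (A := fun j => ε + (ε + 2 * K) * (2 ^ j.natAbs / 2 ^ R)) (B := ε + 2 * K)
      (fun j => by positivity) (fun j _ => ⟨hdouble _ _ (by omega), hdouble _ _ (by omega)⟩)
      (fun j _ => ?_) (by simp) (fun j => by simpa using hdiff j) t ht j
    · refine this.trans ?_
      rw [mul_comm]
      gcongr
      · have := hL.nonneg; positivity
      · exact ht.2
    · simp only [flow_zero]
      rcases le_total j.natAbs R with hj | hj
      · have h1 := (abs_le.1 (h j (by rw [Int.abs_eq_natAbs]; exact_mod_cast hj))).2
        have : 0 ≤ (ε + 2 * K) * ((2 : ℝ) ^ j.natAbs / 2 ^ R) := by positivity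
        linarith
      · have h1 : (1 : ℝ) ≤ 2 ^ j.natAbs / 2 ^ R := by
          rw [one_le_div (by positivity)]; exact pow_le_pow_right₀ one_le_two hj
        have h2 := hdiff j
        nlinarith [mul_le_mul_of_nonneg_left h1 (by positivity : 0 ≤ ε + 2 * K)]
  intro u v hu hv R ε hε h t ht j
  rw [abs_le]
  have h1 := key u v hu hv R ε hε h t ht j
  have h2 := key v u hv hu R ε hε (fun j hj => by rw [abs_sub_comm]; exact h j hj) t ht j
  constructor <;> linarith

/-- Continuity of the flow in the product topology on configurations of uniformly bounded width. -/
theorem exists_flow_close_of_close (hA : StandingAssumptions W V f) (ρ K T : ℝ) (R : ℕ) {η : ℝ}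
    (hη : 0 < η) : ∃ (R' : ℕ) (ε : ℝ), 0 < ε ∧ ∀ u v : Config, WidthLE ρ K u.1 → WidthLE ρ K v.1 →
      (∀ j : ℤ, |j| ≤ R' → |u.1 j - v.1 j| ≤ ε) → ∀ t ∈ Icc 0 T, ∀ j : ℤ, |j| ≤ R →
        |(flow W V f t u).1 j - (flow W V f t v).1 j| ≤ η := by
  obtain ⟨C, hC, h⟩ := exists_flow_close hA ρ K T
  by_cases hK : K < 0
  · exact ⟨0, 1, one_pos, fun u v hu => absurd hu.nonneg (not_le.2 hK)⟩
  push Not at hK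
  obtain ⟨m, hm⟩ := exists_pow_lt_of_lt_one (show 0 < η / (2 * C * (1 + 2 * K)) by positivity)
    (by norm_num : (1 / 2 : ℝ) < 1)
  refine ⟨R + m, min 1 (η / (2 * C)), by positivity, fun u v hu hv huv t ht j hj => ?_⟩
  refine (h u v hu hv (R + m) _ (by positivity) huv t ht j).trans ?_
  have h1 : min 1 (η / (2 * C)) ≤ η / (2 * C) := min_le_right _ _
  have h1' : min 1 (η / (2 * C)) ≤ 1 := min_le_left _ _
  have h1'' : 0 ≤ min 1 (η / (2 * C)) := by positivity
  have h2 : (2 : ℝ) ^ j.natAbs / 2 ^ (R + m) ≤ (1 / 2) ^ m := by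
    rw [div_pow, one_pow, div_le_div_iff₀ (by positivity) (by positivity), one_mul, ← pow_add]
    refine pow_le_pow_right₀ one_le_two ?_
    rw [Int.abs_eq_natAbs] at hj
    have : j.natAbs ≤ R := by exact_mod_cast hj
    omega
  have h3 := h2.trans hm.le
  have h4 : 0 ≤ (2 : ℝ) ^ j.natAbs / 2 ^ (R + m) := by positivity
  generalize (2 : ℝ) ^ j.natAbs / 2 ^ (R + m) = q at h3 h4 ⊢
  calc C * (min 1 (η / (2 * C)) + (min 1 (η / (2 * C)) + 2 * K) * q)
      ≤ C * (η / (2 * C) + (1 + 2 * K) * (η / (2 * C * (1 + 2 * K)))) := by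
        gcongr
    _ = η := by
        have : 1 + 2 * K ≠ 0 := by positivity
        field_simp
        ring

/-! ### Topology of the space of configurations and of its quotient -/

lemma isQuotientMap_toChain : IsQuotientMap toChain := isQuotientMap_quotient_mk'

lemma continuous_toChain : Continuous toChain := isQuotientMap_toChain.continuous

lemma toChain_surjective : Function.Surjective toChain := isQuotientMap_toChain.surjective

lemma toChain_eq_iff {u v : Config} : toChain u = toChain v ↔ ∃ n : ℤ, v = addInt n u := by
  refine (Quotient.eq (r := translationSetoid)).trans ?_
  exact exists_congr fun n => ⟨fun h => Subtype.ext (funext h), fun h j => by rw [h]; rfl⟩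

@[simp] lemma toChain_addInt (n : ℤ) (u : Config) : toChain (addInt n u) = toChain u :=
  (toChain_eq_iff.2 ⟨n, rfl⟩).symm

lemma continuous_apply_config (j : ℤ) : Continuous fun u : Config => u.1 j :=
  (continuous_apply j).comp continuous_subtype_val

lemma continuous_addInt (n : ℤ) : Continuous (addInt n) :=
  Continuous.subtype_mk (continuous_pi fun j => (continuous_apply_config j).add continuous_const) _

lemma continuous_shift (n : ℤ) : Continuous (shift n) :=
  Continuous.subtype_mk (continuous_pi fun j => continuous_apply_config (j - n)) _

lemma preimage_image_toChain (O : Set Config) :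
    toChain ⁻¹' (toChain '' O) = {u | ∃ n : ℤ, addInt n u ∈ O} := by
  ext u
  constructor
  · rintro ⟨v, hv, h⟩
    obtain ⟨n, hn⟩ := toChain_eq_iff.1 h.symm
    exact ⟨n, hn ▸ hv⟩
  · rintro ⟨n, hn⟩
    exact ⟨_, hn, toChain_addInt n u⟩

lemma isOpenMap_toChain : IsOpenMap toChain := by
  intro O hO
  rw [← isQuotientMap_toChain.isOpen_preimage, preimage_image_toChain, ofPred_exists]
  exact isOpen_iUnion fun n => hO.preimage (continuous_addInt n)

instance : SecondCountableTopology Config :=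
  IsInducing.subtypeVal.secondCountableTopology

instance : SecondCountableTopology Chain :=
  isQuotientMap_toChain.secondCountableTopology isOpenMap_toChain

/-- The window neighbourhoods of a configuration. -/
def window (u : Config) (R : ℕ) (ε : ℝ) : Set Config := {v | ∀ j : ℤ, |j| ≤ R → |v.1 j - u.1 j| < ε}

lemma isOpen_window (u : Config) (R : ℕ) (ε : ℝ) : IsOpen (window u R ε) := by
  have : window u R ε = ⋂ j ∈ {j : ℤ | |j| ≤ R}, {v : Config | |v.1 j - u.1 j| < ε} := by
    ext v; simp [window]
  rw [this]
  have hfin : {j : ℤ | |j| ≤ R}.Finite :=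
    (Set.finite_Icc (-(R : ℤ)) R).subset fun j hj => abs_le.1 hj
  exact hfin.isOpen_biInter fun j _ =>
    isOpen_lt (((continuous_apply_config j).sub continuous_const).abs) continuous_const

lemma mem_window_self (u : Config) (R : ℕ) {ε : ℝ} (hε : 0 < ε) : u ∈ window u R ε :=
  fun j _ => by simpa using hε

lemma exists_window_subset {u : Config} {O : Set Config} (hO : O ∈ 𝓝 u) :
    ∃ (R : ℕ) (ε : ℝ), 0 < ε ∧ window u R ε ⊆ O := by
  obtain ⟨t, ht, htO⟩ := (mem_nhds_induced Subtype.val u O).1 hO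
  rw [nhds_pi, Filter.mem_pi] at ht
  obtain ⟨I, hI, s, hs, hst⟩ := ht
  choose ε hε hεs using fun j => Metric.mem_nhds_iff.1 (hs j)
  obtain ⟨R, hR⟩ : ∃ R : ℕ, ∀ j ∈ I, |j| ≤ R := by
    obtain ⟨M, hM⟩ := (hI.image Int.natAbs).bddAbove
    refine ⟨M, fun j hj => ?_⟩
    rw [Int.abs_eq_natAbs]
    exact_mod_cast hM ⟨j, hj, rfl⟩
  obtain ⟨η, hη, hηε⟩ : ∃ η > 0, ∀ j ∈ I, η ≤ ε j := by
    rcases hI.toFinset.eq_empty_or_nonempty with h | h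
    · refine ⟨1, one_pos, fun j hj => ?_⟩
      have := hI.mem_toFinset.2 hj
      simp [h] at this
    · obtain ⟨i, -, hi⟩ := hI.toFinset.exists_min_image ε h
      exact ⟨ε i, hε i, fun j hj => hi j (hI.mem_toFinset.2 hj)⟩
  refine ⟨R, η, hη, fun v hv => htO (hst fun j hj => hεs j ?_)⟩
  rw [Metric.mem_ball, Real.dist_eq]
  exact (hv j (hR j hj)).trans_le (hηε j hj)

lemma window_mem_nhds (u : Config) (R : ℕ) {ε : ℝ} (hε : 0 < ε) : window u R ε ∈ 𝓝 u :=
  (isOpen_window u R ε).mem_nhds (mem_window_self u R hε)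

@[simp] lemma chainShift_toChain (n : ℤ) (u : Config) :
    chainShift n (toChain u) = toChain (shift n u) := rfl

lemma continuous_chainShift (n : ℤ) : Continuous (chainShift n) :=
  isQuotientMap_toChain.continuous_iff.2 (continuous_toChain.comp (continuous_shift n))

lemma shift_shift (m n : ℤ) (u : Config) : shift m (shift n u) = shift (m + n) u :=
  Subtype.ext (funext fun j => by simp [sub_sub])

lemma shift_zero (u : Config) : shift 0 u = u := Subtype.ext (funext fun j => by simp)

lemma shift_addInt (m n : ℤ) (u : Config) : shift m (addInt n u) = addInt n (shift m u) := rfl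

variable {W V f : ℝ → ℝ}

lemma chainFlow_toChain (hA : StandingAssumptions W V f) {t : ℝ} (ht : 0 ≤ t) (u : Config) :
    chainFlow W V f t (toChain u) = toChain (flow W V f t u) := by
  have h : toChain (Quotient.out (toChain u)) = toChain u := Quotient.out_eq _
  obtain ⟨n, hn⟩ := toChain_eq_iff.1 h
  conv_rhs => rw [hn]
  rw [flow_addInt hA _ _ ht, toChain_addInt]
  rfl

lemma map_add_int_of_map_add_one {h : ℝ → ℝ} (h1 : ∀ s, h (s + 1) = h s + 1) (s : ℝ) (n : ℤ) :
    h (s + n) = h s + n := by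
  induction n using Int.induction_on with
  | zero => simp
  | succ n ih => push_cast at ih ⊢; rw [← add_assoc, h1, ih]; ring
  | pred n ih =>
    have := h1 (s + (-(n : ℤ) - 1 : ℤ))
    push_cast at ih this ⊢
    rw [show s + (-(n : ℝ) - 1) + 1 = s + -(n : ℝ) by ring, ih] at this
    linarith

lemma surjective_of_map_add_one {h : ℝ → ℝ} (hc : Continuous h) (h1 : ∀ s, h (s + 1) = h s + 1) :
    Function.Surjective h := by
  intro r
  have e1 := map_add_int_of_map_add_one h1 0 ⌊r - h 0⌋
  have e2 := map_add_int_of_map_add_one h1 0 (⌊r - h 0⌋ + 1)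
  have h3 := Int.floor_le (r - h 0)
  have h4 := Int.lt_floor_add_one (r - h 0)
  push_cast at e2
  refine mem_range_of_exists_le_of_exists_ge hc ⟨_, e1.trans_le ?_⟩ ⟨_, le_trans ?_ e2.ge⟩ <;> linarith

/-! ### Foliations -/

/-- An invariant foliation: a totally ordered family of configurations, parametrized by the value
at the site `0`, that is invariant under translations and the time-one map. The maps `pos j` (the
value of a leaf at the site `j`) and `step` (the time-one map in the leaf space) belong to a
uniformly equicontinuous group of lifts of circle homeomorphisms. -/
structure Foliation (W V f : ℝ → ℝ) (ρ : ℝ) where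
  leaf : ℝ → Config
  pos : ℤ → ℝ ≃o ℝ
  step : ℝ ≃o ℝ
  group : Subgroup (ℝ ≃o ℝ)
  width : ℝ
  leaf_apply : ∀ s j, (leaf s).1 j = pos j s
  pos_zero : ∀ s, pos 0 s = s
  shift_leaf : ∀ n s, shift n (leaf s) = leaf (pos (-n) s)
  flow_leaf : ∀ s, flow W V f 1 (leaf s) = leaf (step s)
  widthLE : ∀ s, WidthLE ρ width (leaf s).1
  pos_mem : ∀ j, pos j ∈ group
  step_mem : step ∈ group
  map_add_one : ∀ θ ∈ group, ∀ s, θ (s + 1) = θ s + 1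
  equicontinuous : ∀ ε > 0, ∃ δ > 0, ∀ θ ∈ group, ∀ s s', |s - s'| < δ → |θ s - θ s'| < ε

/-! ### Transformations of the leaf space that preserve the measure, and their equicontinuity -/

section Mass

variable {leaf : ℝ → Config} {μ : Measure Chain}

/-- The measure of the classes with a representative whose value at `0` is in `(a, b)`. -/
noncomputable def mass (μ : Measure Chain) (a b : ℝ) : ENNReal :=
  μ (toChain '' {u | a < u.1 0 ∧ u.1 0 < b})

lemma isOpen_arc (a b : ℝ) : IsOpen (toChain '' {u : Config | a < u.1 0 ∧ u.1 0 < b}) :=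
  isOpenMap_toChain _ ((isOpen_lt continuous_const (continuous_apply_config 0)).inter
    (isOpen_lt (continuous_apply_config 0) continuous_const))

lemma mem_arc_iff {a b : ℝ} {u : Config} : toChain u ∈ toChain '' {u : Config | a < u.1 0 ∧ u.1 0 < b} ↔
    ∃ n : ℤ, a < u.1 0 + n ∧ u.1 0 + n < b := by
  rw [← mem_preimage, preimage_image_toChain]
  rfl

lemma mass_mono {a b a' b' : ℝ} (ha : a' ≤ a) (hb : b ≤ b') : mass μ a b ≤ mass μ a' b' :=
  measure_mono (image_mono fun _ hu => ⟨ha.trans_lt hu.1, hu.2.trans_le hb⟩)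

lemma mass_add_int (a b : ℝ) (n : ℤ) : mass μ (a + n) (b + n) = mass μ a b := by
  unfold mass
  congr 1
  ext x
  obtain ⟨u, rfl⟩ := toChain_surjective x
  rw [mem_arc_iff, mem_arc_iff]
  constructor
  · rintro ⟨k, h1, h2⟩
    exact ⟨k - n, by push_cast; linarith, by push_cast; linarith⟩
  · rintro ⟨k, h1, h2⟩
    exact ⟨k + n, by push_cast; linarith, by push_cast; linarith⟩

/-- One-sided open arcs at `p` decrease to the empty set, since a class has at most one
representative in an arc of length at most one. The arcs leave out `p`, so nothing is claimed about
an atom there. -/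
lemma exists_mass_small [IsProbabilityMeasure μ] (p : ℝ) {β : ENNReal} (hβ : 0 < β) :
    ∃ r > 0, mass μ p (p + r) < β ∧ mass μ (p - r) p < β := by
  have hr : Tendsto (fun n : ℕ => mass μ p (p + 1 / ((n : ℝ) + 1))) atTop (𝓝 0) := by
    have hanti : Antitone fun n : ℕ =>
        toChain '' {u : Config | p < u.1 0 ∧ u.1 0 < p + 1 / ((n : ℝ) + 1)} := by
      intro m n hmn
      refine image_mono fun u hu => ⟨hu.1, hu.2.trans_le ?_⟩
      gcongr
    have := tendsto_measure_iInter_atTop (μ := μ)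
      (fun n : ℕ => (isOpen_arc p (p + 1 / ((n : ℝ) + 1))).measurableSet.nullMeasurableSet) hanti
      ⟨0, measure_ne_top _ _⟩
    suffices h : (⋂ n : ℕ, toChain '' {u : Config | p < u.1 0 ∧ u.1 0 < p + 1 / ((n : ℝ) + 1)}) = ∅ by
      rw [h, measure_empty] at this
      exact this
    rw [eq_empty_iff_forall_notMem]
    intro x hx
    obtain ⟨u, rfl⟩ := toChain_surjective x
    rw [mem_iInter] at hx
    obtain ⟨k, h1, h2⟩ := mem_arc_iff.1 (hx 0)
    obtain ⟨n, hn⟩ := exists_nat_one_div_lt (sub_pos.2 h1)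
    obtain ⟨l, h3, h4⟩ := mem_arc_iff.1 (hx n)
    have h5 : 1 / ((n : ℝ) + 1) ≤ 1 := by
      rw [div_le_one (by positivity)]; linarith [n.cast_nonneg (α := ℝ)]
    have : l = k := by
      norm_num at h2
      have e1 : (l : ℝ) < k + 1 := by linarith
      have e2 : (k : ℝ) < l + 1 := by linarith
      have e1' : l < k + 1 := by exact_mod_cast e1
      have e2' : k < l + 1 := by exact_mod_cast e2
      omega
    subst this
    linarith
  have hl : Tendsto (fun n : ℕ => mass μ (p - 1 / ((n : ℝ) + 1)) p) atTop (𝓝 0) := by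
    have hanti : Antitone fun n : ℕ =>
        toChain '' {u : Config | p - 1 / ((n : ℝ) + 1) < u.1 0 ∧ u.1 0 < p} := by
      intro m n hmn
      refine image_mono fun u hu => ⟨lt_of_le_of_lt ?_ hu.1, hu.2⟩
      gcongr
    have := tendsto_measure_iInter_atTop (μ := μ)
      (fun n : ℕ => (isOpen_arc (p - 1 / ((n : ℝ) + 1)) p).measurableSet.nullMeasurableSet) hanti
      ⟨0, measure_ne_top _ _⟩
    suffices h : (⋂ n : ℕ, toChain '' {u : Config | p - 1 / ((n : ℝ) + 1) < u.1 0 ∧ u.1 0 < p}) = ∅ by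
      rw [h, measure_empty] at this
      exact this
    rw [eq_empty_iff_forall_notMem]
    intro x hx
    obtain ⟨u, rfl⟩ := toChain_surjective x
    rw [mem_iInter] at hx
    obtain ⟨k, h1, h2⟩ := mem_arc_iff.1 (hx 0)
    obtain ⟨n, hn⟩ := exists_nat_one_div_lt (sub_pos.2 h2)
    obtain ⟨l, h3, h4⟩ := mem_arc_iff.1 (hx n)
    have h5 : 1 / ((n : ℝ) + 1) ≤ 1 := by
      rw [div_le_one (by positivity)]; linarith [n.cast_nonneg (α := ℝ)]
    have : l = k := by
      norm_num at h1
      have e1 : (l : ℝ) < k + 1 := by linarith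
      have e2 : (k : ℝ) < l + 1 := by linarith
      have e1' : l < k + 1 := by exact_mod_cast e1
      have e2' : k < l + 1 := by exact_mod_cast e2
      omega
    subst this
    linarith
  obtain ⟨n, h1, h2⟩ := ((hr.eventually_lt_const hβ).and (hl.eventually_lt_const hβ)).exists
  exact ⟨_, Nat.one_div_pos_of_nat, h1, h2⟩

/-- An interval of length at least `ε` contains an integer translate of one of the `N` intervals of
a subdivision of `[0, 1]` with `N > 2/ε`; the least of their masses serves as `β`. -/
lemma exists_le_mass (hpos : ∀ a b, a < b → 0 < mass μ a b) {ε : ℝ} (hε : 0 < ε) :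
    ∃ β > 0, ∀ a b, ε ≤ b - a → β ≤ mass μ a b := by
  obtain ⟨N, hN⟩ := exists_nat_gt (2 / ε)
  have hN0 : 0 < (N : ℝ) := lt_trans (by positivity) hN
  have hN0' : 0 < N := by exact_mod_cast hN0
  obtain ⟨i, -, hi⟩ := (Finset.range N).exists_min_image
    (fun k : ℕ => mass μ ((k : ℝ) / N) (((k : ℝ) + 1) / N)) ⟨0, Finset.mem_range.2 hN0'⟩
  refine ⟨_, hpos _ _ (by gcongr; linarith : (i : ℝ) / N < ((i : ℝ) + 1) / N), fun a b hab => ?_⟩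
  set k : ℤ := ⌈a * N⌉ with hk
  have hk1 : a * N ≤ k := Int.le_ceil _
  have hk2 : (k : ℝ) < a * N + 1 := Int.ceil_lt_add_one _
  have hNe : 2 ≤ (b - a) * N := by
    rw [div_lt_iff₀ hε] at hN
    nlinarith
  have hmod := Int.emod_add_mul_ediv k N
  have hm0 := Int.emod_nonneg k (by omega : (N : ℤ) ≠ 0)
  have hm1 := Int.emod_lt_of_pos k (by omega : (0 : ℤ) < N)
  set r := k % N
  set q := k / N
  have hkr : (k : ℝ) = r + N * q := by exact_mod_cast hmod.symm
  have := hi r.toNat (Finset.mem_range.2 (by omega))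
  refine this.trans ?_
  have hr : ((r.toNat : ℕ) : ℝ) = r := by
    have : ((r.toNat : ℕ) : ℤ) = r := Int.toNat_of_nonneg hm0
    exact_mod_cast this
  rw [hr, ← mass_add_int _ _ q]
  refine mass_mono ?_ ?_
  · rw [← sub_le_iff_le_add, le_div_iff₀ hN0]; nlinarith
  · rw [← le_sub_iff_add_le, div_le_iff₀ hN0]; nlinarith

/-- The order isomorphisms that commute with the unit translation and preserve `mass`. -/
def massGroup (μ : Measure Chain) : Subgroup (ℝ ≃o ℝ) where
  carrier := {θ | (∀ s, θ (s + 1) = θ s + 1) ∧ ∀ a b, mass μ (θ a) (θ b) = mass μ a b}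
  mul_mem' {θ φ} hθ hφ := ⟨fun s => by rw [RelIso.mul_apply, RelIso.mul_apply, hφ.1, hθ.1],
    fun a b => by rw [RelIso.mul_apply, RelIso.mul_apply, hθ.2, hφ.2]⟩
  one_mem' := ⟨fun _ => rfl, fun _ _ => rfl⟩
  inv_mem' {θ} hθ := by
    refine ⟨fun s => θ.injective ?_, fun a b => ?_⟩
    · rw [hθ.1, RelIso.apply_inv_self, RelIso.apply_inv_self]
    · rw [← hθ.2, RelIso.apply_inv_self, RelIso.apply_inv_self]

/-- Long intervals have mass at least `β`, and short one-sided intervals have less; as mass is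
preserved, images of short intervals are short. An interval that contains the centre `p` is split
there, which avoids a possible atom and is why `ε / 2` is used. Compactness of `[0, 1]` and the
commutation with the unit translation make `δ` uniform. -/
lemma massGroup_equicontinuous [IsProbabilityMeasure μ] (hpos : ∀ a b, a < b → 0 < mass μ a b) :
    ∀ ε > 0, ∃ δ > 0, ∀ θ ∈ massGroup μ, ∀ s s', |s - s'| < δ → |θ s - θ s'| < ε := by
  intro ε hε
  obtain ⟨β, hβ, h⟩ := exists_le_mass hpos (half_pos hε)
  choose r hr hr1 hr2 using fun p => exists_mass_small (μ := μ) p hβ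
  obtain ⟨δ, hδ, hcov⟩ := lebesgue_number_lemma_of_metric (isCompact_Icc (a := (0 : ℝ)) (b := 1))
    (c := fun p : ℝ => Metric.ball p (r p)) (fun _ => Metric.isOpen_ball)
    (fun x _ => mem_iUnion.2 ⟨x, Metric.mem_ball_self (hr x)⟩)
  have hsmall : ∀ θ ∈ massGroup μ, ∀ a b, mass μ a b < β → θ b - θ a < ε / 2 := by
    intro θ hθ a b hab
    by_contra hc
    have := h _ _ (not_lt.1 hc)
    rw [hθ.2] at this
    exact absurd hab (not_lt.2 this)
  have key : ∀ θ ∈ massGroup μ, ∀ s s', s ≤ s' → s' - s < δ → θ s' - θ s < ε := by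
    intro θ hθ s s' hss hd
    wlog hs : s ∈ Icc (0 : ℝ) 1 generalizing s s' with H
    · have e1 := map_add_int_of_map_add_one hθ.1 s (-⌊s⌋)
      have e2 := map_add_int_of_map_add_one hθ.1 s' (-⌊s⌋)
      have := H (s + (-⌊s⌋ : ℤ)) (s' + (-⌊s⌋ : ℤ)) (by linarith) (by linarith) (by
        push_cast
        constructor <;> linarith [Int.floor_le s, Int.lt_floor_add_one s])
      linarith
    · obtain ⟨p, hp⟩ := hcov s hs
      have h1 := hp (Metric.mem_ball_self hδ)
      have h2 := hp (show s' ∈ Metric.ball s δ by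
        rw [Metric.mem_ball, Real.dist_eq, abs_of_nonneg (by linarith)]; exact hd)
      rw [Metric.mem_ball, Real.dist_eq, abs_lt] at h1 h2
      rcases le_total s' p with hp1 | hp1
      · have := hsmall θ hθ s s' ((mass_mono (by linarith) hp1).trans_lt (hr2 p))
        linarith
      · rcases le_total p s with hp2 | hp2
        · have := hsmall θ hθ s s' ((mass_mono hp2 (by linarith)).trans_lt (hr1 p))
          linarith
        · have e1 := hsmall θ hθ s p ((mass_mono (by linarith) le_rfl).trans_lt (hr2 p))
          have e2 := hsmall θ hθ p s' ((mass_mono le_rfl (by linarith)).trans_lt (hr1 p))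
          linarith
  refine ⟨δ, hδ, fun θ hθ s s' hs => ?_⟩
  rw [abs_lt] at hs
  rcases le_total s s' with hss | hss
  · rw [abs_sub_comm, abs_of_nonneg (sub_nonneg.2 (θ.monotone hss))]
    exact key θ hθ s s' hss (by linarith)
  · rw [abs_of_nonneg (sub_nonneg.2 (θ.monotone hss))]
    exact key θ hθ s' s hss (by linarith)

end Mass

/-! ### The foliation formed by the support of a synchronized measure -/

section Construction

variable {W V f : ℝ → ℝ} {ρ : ℝ} {μ : Measure Chain}

/-- Without intersections the products of adjacent differences are positive, so the sign of the
difference propagates from one site to all others. -/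
lemma IsSynchronizedMeasure.lt_of_lt (hμ : IsSynchronizedMeasure W V f ρ μ) {u v : Config}
    (hu : toChain u ∈ μ.support) (hv : toChain v ∈ μ.support) {i : ℤ} (hi : u.1 i < v.1 i) (j : ℤ) :
    u.1 j < v.1 j := by
  have hne : u ≠ v := fun h => by rw [h] at hi; exact lt_irrefl _ hi
  have hprod : ∀ j, 0 < (v.1 (j + 1) - u.1 (j + 1)) * (v.1 j - u.1 j) := by
    intro j
    by_contra hc
    exact hμ.not_intersect u v hu hv ⟨hne, j, not_lt.1 hc⟩
  have hup : ∀ j, u.1 j < v.1 j → u.1 (j + 1) < v.1 (j + 1) := fun j hj =>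
    sub_pos.1 ((pos_iff_pos_of_mul_pos (hprod j)).2 (sub_pos.2 hj))
  have hdown : ∀ j, u.1 (j + 1) < v.1 (j + 1) → u.1 j < v.1 j := fun j hj =>
    sub_pos.1 ((pos_iff_pos_of_mul_pos (hprod j)).1 (sub_pos.2 hj))
  refine Int.inductionOn' j i hi (fun k _ hk => hup k hk) (fun k _ hk => hdown _ ?_)
  rwa [sub_add_cancel]

lemma IsSynchronizedMeasure.eq_of_eq (hμ : IsSynchronizedMeasure W V f ρ μ) {u v : Config}
    (hu : toChain u ∈ μ.support) (hv : toChain v ∈ μ.support) {i : ℤ} (hi : u.1 i = v.1 i) :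
    u = v := by
  refine Subtype.ext (funext fun j => ?_)
  rcases lt_trichotomy (u.1 j) (v.1 j) with h | h | h
  · exact absurd hi (hμ.lt_of_lt hu hv h i).ne
  · exact h
  · exact absurd hi (hμ.lt_of_lt hv hu h i).ne'

lemma shift_mem_support_of_measurePreserving (h : MeasurePreserving (chainShift 1) μ μ) {u : Config} :
    toChain u ∈ μ.support ↔ toChain (shift 1 u) ∈ μ.support := by
  simp only [Measure.mem_support_iff_forall]
  have hinv : ∀ (m n : ℤ), m + n = 0 → ∀ x : Chain, chainShift m (chainShift n x) = x := by
    intro m n hmn x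
    obtain ⟨v, rfl⟩ := toChain_surjective x
    rw [chainShift_toChain, chainShift_toChain, shift_shift, hmn, shift_zero]
  constructor
  · intro hu U hU
    obtain ⟨O, hOU, hO, huO⟩ := mem_nhds_iff.1 hU
    have h1 := hu (chainShift 1 ⁻¹' O) ((hO.preimage (continuous_chainShift 1)).mem_nhds huO)
    rw [h.measure_preimage hO.measurableSet.nullMeasurableSet] at h1
    exact h1.trans_le (measure_mono hOU)
  · intro hu U hU
    obtain ⟨O, hOU, hO, huO⟩ := mem_nhds_iff.1 hU
    have h1 := hu (chainShift (-1) ⁻¹' O) ((hO.preimage (continuous_chainShift (-1))).mem_nhds (by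
      rw [mem_preimage, ← chainShift_toChain, hinv _ _ (by norm_num)]; exact huO))
    rw [← h.measure_preimage ((hO.preimage (continuous_chainShift (-1))).measurableSet.nullMeasurableSet)]
      at h1
    rw [← preimage_comp] at h1
    have : chainShift (-1) ∘ chainShift 1 = id := funext fun x => hinv _ _ (by norm_num) x
    rw [this, preimage_id] at h1
    exact h1.trans_le (measure_mono hOU)

lemma IsSynchronizedMeasure.shift_mem (hμ : IsSynchronizedMeasure W V f ρ μ) (n : ℤ) {u : Config}
    (hu : toChain u ∈ μ.support) : toChain (shift n u) ∈ μ.support := by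
  induction n using Int.induction_on with
  | zero => rwa [shift_zero]
  | succ n ih =>
    rw [add_comm, ← shift_shift]
    exact (shift_mem_support_of_measurePreserving hμ.invariant_shift).1 ih
  | pred n ih =>
    rw [shift_mem_support_of_measurePreserving hμ.invariant_shift, shift_shift]
    convert ih using 3
    ring

/-- Only points of the support matter for the measure, and there the width is uniformly bounded by
hypothesis. The flow is therefore continuous where it is needed, and a neighbourhood of the image
pulls back to a set that contains, almost everywhere, a neighbourhood of `u`. -/
lemma flow_mem_support (hA : StandingAssumptions W V f)
    (hμ : MeasurePreserving (chainFlow W V f 1) μ μ) {K : ℝ}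
    (hK : ∀ u : Config, toChain u ∈ μ.support → WidthLE ρ K u.1) {u : Config}
    (hu : toChain u ∈ μ.support) : toChain (flow W V f 1 u) ∈ μ.support := by
  rw [Measure.mem_support_iff_forall]
  intro U hU
  obtain ⟨O, hOU, hO, huO⟩ := mem_nhds_iff.1 hU
  obtain ⟨R, η, hη, hR⟩ := exists_window_subset ((hO.preimage continuous_toChain).mem_nhds huO)
  obtain ⟨R', ε, hε, hclose⟩ := exists_flow_close_of_close hA ρ K 1 R (half_pos hη)
  have h1 := (Measure.mem_support_iff_forall _).1 hu (toChain '' window u R' ε)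
    ((isOpenMap_toChain _ (isOpen_window u R' ε)).mem_nhds ⟨u, mem_window_self u R' hε, rfl⟩)
  refine lt_of_lt_of_le ?_ (measure_mono hOU)
  rw [← hμ.measure_preimage hO.measurableSet.nullMeasurableSet]
  refine h1.trans_le (measure_mono_ae ?_)
  filter_upwards [Measure.support_mem_ae (μ := μ)] with x hx hxw
  obtain ⟨v, hv, rfl⟩ := hxw
  change chainFlow W V f 1 (toChain v) ∈ O
  rw [chainFlow_toChain hA zero_le_one]
  refine hR fun j hj => ?_
  have := hclose v u (hK v hx) (hK u hu) (fun j hj => (hv j hj).le) 1 ⟨zero_le_one, le_rfl⟩ j hj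
  linarith

lemma exists_mem_support (hμ : proj₀ '' μ.support = univ) (s : ℝ) :
    ∃ u : Config, toChain u ∈ μ.support ∧ u.1 0 = s := by
  obtain ⟨x, hx, hxs⟩ : ((s : ℝ) : UnitAddCircle) ∈ proj₀ '' μ.support := by rw [hμ]; trivial
  obtain ⟨u, rfl⟩ := toChain_surjective x
  have hxs' : ((u.1 0 : ℝ) : UnitAddCircle) = s := hxs
  rw [eq_comm, ← sub_eq_zero, ← AddCircle.coe_sub, AddCircle.coe_eq_zero_iff] at hxs'
  obtain ⟨n, hn⟩ := hxs'
  refine ⟨addInt n u, by rwa [toChain_addInt], ?_⟩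
  simp at hn ⊢
  linarith

/-- Almost every class is that of a leaf, and on leaves `Θ` acts on the parameter through `θ`. The
preimage under `Θ` of the arc `(θ a, θ b)` is thus the arc `(a, b)` up to a null set. -/
lemma mass_map_eq {leaf : ℝ → Config} [IsProbabilityMeasure μ]
    (hleaf : ∀ u, toChain u ∈ μ.support → u = leaf (u.1 0)) (h0 : ∀ s, (leaf s).1 0 = s)
    {Θ : Chain → Chain} (hΘ : MeasurePreserving Θ μ μ) {θ : ℝ ≃o ℝ} (h1 : ∀ s, θ (s + 1) = θ s + 1)
    (h : ∀ s, Θ (toChain (leaf s)) = toChain (leaf (θ s))) (a b : ℝ) :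
    mass μ (θ a) (θ b) = mass μ a b := by
  unfold mass
  rw [← hΘ.measure_preimage (isOpen_arc _ _).measurableSet.nullMeasurableSet]
  refine measure_congr ?_
  filter_upwards [Measure.support_mem_ae (μ := μ)] with x hx
  obtain ⟨u, rfl⟩ := toChain_surjective x
  have hu := hleaf u hx
  generalize u.1 0 = s at hu
  subst hu
  refine propext ?_
  change Θ (toChain (leaf s)) ∈ toChain '' _ ↔ toChain (leaf s) ∈ toChain '' _
  rw [h, mem_arc_iff, mem_arc_iff]
  refine exists_congr fun n => ?_
  rw [h0, h0, ← map_add_int_of_map_add_one h1, θ.lt_iff_lt, θ.lt_iff_lt]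

/-- Surjectivity of the projection provides a member of the support with any prescribed value at
`0`, and total order makes it unique. Invariance of the measure puts the motions of the leaf
parameter in `massGroup`, whence their equicontinuity. -/
theorem exists_foliation (hA : StandingAssumptions W V f) (hμ : IsSynchronizedMeasure W V f ρ μ)
    (hs : proj₀ '' μ.support = univ) :
    ∃ F : Foliation W V f ρ, ∀ u, toChain u ∈ μ.support ↔ ∃ s, u = F.leaf s := by
  have := hμ.isProbability
  choose leaf hmem h0 using exists_mem_support hs
  have hleaf : ∀ u, toChain u ∈ μ.support → u = leaf (u.1 0) := fun u hu =>
    hμ.eq_of_eq hu (hmem _) (h0 _).symm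
  have hmono : ∀ j, StrictMono fun s => (leaf s).1 j := fun j s s' hss =>
    hμ.lt_of_lt (hmem s) (hmem s') (i := 0) (by rwa [h0, h0]) j
  have hshift : ∀ n s, shift n (leaf s) = leaf ((leaf s).1 (-n)) := fun n s => by
    have := hleaf _ (hμ.shift_mem n (hmem s))
    simpa using this
  -- The leaf with value `r` at the site `j` is the translate by `j` of the leaf with value `r` at
  -- the site `0`.
  have hsurj : ∀ j, Function.Surjective fun s => (leaf s).1 j := fun j r => by
    refine ⟨(leaf r).1 (-j), ?_⟩
    beta_reduce
    rw [← hshift, shift_apply, sub_self, h0]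
  let pos : ℤ → ℝ ≃o ℝ := fun j => (hmono j).orderIsoOfSurjective _ (hsurj j)
  have hpos : ∀ s j, (leaf s).1 j = pos j s := fun _ _ => rfl
  have hadd : ∀ s, leaf (s + 1) = addInt 1 (leaf s) := fun s => by
    refine hμ.eq_of_eq (i := 0) (hmem _) (by rw [toChain_addInt]; exact hmem _) ?_
    simp [h0]
  have hposadd : ∀ j s, pos j (s + 1) = pos j s + 1 := fun j s => by
    rw [← hpos, ← hpos, hadd]; simp
  -- width
  obtain ⟨K, hK⟩ : ∃ K, ∀ s, WidthLE ρ K (leaf s).1 := by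
    obtain ⟨x, ⟨u, rfl, K, hK⟩, hx⟩ := (hμ.spacing.and Measure.support_mem_ae).exists
    refine ⟨K + 2, fun s m n => ?_⟩
    set s₀ := u.1 0
    have hu := hleaf u hx
    -- Every leaf lies between two consecutive integer translates of the single leaf `u` of known
    -- width; hence the common width `K + 2`.
    have hbr : ∀ j, u.1 j + ⌊s - s₀⌋ ≤ (leaf s).1 j ∧ (leaf s).1 j ≤ u.1 j + ⌊s - s₀⌋ + 1 := by
      intro j
      have e1 := map_add_int_of_map_add_one (hposadd j) s₀ ⌊s - s₀⌋
      have e2 := map_add_int_of_map_add_one (hposadd j) s₀ (⌊s - s₀⌋ + 1)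
      have f1 := Int.floor_le (s - s₀)
      have f2 := Int.lt_floor_add_one (s - s₀)
      push_cast at e2
      have f3 : u.1 j = pos j s₀ := by rw [← hpos, ← hu]
      rw [hpos, f3]
      constructor
      · rw [← e1]; exact (pos j).monotone (by linarith)
      · rw [add_assoc, ← e2]; exact (pos j).monotone (by linarith)
    have h1 := abs_le.1 (hK m n)
    have h2 := hbr m
    have h3 := hbr n
    rw [abs_le]
    constructor <;> linarith [h1.1, h1.2, h2.1, h2.2, h3.1, h3.2]
  have hKsupp : ∀ u : Config, toChain u ∈ μ.support → WidthLE ρ K u.1 := fun u hu => by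
    rw [hleaf u hu]; exact hK _
  have hflowmem : ∀ s, toChain (flow W V f 1 (leaf s)) ∈ μ.support := fun s =>
    flow_mem_support hA hμ.invariant_flow hKsupp (hmem s)
  let τ : ℝ → ℝ := fun s => (flow W V f 1 (leaf s)).1 0
  have hτ : ∀ s, flow W V f 1 (leaf s) = leaf (τ s) := fun s => hleaf _ (hflowmem s)
  have hτmono : StrictMono τ := fun s s' hss => flow_lt hA (fun j => hmono j hss) zero_le_one 0
  have hτadd : ∀ s, τ (s + 1) = τ s + 1 := fun s => by
    simp only [τ]
    rw [hadd, flow_addInt hA _ _ zero_le_one]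
    simp
  have hτcont : Continuous τ := by
    rw [Metric.continuous_iff']
    intro s ε hε
    obtain ⟨R, η, hη, hc⟩ := exists_flow_close_of_close hA ρ K 1 0 (half_pos hε)
    have hev : ∀ᶠ s' in 𝓝 s, ∀ j ∈ Finset.Icc (-(R : ℤ)) R, |(leaf s').1 j - (leaf s).1 j| < η := by
      rw [Filter.eventually_all_finset]
      intro j _
      have hcj : Continuous (pos j) := (pos j).continuous
      have := Metric.continuous_iff'.1 hcj s η hη
      simpa [Real.dist_eq, hpos] using this
    filter_upwards [hev] with s' hs'
    rw [Real.dist_eq]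
    have := hc (leaf s') (leaf s) (hK _) (hK _) (fun j hj => (hs' j (Finset.mem_Icc.2 (abs_le.1 hj))).le)
      1 ⟨zero_le_one, le_rfl⟩ 0 (by simp)
    exact this.trans_lt (half_lt_self hε)
  let step : ℝ ≃o ℝ := hτmono.orderIsoOfSurjective _ (surjective_of_map_add_one hτcont hτadd)
  have hposmass : ∀ a b, a < b → 0 < mass μ a b := by
    intro a b hab
    obtain ⟨c, hac, hcb⟩ := exists_between hab
    refine (Measure.mem_support_iff_forall _).1 (hmem c) _ ((isOpen_arc a b).mem_nhds ?_)
    exact ⟨leaf c, by simp [h0, hac, hcb], rfl⟩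
  have hstep : step ∈ massGroup μ := by
    refine ⟨hτadd, mass_map_eq hleaf h0 hμ.invariant_flow (θ := step) hτadd fun s => ?_⟩
    rw [chainFlow_toChain hA zero_le_one, hτ]
    rfl
  have hposmul : ∀ m n, pos (m + n) = pos m * pos n := by
    intro m n
    ext s
    rw [RelIso.mul_apply, ← hpos, ← hpos, ← hpos]
    have := hshift (-n) s
    rw [neg_neg] at this
    rw [← this, shift_apply, sub_neg_eq_add]
  have hpos1 : pos (-1) ∈ massGroup μ := by
    refine ⟨hposadd _, mass_map_eq hleaf h0 hμ.invariant_shift (θ := pos (-1)) (hposadd _) fun s => ?_⟩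
    rw [chainShift_toChain, hshift]
    rfl
  have hpos0 : pos 0 = 1 := by
    ext s
    rw [← hpos, h0]
    rfl
  have hpos1' : pos 1 ∈ massGroup μ := by
    have : pos 1 * pos (-1) = 1 := by rw [← hposmul, add_neg_cancel, hpos0]
    rw [eq_inv_of_mul_eq_one_left this]
    exact inv_mem hpos1
  have hposmem : ∀ j, pos j ∈ massGroup μ := by
    intro j
    induction j using Int.induction_on with
    | zero => rw [hpos0]; exact one_mem _
    | succ n ih => rw [hposmul]; exact mul_mem ih hpos1'
    | pred n ih => rw [sub_eq_add_neg, hposmul]; exact mul_mem ih hpos1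
  refine ⟨⟨leaf, pos, step, massGroup μ, K, hpos, fun s => h0 s, hshift, hτ, hK, hposmem, hstep,
    fun θ hθ => hθ.1, massGroup_equicontinuous hposmass⟩, fun u => ⟨fun hu => ⟨_, hleaf u hu⟩, ?_⟩⟩
  rintro ⟨s, rfl⟩
  exact hmem s

end Construction

/-! ### Sequences updated within the hull of their neighbours -/

/-- `l'` arises from `l` by an update of the sites in `A`, each within the hull of the values at the
site and its two neighbours. -/
structure HullStep (A : Set ℤ) (l l' : ℤ → ℝ) : Prop where
  eq : ∀ j ∉ A, l' j = l j
  le : ∀ j ∈ A, ∃ i, |i - j| ≤ 1 ∧ l' j ≤ l i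
  ge : ∀ j ∈ A, ∃ i, |i - j| ≤ 1 ∧ l i ≤ l' j

lemma HullStep.comp_monotone {A : Set ℤ} {l l' : ℤ → ℝ} (h : HullStep A l l') {θ : ℝ → ℝ}
    (hθ : Monotone θ) : HullStep A (fun j => θ (l j)) (fun j => θ (l' j)) where
  eq j hj := by rw [h.eq j hj]
  le j hj := (h.le j hj).imp fun _ hi => ⟨hi.1, hθ hi.2⟩
  ge j hj := (h.ge j hj).imp fun _ hi => ⟨hi.1, hθ hi.2⟩

lemma HullStep.neg {A : Set ℤ} {l l' : ℤ → ℝ} (h : HullStep A l l') :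
    HullStep A (fun j => -l j) (fun j => -l' j) where
  eq j hj := by rw [h.eq j hj]
  le j hj := (h.ge j hj).imp fun _ hi => ⟨hi.1, neg_le_neg hi.2⟩
  ge j hj := (h.le j hj).imp fun _ hi => ⟨hi.1, neg_le_neg hi.2⟩

/-- No two updated sites are adjacent, so the neighbours of an updated site keep their values, and
for monotone data these are the extremes of its hull. -/
lemma HullStep.monotone {A : Set ℤ} (hA : ∀ j ∈ A, j + 1 ∉ A) {l l' : ℤ → ℝ} (h : HullStep A l l')
    (hl : Monotone l) : Monotone l' := by
  refine monotone_int_of_le_succ fun j => ?_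
  by_cases hj : j ∈ A
  · obtain ⟨i, hi, hle⟩ := h.le j hj
    rw [h.eq _ (hA j hj)]
    exact hle.trans (hl (by rw [abs_le] at hi; omega))
  · rw [h.eq j hj]
    by_cases hj' : j + 1 ∈ A
    · obtain ⟨i, hi, hle⟩ := h.ge _ hj'
      exact (hl (by rw [abs_le] at hi; omega)).trans hle
    · rw [h.eq _ hj']
      exact hl (by omega)

lemma HullStep.antitone {A : Set ℤ} (hA : ∀ j ∈ A, j + 1 ∉ A) {l l' : ℤ → ℝ} (h : HullStep A l l')
    (hl : Antitone l) : Antitone l' := by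
  have := h.neg.monotone hA hl.neg
  exact fun a b hab => neg_le_neg_iff.1 (this hab)

/-- Total variation on `[p, q]`. -/
noncomputable def tv (p q : ℤ) (s : ℤ → ℝ) : ℝ := ∑ j ∈ Finset.Ico p q, |s (j + 1) - s j|

lemma tv_neg (p q : ℤ) (s : ℤ → ℝ) : tv p q (fun j => -s j) = tv p q s := by
  unfold tv
  refine Finset.sum_congr rfl fun j _ => ?_
  rw [← abs_neg]
  congr 1
  ring

lemma tv_nonneg (p q : ℤ) (s : ℤ → ℝ) : 0 ≤ tv p q s := Finset.sum_nonneg fun _ _ => abs_nonneg _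

lemma abs_sub_le_tv (s : ℤ → ℝ) {p q : ℤ} (h : p ≤ q) : |s q - s p| ≤ tv p q s := by
  induction q, h using Int.leInduction with
  | base => simp [tv]
  | succ q hq ih =>
    have : Finset.Ico p (q + 1) = insert q (Finset.Ico p q) := by
      ext j; simp only [Finset.mem_Ico, Finset.mem_insert]; omega
    rw [tv, this, Finset.sum_insert (by simp)]
    calc |s (q + 1) - s p| = |(s (q + 1) - s q) + (s q - s p)| := by congr 1; ring
      _ ≤ |s (q + 1) - s q| + |s q - s p| := abs_add_le _ _
      _ ≤ _ := by gcongr; exact ih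

lemma tv_split (s : ℤ → ℝ) {p r q : ℤ} (h1 : p ≤ r) (h2 : r ≤ q) :
    tv p q s = tv p r s + tv r q s := by
  unfold tv
  rw [← Finset.sum_union]
  · congr 1
    ext j; simp only [Finset.mem_Ico, Finset.mem_union]; omega
  · rw [Finset.disjoint_left]
    intro j
    simp only [Finset.mem_Ico]
    omega

/-- The variation across a site whose neighbours have values `a`, `b` is least between `a` and `b`
and grows with the distance from that interval; moving `x` within the hull of `a`, `b`, `x` cannot
increase it. -/
lemma abs_sub_add_abs_sub_le {a b x y : ℝ} (hle : y ≤ x ∨ y ≤ a ∨ y ≤ b)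
    (hge : x ≤ y ∨ a ≤ y ∨ b ≤ y) : |y - a| + |b - y| ≤ |x - a| + |b - x| := by
  have h1 := abs_sub_le a x b
  rcases abs_cases (y - a) with h | h <;> rcases abs_cases (b - y) with h' | h' <;>
  rcases abs_cases (x - a) with h'' | h'' <;> rcases abs_cases (b - x) with h''' | h''' <;>
  rcases hle with h2 | h2 | h2 <;> rcases hge with h3 | h3 | h3 <;> linarith

lemma tv_update_le {p q j : ℤ} (hp : p < j) (hq : j < q) {s : ℤ → ℝ} {y : ℝ}
    (hle : y ≤ s j ∨ y ≤ s (j - 1) ∨ y ≤ s (j + 1)) (hge : s j ≤ y ∨ s (j - 1) ≤ y ∨ s (j + 1) ≤ y) :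
    tv p q (Function.update s j y) ≤ tv p q s := by
  have key : tv p q (Function.update s j y) - tv p q s =
      ∑ i ∈ {j - 1, j}, (|Function.update s j y (i + 1) - Function.update s j y i| -
        |s (i + 1) - s i|) := by
    unfold tv
    rw [← Finset.sum_sub_distrib]
    symm
    refine Finset.sum_subset (fun i hi => ?_) fun i _ hi => ?_
    · simp only [Finset.mem_insert, Finset.mem_singleton, Finset.mem_Ico] at hi ⊢
      omega
    · simp only [Finset.mem_insert, Finset.mem_singleton, not_or] at hi
      rw [Function.update_of_ne (by omega), Function.update_of_ne hi.2, sub_self]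
  rw [Finset.sum_pair (by omega), sub_add_cancel, Function.update_self,
    Function.update_of_ne (by omega), Function.update_of_ne (by omega)] at key
  have := abs_sub_add_abs_sub_le hle hge
  linarith

/-- The sites are updated one at a time. Since none of them are adjacent, each update still sees the
original neighbours. -/
theorem HullStep.tv_le {A : Set ℤ} {p q : ℤ} (hA : ∀ j ∈ A, j + 1 ∉ A ∧ p < j ∧ j < q)
    {l l' : ℤ → ℝ} (h : HullStep A l l') : tv p q l' ≤ tv p q l := by
  classical
  have key : ∀ B : Finset ℤ, (∀ j ∈ B, j ∈ A) → tv p q (fun j => if j ∈ B then l' j else l j) ≤ tv p q l := by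
    intro B
    induction B using Finset.induction_on with
    | empty => simp
    | insert j B hj ih =>
      intro hB
      refine le_trans ?_ (ih fun i hi => hB i (Finset.mem_insert_of_mem hi))
      have hjA := hB j (Finset.mem_insert_self _ _)
      have heq : (fun i => if i ∈ insert j B then l' i else l i) =
          Function.update (fun i => if i ∈ B then l' i else l i) j (l' j) := by
        funext i
        rcases eq_or_ne i j with rfl | hij
        · simp
        · simp [hij]
      have h1 : j + 1 ∉ B := fun hc => (hA j hjA).1 (hB _ (Finset.mem_insert_of_mem hc))
      have h2 : j - 1 ∉ B := fun hc => (hA (j - 1) (hB _ (Finset.mem_insert_of_mem hc))).1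
        (by rwa [sub_add_cancel])
      rw [heq]
      have hcase : ∀ i, |i - j| ≤ 1 → i = j ∨ i = j - 1 ∨ i = j + 1 := fun i hi => by
        rw [abs_le] at hi; omega
      refine tv_update_le (hA j hjA).2.1 (hA j hjA).2.2 ?_ ?_
      · simp only [hj, h1, h2, if_false]
        obtain ⟨i, hi, hle⟩ := h.le j hjA
        rcases hcase i hi with rfl | rfl | rfl <;> tauto
      · simp only [hj, h1, h2, if_false]
        obtain ⟨i, hi, hle⟩ := h.ge j hjA
        rcases hcase i hi with rfl | rfl | rfl <;> tauto
  have hfin : A.Finite := (Set.finite_Ioo p q).subset fun j hj => ⟨(hA j hj).2.1, (hA j hj).2.2⟩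
  have := key hfin.toFinset (by simp)
  convert this using 2
  funext j
  by_cases hj : j ∈ A
  · simp [hj]
  · simp [hj, h.eq j hj]

/-! ### Truncation on blocks -/

section Blocks

variable {ι : Type*} {lo hi : ι → ℤ} {c : ι → ℝ}

open Classical in
/-- Truncation of a sequence from above by the level `c b` on each block `[lo b, hi b]`. -/
noncomputable def cut (lo hi : ι → ℤ) (c : ι → ℝ) (B : Finset ι) (s : ℤ → ℝ) (j : ℤ) : ℝ :=
  s j - ∑ b ∈ B, if lo b ≤ j ∧ j ≤ hi b then max (s j - c b) 0 else 0

/-- Disjointness of blocks. -/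
def BlocksDisjoint (lo hi : ι → ℤ) (B : Finset ι) : Prop :=
  ∀ b ∈ B, ∀ b' ∈ B, ∀ j, lo b ≤ j → j ≤ hi b → lo b' ≤ j → j ≤ hi b' → b = b'

lemma cut_of_mem {B : Finset ι} (hB : BlocksDisjoint lo hi B) {b : ι} (hb : b ∈ B) {j : ℤ}
    (h1 : lo b ≤ j) (h2 : j ≤ hi b) (s : ℤ → ℝ) : cut lo hi c B s j = min (s j) (c b) := by
  classical
  rw [cut, Finset.sum_eq_single_of_mem b hb, if_pos ⟨h1, h2⟩]
  · rcases le_total (s j) (c b) with h | h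
    · rw [max_eq_right (by linarith), min_eq_left h, sub_zero]
    · rw [max_eq_left (by linarith), min_eq_right h]; ring
  · intro b' hb' hne
    rw [if_neg]
    rintro ⟨h3, h4⟩
    exact hne (hB b' hb' b hb j h3 h4 h1 h2)

lemma cut_of_notMem {B : Finset ι} {j : ℤ} (h : ∀ b ∈ B, ¬ (lo b ≤ j ∧ j ≤ hi b)) (s : ℤ → ℝ) :
    cut lo hi c B s j = s j := by
  classical
  rw [cut, Finset.sum_eq_zero fun b hb => if_neg (h b hb), sub_zero]

lemma cut_le {B : Finset ι} (s : ℤ → ℝ) (j : ℤ) : cut lo hi c B s j ≤ s j := by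
  classical
  rw [cut, sub_le_self_iff]
  refine Finset.sum_nonneg fun b _ => ?_
  split_ifs
  · exact le_max_right _ _
  · exact le_rfl

lemma cut_eq_self {B : Finset ι} (hB : BlocksDisjoint lo hi B) {s : ℤ → ℝ}
    (h : ∀ b ∈ B, ∀ j, lo b ≤ j → j ≤ hi b → s j ≤ c b) (j : ℤ) : cut lo hi c B s j = s j := by
  by_cases hj : ∃ b ∈ B, lo b ≤ j ∧ j ≤ hi b
  · obtain ⟨b, hb, h1, h2⟩ := hj
    rw [cut_of_mem hB hb h1 h2, min_eq_left (h b hb j h1 h2)]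
  · push Not at hj
    exact cut_of_notMem (fun b hb hc => absurd hc.2 (not_le.2 (hj b hb hc.1))) s

/-- If the values at `i` and `j` are ordered, so are the truncated values, provided that truncation
at the site of the larger value happens away from the ends of the block. -/
lemma cut_le_cut {B : Finset ι} (hB : BlocksDisjoint lo hi B) {s s' : ℤ → ℝ} {i j : ℤ}
    (hij : |i - j| ≤ 1) (hs : s i ≤ s' j)
    (hend : ∀ b ∈ B, s' (lo b) ≤ c b ∧ s' (hi b) ≤ c b) :
    cut lo hi c B s i ≤ cut lo hi c B s' j := by
  rw [abs_le] at hij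
  by_cases hj : ∃ b ∈ B, lo b ≤ j ∧ j ≤ hi b
  · obtain ⟨b, hb, h1, h2⟩ := hj
    rw [cut_of_mem hB hb h1 h2]
    rcases le_or_gt (s' j) (c b) with hc | hc
    · rw [min_eq_left hc]
      exact (cut_le s i).trans hs
    · have h3 : j ≠ lo b := fun h => absurd (hend b hb).1 (by rw [← h]; exact not_le.2 hc)
      have h4 : j ≠ hi b := fun h => absurd (hend b hb).2 (by rw [← h]; exact not_le.2 hc)
      rw [cut_of_mem hB hb (by omega) (by omega)]
      exact min_le_min hs le_rfl
  · push Not at hj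
    rw [cut_of_notMem (fun b hb hc => absurd hc.2 (not_le.2 (hj b hb hc.1))) s']
    exact (cut_le s i).trans hs

/-- Within a block truncation is a monotone function of the value, so it respects hulls. Across a
block's boundary it does so because both sequences are below the level at the end sites, where
truncation changes nothing. -/
lemma HullStep.cut {A : Set ℤ} {B : Finset ι} (hB : BlocksDisjoint lo hi B) {l l' : ℤ → ℝ}
    (h : HullStep A l l') (h1 : ∀ b ∈ B, l (lo b) ≤ c b ∧ l (hi b) ≤ c b)
    (h2 : ∀ b ∈ B, l' (lo b) ≤ c b ∧ l' (hi b) ≤ c b) :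
    HullStep A (cut lo hi c B l) (cut lo hi c B l') where
  eq j hj := by simp only [FrenkelKontorova.cut, h.eq j hj]
  le j hj := by
    obtain ⟨i, hi, hle⟩ := h.le j hj
    exact ⟨i, hi, cut_le_cut hB (by rwa [abs_sub_comm]) hle h1⟩
  ge j hj := by
    obtain ⟨i, hi, hle⟩ := h.ge j hj
    exact ⟨i, hi, cut_le_cut hB hi hle h2⟩

/-- The parts of an increment below and above the level `c` have the same sign, so their absolute
values add up. -/
lemma abs_min_sub_min_add (a b c : ℝ) :
    |min a c - min b c| + |max (a - c) 0 - max (b - c) 0| = |a - b| := by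
  rcases le_total a c with h1 | h1 <;> rcases le_total b c with h2 | h2
  · rw [min_eq_left h1, min_eq_left h2, max_eq_right (by linarith), max_eq_right (by linarith)]; simp
  · rw [min_eq_left h1, min_eq_right h2, max_eq_right (by linarith), max_eq_left (by linarith),
      abs_of_nonpos (by linarith), abs_of_nonpos (by linarith), abs_of_nonpos (by linarith)]
    ring
  · rw [min_eq_right h1, min_eq_left h2, max_eq_left (by linarith), max_eq_right (by linarith),
      abs_of_nonneg (by linarith), abs_of_nonneg (by linarith), abs_of_nonneg (by linarith)]
    ring
  · rw [min_eq_right h1, min_eq_right h2, max_eq_left (by linarith), max_eq_left (by linarith)]; simp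

/-- Truncation on the blocks reduces the total variation by twice the height of the peaks. -/
theorem tv_cut_add_le {p q : ℤ} {B : Finset ι} (hB : BlocksDisjoint lo hi B) {s : ℤ → ℝ}
    {peak : ι → ℤ} {C : ι → ℝ} (hpq : ∀ b ∈ B, p ≤ lo b ∧ hi b ≤ q)
    (hpeak : ∀ b ∈ B, lo b ≤ peak b ∧ peak b ≤ hi b ∧ C b ≤ s (peak b))
    (hend : ∀ b ∈ B, s (lo b) ≤ c b ∧ s (hi b) ≤ c b) :
    tv p q (cut lo hi c B s) + ∑ b ∈ B, 2 * (C b - c b) ≤ tv p q s := by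
  classical
  induction B using Finset.induction_on with
  | empty =>
    have : cut lo hi c ∅ s = s := by funext j; simp [cut]
    rw [this]; simp
  | insert b B hb ih =>
    have hB' : BlocksDisjoint lo hi B := fun b hb b' hb' =>
      hB b (Finset.mem_insert_of_mem hb) b' (Finset.mem_insert_of_mem hb')
    have hmem := Finset.mem_insert_self b B
    have := ih hB' (fun b hb => hpq b (Finset.mem_insert_of_mem hb))
      (fun b hb => hpeak b (Finset.mem_insert_of_mem hb))
      (fun b hb => hend b (Finset.mem_insert_of_mem hb))
    rw [Finset.sum_insert hb]
    suffices h : tv p q (cut lo hi c (insert b B) s) + 2 * (C b - c b) ≤ tv p q (cut lo hi c B s) by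
      linarith
    set x : ℤ → ℝ := fun j => if lo b ≤ j ∧ j ≤ hi b then max (s j - c b) 0 else 0 with hx
    have hcut : ∀ j, cut lo hi c (insert b B) s j = cut lo hi c B s j - x j := fun j => by
      rw [cut, Finset.sum_insert hb, cut, hx]; ring
    have hout : ∀ j, ¬ (lo b < j ∧ j < hi b) → x j = 0 := by
      intro j hj
      simp only [hx]
      split_ifs with h
      · refine max_eq_right ?_
        rcases eq_or_ne j (lo b) with rfl | h1
        · linarith [(hend b hmem).1]
        · rcases eq_or_ne j (hi b) with rfl | h2
          · linarith [(hend b hmem).2]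
          · omega
      · rfl
    -- Cutting splits the variation exactly into that of the truncated sequence and that of the
    -- removed part `x`. The latter vanishes at both ends and reaches at least `C b - c b` at the
    -- peak, hence accounts for twice that height.
    have hsum : tv p q (cut lo hi c (insert b B) s) + tv p q x = tv p q (cut lo hi c B s) := by
      unfold tv
      rw [← Finset.sum_add_distrib]
      refine Finset.sum_congr rfl fun j _ => ?_
      by_cases hin : lo b ≤ j ∧ j + 1 ≤ hi b
      · have hBout : ∀ i, lo b ≤ i → i ≤ hi b → cut lo hi c B s i = s i := fun i h1 h2 =>
          cut_of_notMem (fun b' hb' hc => hb (by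
            rw [hB b hmem b' (Finset.mem_insert_of_mem hb') i h1 h2 hc.1 hc.2]; exact hb')) s
        rw [cut_of_mem hB hmem hin.1 (by omega), cut_of_mem hB hmem (by omega) hin.2,
          hBout j hin.1 (by omega), hBout (j + 1) (by omega) hin.2]
        simp only [hx]
        rw [if_pos ⟨by omega, hin.2⟩, if_pos ⟨hin.1, by omega⟩]
        exact abs_min_sub_min_add _ _ _
      · rw [hcut, hcut, hout j (by omega), hout (j + 1) (by omega)]
        simp
    have hp := hpq b hmem
    obtain ⟨k1, k2, k3⟩ := hpeak b hmem
    have h1 := abs_sub_le_tv x (show p ≤ peak b by omega)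
    have h2 := abs_sub_le_tv x (show peak b ≤ q by omega)
    rw [hout p (by omega)] at h1
    rw [hout q (by omega)] at h2
    have h3 := tv_split x (show p ≤ peak b by omega) (show peak b ≤ q by omega)
    have h4 : C b - c b ≤ x (peak b) := by
      simp only [hx]
      rw [if_pos ⟨k1, k2⟩]
      exact le_max_of_le_left (by linarith)
    have h5 := le_abs_self (x (peak b) - 0)
    have h6 := neg_abs_le (0 - x (peak b))
    linarith

end Blocks

/-! ### A Gauss–Seidel scheme for the lattice equation -/

section Scheme

variable {g ψ f : ℝ → ℝ} {L : ℝ}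

open Classical in
/-- One explicit Euler step of length `h` at the sites in `A`. -/
noncomputable def eulerOn (g ψ : ℝ → ℝ) (h c : ℝ) (A : Set ℤ) (x : ℤ → ℝ) (j : ℤ) : ℝ :=
  if j ∈ A then x j + h * force g ψ c x j else x j

/-- The even sites strictly between `p` and `q`. -/
def evens (p q : ℤ) : Set ℤ := {j | (p < j ∧ j < q) ∧ Even j}

/-- The odd sites strictly between `p` and `q`. -/
def odds (p q : ℤ) : Set ℤ := {j | (p < j ∧ j < q) ∧ ¬ Even j}

/-- The even sites are updated first, then the odd ones; sites outside `(p, q)` follow `b`. -/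
noncomputable def schemeStep (g ψ : ℝ → ℝ) (p q : ℤ) (h c : ℝ) (b x : ℤ → ℝ) (j : ℤ) : ℝ :=
  if p < j ∧ j < q then eulerOn g ψ h c (odds p q) (eulerOn g ψ h c (evens p q) x) j else b j

/-- The scheme on the window `(p, q)` with exact boundary data `bd`. -/
noncomputable def scheme (g ψ f : ℝ → ℝ) (p q : ℤ) (h : ℝ) (bd : ℕ → ℤ → ℝ) (x : ℤ → ℝ) : ℕ → ℤ → ℝ
  | 0 => x
  | k + 1 => schemeStep g ψ p q h (f (k * h)) (bd (k + 1)) (scheme g ψ f p q h bd x k)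

lemma MonoLip.abs_force_sub_le (hm : MonoLip g ψ L) (c : ℝ) (x y : ℤ → ℝ) (j : ℤ) :
    |force g ψ c x j - force g ψ c y j| ≤
      L * (|x (j + 1) - y (j + 1)| + |x (j - 1) - y (j - 1)| + 3 * |x j - y j|) := by
  have h1 := hm.abs_sub_le (x (j + 1) - x j) (y (j + 1) - y j)
  have h2 := hm.abs_sub_le (x j - x (j - 1)) (y j - y (j - 1))
  have h3 := hm.lip_site (x j) (y j)
  have e1 : |x (j + 1) - x j - (y (j + 1) - y j)| ≤ |x (j + 1) - y (j + 1)| + |x j - y j| := by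
    rw [show x (j + 1) - x j - (y (j + 1) - y j) = (x (j + 1) - y (j + 1)) - (x j - y j) by ring]
    exact abs_sub _ _
  have e2 : |x j - x (j - 1) - (y j - y (j - 1))| ≤ |x j - y j| + |x (j - 1) - y (j - 1)| := by
    rw [show x j - x (j - 1) - (y j - y (j - 1)) = (x j - y j) - (x (j - 1) - y (j - 1)) by ring]
    exact abs_sub _ _
  have f1 := abs_le.1 (h1.trans (mul_le_mul_of_nonneg_left e1 hm.nonneg))
  have f2 := abs_le.1 (h2.trans (mul_le_mul_of_nonneg_left e2 hm.nonneg))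
  have f3 := abs_le.1 h3
  rw [abs_le, force, force]
  constructor <;> linarith [f1.1, f1.2, f2.1, f2.2, f3.1, f3.2]

/-- Error propagation in one step. -/
lemma schemeStep_error (hm : MonoLip g ψ L) {p q : ℤ} {h c η B : ℝ} (hh : 0 ≤ h) (hLh : L * h ≤ 1)
    (hη : 0 ≤ η) (hB0 : 0 ≤ B) {x y y' b E : ℤ → ℝ} (hE0 : ∀ j, 0 ≤ E j)
    (hE : ∀ j, p < j → j < q → E (j + 1) ≤ 2 * E j ∧ E (j - 1) ≤ 2 * E j)
    (hx : ∀ j, p ≤ j → j ≤ q → |x j - y j| ≤ E j)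
    (hy : ∀ j, |y' j - y j - h * force g ψ c y j| ≤ h * η) (hB : ∀ j, |y' j - y j| ≤ h * B)
    (hb : ∀ j, j = p ∨ j = q → |b j - y' j| ≤ E j) {j : ℤ} (hpj : p ≤ j) (hjq : j ≤ q) :
    |schemeStep g ψ p q h c b x j - y' j| ≤
      E j * (1 + 35 * L * h) + h * (η + 2 * L * h * (η + B)) := by
  have hL := hm.nonneg
  have hLh0 : 0 ≤ L * h := by positivity
  have hupd : ∀ z : ℤ → ℝ, ∀ j, |z j + h * force g ψ c z j - y' j| ≤
      |z j - y j| + h * (L * (|z (j + 1) - y (j + 1)| + |z (j - 1) - y (j - 1)| + 3 * |z j - y j|)) +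
        h * η := by
    intro z j
    have e1 := hm.abs_force_sub_le c z y j
    have e2 := hy j
    have e3 : z j + h * force g ψ c z j - y' j = (z j - y j) +
        h * (force g ψ c z j - force g ψ c y j) - (y' j - y j - h * force g ψ c y j) := by ring
    rw [e3]
    refine (abs_sub _ _).trans (add_le_add ((abs_add_le _ _).trans ?_) e2)
    rw [abs_mul, abs_of_nonneg hh]
    gcongr
  set e := eulerOn g ψ h c (evens p q) x with he
  have heven : ∀ j, j ∈ evens p q → |e j - y' j| ≤ E j * (1 + 7 * L * h) + h * η := by
    intro j hj
    rw [he, eulerOn, if_pos hj]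
    refine (hupd x j).trans ?_
    have h0 := hx j (by have := hj.1.1; omega) (by have := hj.1.2; omega)
    have h1 := (hx (j + 1) (by have := hj.1.1; omega) (by have := hj.1.2; omega)).trans
      (hE j hj.1.1 hj.1.2).1
    have h2 := (hx (j - 1) (by have := hj.1.1; omega) (by have := hj.1.2; omega)).trans
      (hE j hj.1.1 hj.1.2).2
    calc _ ≤ E j + h * (L * (2 * E j + 2 * E j + 3 * E j)) + h * η := by gcongr
      _ = _ := by ring
  have hnot : ∀ j, j ∉ evens p q → e j = x j := fun j hj => by rw [he, eulerOn, if_neg hj]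
  -- The odd sites use the already updated even values, which are compared here with the exact
  -- values before the step; this costs `h * (η + B)`. The factor `8` is `1 + 7` with `L * h ≤ 1`,
  -- and `35 = 16 + 16 + 3` follows from it at the odd sites.
  have hev : ∀ j, p ≤ j → j ≤ q → |e j - y j| ≤ 8 * E j + h * (η + B) := by
    intro j h1 h2
    by_cases hj : j ∈ evens p q
    · have e1 := heven j hj
      have e2 := hB j
      have e3 : |e j - y j| ≤ |e j - y' j| + |y' j - y j| := abs_sub_le _ _ _
      have e4 : E j * (L * h) ≤ E j * 1 := mul_le_mul_of_nonneg_left hLh (hE0 j)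
      linarith
    · rw [hnot j hj]
      have := hx j h1 h2
      have := hE0 j
      have : 0 ≤ h * (η + B) := by positivity
      linarith
  have hpos : 0 ≤ 2 * L * h * (η + B) := by positivity
  unfold schemeStep
  split_ifs with hin
  · rw [eulerOn]
    split_ifs with hodd
    · have hnj : j ∉ evens p q := fun hc => hodd.2 hc.2
      refine (hupd e j).trans ?_
      rw [hnot j hnj]
      have h0 := hx j hpj hjq
      have h1 := hev (j + 1) (by omega) (by omega)
      have h2 := hev (j - 1) (by omega) (by omega)
      have h3 := (hE j hin.1 hin.2).1
      have h4 := (hE j hin.1 hin.2).2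
      calc _ ≤ E j + h * (L * ((8 * (2 * E j) + h * (η + B)) + (8 * (2 * E j) + h * (η + B)) +
            3 * E j)) + h * η := by
            gcongr <;> linarith
        _ = _ := by ring
    · have hj : j ∈ evens p q := ⟨hin, by by_contra hc; exact hodd ⟨hin, hc⟩⟩
      refine (heven j hj).trans ?_
      have : 0 ≤ E j * (28 * L * h) := mul_nonneg (hE0 j) (by positivity)
      nlinarith [mul_nonneg hh hpos]
  · refine (hb j (by omega)).trans ?_
    have : 0 ≤ E j * (35 * L * h) := mul_nonneg (hE0 j) (by positivity)
    have : 0 ≤ h * (η + 2 * L * h * (η + B)) := by positivity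
    linarith

lemma abs_force_le {M c : ℝ} (hg : ∀ p, |g p| ≤ M) (hψ : ∀ p, |ψ p| ≤ M) (u : ℤ → ℝ) (j : ℤ) :
    |force g ψ c u j| ≤ 3 * M + |c| := by
  have h1 := abs_le.1 (hg (u (j + 1) - u j))
  have h2 := abs_le.1 (hg (u j - u (j - 1)))
  have h3 := abs_le.1 (hψ (u j))
  have h4 := neg_abs_le c
  have h5 := le_abs_self c
  rw [abs_le, force]
  constructor <;> linarith [h1.1, h1.2, h2.1, h2.2, h3.1, h3.2]

lemma SolvesOn.abs_sub_le {T B : ℝ} {U : ℝ → ℤ → ℝ} (hU : SolvesOn g ψ f T U)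
    (hB : ∀ t ∈ Icc 0 T, ∀ j, |force g ψ (f t) (U t) j| ≤ B) {s t : ℝ} (hs : 0 ≤ s) (hst : s ≤ t)
    (ht : t ≤ T) (j : ℤ) : |U t j - U s j| ≤ B * (t - s) := by
  refine norm_image_sub_le_of_norm_deriv_le_segment' (f := fun r => U r j)
    (f' := fun r => force g ψ (f r) (U r) j) (fun r hr => ?_)
    (fun r hr => hB r ⟨hs.trans hr.1, hr.2.le.trans ht⟩ j) t ⟨hst, le_rfl⟩
  exact (hU.hderiv r ⟨hs.trans hr.1, hr.2.trans ht⟩ j).mono (Icc_subset_Icc hs ht)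

/-- Local truncation error of the Euler step. -/
lemma SolvesOn.euler_error (hm : MonoLip g ψ L) {T B ω : ℝ} {U : ℝ → ℤ → ℝ}
    (hU : SolvesOn g ψ f T U) (hB : ∀ t ∈ Icc 0 T, ∀ j, |force g ψ (f t) (U t) j| ≤ B) {t h : ℝ}
    (ht : 0 ≤ t) (hh : 0 ≤ h) (hth : t + h ≤ T) (hω : ∀ r, t ≤ r → r ≤ t + h → |f r - f t| ≤ ω)
    (hB0 : 0 ≤ B) (j : ℤ) :
    |U (t + h) j - U t j - h * force g ψ (f t) (U t) j| ≤ h * (5 * L * B * h + ω) := by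
  have hL := hm.nonneg
  have := norm_image_sub_le_of_norm_deriv_le_segment' (a := t) (b := t + h)
    (f := fun r => U r j - r * force g ψ (f t) (U t) j)
    (f' := fun r => force g ψ (f r) (U r) j - 1 * force g ψ (f t) (U t) j) (C := 5 * L * B * h + ω)
    (fun r hr => ?_) (fun r hr => ?_) (t + h) ⟨by linarith, le_rfl⟩
  · rw [Real.norm_eq_abs] at this
    calc _ = |U (t + h) j - (t + h) * force g ψ (f t) (U t) j -
          (U t j - t * force g ψ (f t) (U t) j)| := by congr 1; ring
      _ ≤ _ := this
      _ = _ := by ring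
  · exact ((hU.hderiv r ⟨ht.trans hr.1, hr.2.trans hth⟩ j).mono (Icc_subset_Icc ht hth)).sub
      (((hasDerivAt_id r).mul_const _).hasDerivWithinAt)
  · have e0 : ∀ i, |U r i - U t i| ≤ B * h := fun i =>
      (hU.abs_sub_le hB ht hr.1 (hr.2.le.trans hth) i).trans (by
        have : r - t ≤ h := by linarith [hr.2]
        gcongr)
    have e1 := (hm.abs_force_sub_le (f t) (U r) (U t) j).trans (mul_le_mul_of_nonneg_left
      (show _ ≤ 5 * (B * h) by linarith [e0 (j + 1), e0 (j - 1), e0 j]) hL)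
    have e2 := hω r hr.1 hr.2.le
    have e3 : force g ψ (f r) (U r) j - 1 * force g ψ (f t) (U t) j =
        (force g ψ (f t) (U r) j - force g ψ (f t) (U t) j) + (f r - f t) := by
      unfold force; ring
    rw [e3, Real.norm_eq_abs]
    refine (abs_add_le _ _).trans ?_
    linarith

/-- Convergence of the scheme, with a weight that controls the influence of the boundary. -/
theorem exists_scheme_error (hm : MonoLip g ψ L) {M : ℝ} (hg : ∀ p, |g p| ≤ M)
    (hψ : ∀ p, |ψ p| ≤ M) (hf : Continuous f) {T : ℝ} (hT : 0 ≤ T) {ε : ℝ} (hε : 0 < ε) :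
    ∃ n₀ : ℕ, ∀ n : ℕ, n₀ ≤ n → 0 < n → ∀ (U : ℝ → ℤ → ℝ), SolvesOn g ψ f T U →
      ∀ (p q : ℤ) (A : ℤ → ℝ), (∀ j, 0 ≤ A j) →
      (∀ j, p < j → j < q → A (j + 1) ≤ 2 * A j ∧ A (j - 1) ≤ 2 * A j) →
      ∀ (x : ℤ → ℝ) (bd : ℕ → ℤ → ℝ), (∀ j, p ≤ j → j ≤ q → |x j - U 0 j| ≤ A j) →
      (∀ k ≤ n, ∀ j, j = p ∨ j = q → |bd k j - U (k * (T / n)) j| ≤ A j) →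
      ∀ k ≤ n, ∀ j, p ≤ j → j ≤ q → |scheme g ψ f p q (T / n) bd x k j - U (k * (T / n)) j| ≤
        (A j + ε) * Real.exp (35 * L * T) := by
  have hL := hm.nonneg
  have hM : 0 ≤ M := (abs_nonneg _).trans (hg 0)
  obtain ⟨N, hN⟩ := (isCompact_Icc (a := (0 : ℝ)) (b := T)).exists_bound_of_continuousOn
    (f := f) hf.continuousOn
  have hN0 : 0 ≤ N := (norm_nonneg _).trans (hN 0 ⟨le_rfl, hT⟩)
  set B := 3 * M + N with hBdef
  have hB0 : 0 ≤ B := by positivity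
  -- the modulus of continuity of the driving
  set ω := ε / (4 * (T + 1)) with hωdef
  have hω0 : 0 < ω := by positivity
  obtain ⟨d, hd, hdω⟩ := Metric.uniformContinuousOn_iff.1
    (isCompact_Icc.uniformContinuousOn_of_continuous (hf.continuousOn (s := Icc 0 T))) ω hω0
  have hlim : Tendsto (fun n : ℕ => T / (n : ℝ)) atTop (𝓝 0) :=
    tendsto_const_nhds.div_atTop tendsto_natCast_atTop_atTop
  have hcont : Tendsto (fun n : ℕ => (5 * L * B * (T / n) + ω) +
      2 * L * (T / n) * ((5 * L * B * (T / n) + ω) + B)) atTop (𝓝 ((5 * L * B * 0 + ω) +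
      2 * L * 0 * ((5 * L * B * 0 + ω) + B))) := by
    have h1 := (hlim.const_mul (5 * L * B)).add_const ω
    exact h1.add ((hlim.const_mul (2 * L)).mul (h1.add_const B))
  have hev1 : ∀ᶠ n : ℕ in atTop, (5 * L * B * (T / n) + ω) +
      2 * L * (T / n) * ((5 * L * B * (T / n) + ω) + B) < 2 * ω :=
    hcont.eventually_lt_const (by simp; linarith)
  have hev2 : ∀ᶠ n : ℕ in atTop, L * (T / n) < 1 :=
    (hlim.const_mul L).eventually_lt_const (by simp)
  have hev3 : ∀ᶠ n : ℕ in atTop, T / (n : ℝ) < d := hlim.eventually_lt_const hd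
  obtain ⟨n₀, hn₀⟩ := eventually_atTop.1 (hev1.and (hev2.and hev3))
  refine ⟨n₀, fun n hn hnpos U hU p q A hA0 hA x bd hx hbd => ?_⟩
  obtain ⟨h1, h2, h3⟩ := hn₀ n hn
  set h := T / (n : ℝ) with hh
  have hh0 : 0 ≤ h := by positivity
  have hnh : (n : ℝ) * h = T := by
    rw [hh]; field_simp
  have hUB : ∀ t ∈ Icc 0 T, ∀ j, |force g ψ (f t) (U t) j| ≤ B := fun t ht j =>
    (abs_force_le hg hψ _ _).trans (by
      have : |f t| ≤ N := hN t ht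
      rw [hBdef]; linarith)
  have hkT : ∀ k : ℕ, k ≤ n → (k : ℝ) * h ≤ T := fun k hk => by
    rw [← hnh]; gcongr
  set η := 5 * L * B * h + ω with hη
  have hη0 : 0 ≤ η := by positivity
  set η' := η + 2 * L * h * (η + B) with hη'
  have hη'0 : 0 ≤ η' := by positivity
  have hT' : T * η' ≤ ε := by
    have : T * η' ≤ T * (2 * ω) := mul_le_mul_of_nonneg_left h1.le hT
    refine this.trans ?_
    rw [hωdef]
    have : T * (2 * (ε / (4 * (T + 1)))) = ε * (T / (2 * (T + 1))) := by field_simp; ring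
    rw [this]
    have : T / (2 * (T + 1)) ≤ 1 := by rw [div_le_one (by positivity)]; linarith
    nlinarith
  -- A discrete Grönwall estimate: each step multiplies the error by `1 + 35Lh` and adds `hη'`.
  -- Adding a constant to `A` preserves the property that it at most doubles from site to site.
  have key : ∀ k ≤ n, ∀ j, p ≤ j → j ≤ q → |scheme g ψ f p q h bd x k j - U (k * h) j| ≤
      (A j + k * h * η') * (1 + 35 * L * h) ^ k := by
    intro k
    induction k with
    | zero =>
      intro _ j h1 h2
      simpa [scheme] using hx j h1 h2
    | succ k ih =>
      intro hk j hpj hjq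
      have ih := ih (by omega)
      have hk1 := hkT (k + 1) hk
      have hcast : ((k + 1 : ℕ) : ℝ) * h = k * h + h := by push_cast; ring
      rw [hcast] at hk1
      have hkh : 0 ≤ (k : ℝ) * h := by positivity
      have hone : 1 ≤ 1 + 35 * L * h := by
        have : 0 ≤ 35 * L * h := by positivity
        linarith
      have hpow : (1 : ℝ) ≤ (1 + 35 * L * h) ^ k := one_le_pow₀ hone
      have hstep := schemeStep_error hm (p := p) (q := q) (c := f (k * h)) hh0 h2.le hη0 hB0
        (x := scheme g ψ f p q h bd x k) (y := U (k * h)) (y' := U (k * h + h)) (b := bd (k + 1))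
        (E := fun j => (A j + k * h * η') * (1 + 35 * L * h) ^ k)
        (fun j => by have := hA0 j; positivity) (fun j h1 h2 => by
          have := hA j h1 h2
          have h3 : 0 ≤ (k : ℝ) * h * η' := by positivity
          constructor
          · rw [← mul_assoc]; gcongr; linarith
          · rw [← mul_assoc]; gcongr; linarith) ih
        (fun j => hU.euler_error hm hUB hkh hh0 hk1 (fun r hr1 hr2 => by
          have := hdω r ⟨hkh.trans hr1, hr2.trans hk1⟩ (k * h) ⟨hkh, by linarith⟩ (by
            rw [Real.dist_eq, abs_of_nonneg (by linarith)]; linarith)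
          exact this.le) hB0 j)
        (fun j => by
          have := hU.abs_sub_le hUB hkh (show (k : ℝ) * h ≤ k * h + h by linarith) hk1 j
          linarith)
        (fun j hj => by
          have := hbd (k + 1) hk j hj
          rw [hcast] at this
          refine this.trans ?_
          have h4 : A j ≤ A j + k * h * η' := by
            have : 0 ≤ (k : ℝ) * h * η' := by positivity
            linarith
          have h5 := hA0 j
          calc A j ≤ (A j + k * h * η') * 1 := by linarith
            _ ≤ _ := by gcongr) hpj hjq
      rw [hcast]
      refine hstep.trans ?_
      have h5 := hA0 j
      have hpow' : (1 : ℝ) ≤ (1 + 35 * L * h) ^ (k + 1) := one_le_pow₀ hone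
      calc _ = (A j + k * h * η') * (1 + 35 * L * h) ^ (k + 1) + h * η' * 1 := by
            rw [pow_succ]; ring
        _ ≤ (A j + k * h * η') * (1 + 35 * L * h) ^ (k + 1) +
            h * η' * (1 + 35 * L * h) ^ (k + 1) := by gcongr
        _ = _ := by ring
  intro k hk j hpj hjq
  refine (key k hk j hpj hjq).trans ?_
  have h6 : (k : ℝ) * h * η' ≤ ε := le_trans (by have := hkT k hk; gcongr) hT'
  have h7 : (1 + 35 * L * h) ^ k ≤ Real.exp (35 * L * T) := by
    calc (1 + 35 * L * h) ^ k ≤ (Real.exp (35 * L * h)) ^ k := by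
          gcongr
          rw [add_comm]; exact Real.add_one_le_exp _
      _ = Real.exp (35 * L * (k * h)) := by rw [← Real.exp_nat_mul]; congr 1; ring
      _ ≤ _ := by
          rw [Real.exp_le_exp]
          have := hkT k hk
          gcongr
  have h8 := hA0 j
  gcongr

/-! ### Labels -/

/-- A family of sequences indexed by `ℝ`, filling every fibre monotonically. -/
structure IsFoliated (Φ : ℝ → ℤ → ℝ) : Prop where
  strictMono : ∀ j, StrictMono fun s => Φ s j
  continuous : ∀ j, Continuous fun s => Φ s j
  add_one : ∀ s j, Φ (s + 1) j = Φ s j + 1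

/-- The label of the leaf through `x j` at the site `j`. -/
noncomputable def label (Φ : ℝ → ℤ → ℝ) (x : ℤ → ℝ) (j : ℤ) : ℝ :=
  Function.invFun (fun s => Φ s j) (x j)

variable {Φ : ℝ → ℤ → ℝ} {x y : ℤ → ℝ} {s : ℝ} {j : ℤ}

lemma IsFoliated.surjective (hΦ : IsFoliated Φ) (j : ℤ) : Function.Surjective fun s => Φ s j :=
  surjective_of_map_add_one (hΦ.continuous j) fun s => hΦ.add_one s j

lemma IsFoliated.label_spec (hΦ : IsFoliated Φ) (x : ℤ → ℝ) (j : ℤ) : Φ (label Φ x j) j = x j :=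
  Function.rightInverse_invFun (hΦ.surjective j) (x j)

lemma IsFoliated.label_le_iff (hΦ : IsFoliated Φ) : label Φ x j ≤ s ↔ x j ≤ Φ s j := by
  rw [← hΦ.label_spec x j]
  exact ((hΦ.strictMono j).le_iff_le).symm

lemma IsFoliated.le_label_iff (hΦ : IsFoliated Φ) : s ≤ label Φ x j ↔ Φ s j ≤ x j := by
  rw [← hΦ.label_spec x j]
  exact ((hΦ.strictMono j).le_iff_le).symm

lemma IsFoliated.label_lt_iff (hΦ : IsFoliated Φ) : label Φ x j < s ↔ x j < Φ s j := by
  rw [← not_le, ← not_le, hΦ.le_label_iff]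

lemma IsFoliated.lt_label_iff (hΦ : IsFoliated Φ) : s < label Φ x j ↔ Φ s j < x j := by
  rw [← not_le, ← not_le, hΦ.label_le_iff]

lemma IsFoliated.label_eq_iff (hΦ : IsFoliated Φ) : label Φ x j = s ↔ x j = Φ s j := by
  rw [le_antisymm_iff, le_antisymm_iff, hΦ.label_le_iff, hΦ.le_label_iff]

/-- Monotonicity of the Euler step at a site. -/
lemma MonoLip.euler_sub_ge (hm : MonoLip g ψ L) {h c : ℝ} (hh : 0 ≤ h) {x y : ℤ → ℝ} {j : ℤ}
    (h1 : x (j - 1) ≤ y (j - 1)) (h2 : x j ≤ y j) (h3 : x (j + 1) ≤ y (j + 1)) :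
    (1 - 3 * L * h) * (y j - x j) ≤
      (y j + h * force g ψ c y j) - (x j + h * force g ψ c x j) := by
  have e1 := hm.sub_le (x (j + 1) - x j) (y (j + 1) - y j)
  have e2 := hm.sub_le (y j - y (j - 1)) (x j - x (j - 1))
  have e3 := (abs_le.1 (hm.lip_site (x j) (y j))).2
  rw [abs_of_nonpos (by linarith)] at e3
  have e4 : max (x (j + 1) - x j - (y (j + 1) - y j)) 0 ≤ y j - x j :=
    max_le (by linarith) (by linarith)
  have e5 : max (y j - y (j - 1) - (x j - x (j - 1))) 0 ≤ y j - x j :=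
    max_le (by linarith) (by linarith)
  have e6 := mul_le_mul_of_nonneg_left e4 hm.nonneg
  have e7 := mul_le_mul_of_nonneg_left e5 hm.nonneg
  have e8 : force g ψ c x j - force g ψ c y j ≤ 3 * L * (y j - x j) := by
    unfold force; linarith
  nlinarith [mul_le_mul_of_nonneg_left e8 hh]

variable {h c : ℝ}

lemma IsFoliated.eulerOn (hΦ : IsFoliated Φ) (hm : MonoLip g ψ L) (hψ : ∀ x, ψ (x + 1) = ψ x)
    (hh : 0 ≤ h) (hLh : 3 * L * h < 1) (A : Set ℤ) :
    IsFoliated fun s => eulerOn g ψ h c A (Φ s) where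
  strictMono j s s' hs := by
    have hlt := fun i => hΦ.strictMono i hs
    simp only [FrenkelKontorova.eulerOn]
    split_ifs
    · have := hm.euler_sub_ge (c := c) hh (hlt (j - 1)).le (hlt j).le (hlt (j + 1)).le
      have h2 : 0 < (1 - 3 * L * h) * (Φ s' j - Φ s j) :=
        mul_pos (by linarith) (sub_pos.2 (hlt j))
      linarith
    · exact hlt j
  continuous j := by
    have hgc : Continuous g := continuous_of_lip hm.abs_sub_le
    have hψc : Continuous ψ := continuous_of_lip hm.lip_site
    have h1 := hΦ.continuous j
    have h2 := hΦ.continuous (j + 1)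
    have h3 := hΦ.continuous (j - 1)
    simp only [FrenkelKontorova.eulerOn]
    split_ifs
    · unfold force
      exact h1.add (continuous_const.mul ((((hgc.comp (h2.sub h1)).sub (hgc.comp (h1.sub h3))).add
        (hψc.comp h1)).add continuous_const))
    · exact h1
  add_one s j := by
    simp only [FrenkelKontorova.eulerOn, force, hΦ.add_one, hψ, add_sub_add_right_eq_sub]
    split_ifs
    · ring
    · rfl

/-- Let `s` be the largest label at the site and its two neighbours. Then `x` lies below the leaf
`s` at all three; the Euler step is monotone for `3Lh < 1`, so the new value lies below the new
position of the same leaf. Likewise for the smallest label. -/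
lemma IsFoliated.hullStep_eulerOn (hΦ : IsFoliated Φ) (hm : MonoLip g ψ L)
    (hψ : ∀ x, ψ (x + 1) = ψ x) (hh : 0 ≤ h) (hLh : 3 * L * h < 1) (A : Set ℤ) (x : ℤ → ℝ) :
    HullStep A (label Φ x)
      (label (fun s => FrenkelKontorova.eulerOn g ψ h c A (Φ s)) (FrenkelKontorova.eulerOn g ψ h c A x)) := by
  have hΦ' := hΦ.eulerOn (c := c) hm hψ hh hLh A
  refine ⟨fun j hj => ?_, fun j hj => ?_, fun j hj => ?_⟩
  · rw [hΦ'.label_eq_iff]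
    simp only [FrenkelKontorova.eulerOn, if_neg hj]
    exact (hΦ.label_spec x j).symm
  · obtain ⟨i, hi, hmax⟩ := Finset.exists_max_image (Finset.Icc (j - 1) (j + 1)) (label Φ x)
      ⟨j, by simp⟩
    rw [Finset.mem_Icc] at hi
    refine ⟨i, abs_le.2 ⟨by omega, by omega⟩, ?_⟩
    have hle : ∀ k, j - 1 ≤ k → k ≤ j + 1 → x k ≤ Φ (label Φ x i) k := fun k h1 h2 =>
      hΦ.label_le_iff.1 (hmax k (Finset.mem_Icc.2 ⟨h1, h2⟩))
    rw [hΦ'.label_le_iff]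
    simp only [FrenkelKontorova.eulerOn, if_pos hj]
    have h2 := hle j (by omega) (by omega)
    have := hm.euler_sub_ge (c := c) hh (hle (j - 1) (by omega) (by omega)) h2
      (hle (j + 1) (by omega) (by omega))
    have h3 := mul_nonneg (show 0 ≤ 1 - 3 * L * h by linarith) (sub_nonneg.2 h2)
    linarith
  · obtain ⟨i, hi, hmin⟩ := Finset.exists_min_image (Finset.Icc (j - 1) (j + 1)) (label Φ x)
      ⟨j, by simp⟩
    rw [Finset.mem_Icc] at hi
    refine ⟨i, abs_le.2 ⟨by omega, by omega⟩, ?_⟩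
    have hle : ∀ k, j - 1 ≤ k → k ≤ j + 1 → Φ (label Φ x i) k ≤ x k := fun k h1 h2 =>
      hΦ.le_label_iff.1 (hmin k (Finset.mem_Icc.2 ⟨h1, h2⟩))
    rw [hΦ'.le_label_iff]
    simp only [FrenkelKontorova.eulerOn, if_pos hj]
    have h2 := hle j (by omega) (by omega)
    have := hm.euler_sub_ge (c := c) hh (hle (j - 1) (by omega) (by omega)) h2
      (hle (j + 1) (by omega) (by omega))
    have h3 := mul_nonneg (show 0 ≤ 1 - 3 * L * h by linarith) (sub_nonneg.2 h2)
    linarith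

/-! ### Labels along the scheme -/

section SchemeLabels

variable {p q : ℤ} {bΦ : ℕ → ℝ → ℤ → ℝ}

/-- The scheme applied to all the leaves of a moving foliation. -/
noncomputable def leafScheme (g ψ f : ℝ → ℝ) (p q : ℤ) (h : ℝ) (bΦ : ℕ → ℝ → ℤ → ℝ) (k : ℕ) (s : ℝ) :
    ℤ → ℝ := scheme g ψ f p q h (fun k => bΦ k s) (bΦ 0 s) k

/-- The scheme applied to `x`, with the boundary values moving along their leaves. -/
noncomputable def configScheme (g ψ f : ℝ → ℝ) (p q : ℤ) (h : ℝ) (bΦ : ℕ → ℝ → ℤ → ℝ) (x : ℤ → ℝ)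
    (k : ℕ) : ℤ → ℝ := scheme g ψ f p q h (fun k j => bΦ k (label (bΦ 0) x j) j) x k

lemma isFoliated_leafScheme (hm : MonoLip g ψ L) (hψ : ∀ x, ψ (x + 1) = ψ x) (hh : 0 ≤ h)
    (hLh : 3 * L * h < 1) (hb : ∀ k, IsFoliated (bΦ k)) (k : ℕ) :
    IsFoliated (leafScheme g ψ f p q h bΦ k) := by
  induction k with
  | zero => exact hb 0
  | succ k ih =>
    have h2 := (ih.eulerOn (c := f (k * h)) hm hψ hh hLh (evens p q)).eulerOn (c := f (k * h))
      hm hψ hh hLh (odds p q)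
    have hb' := hb (k + 1)
    have heq : ∀ s j, leafScheme g ψ f p q h bΦ (k + 1) s j = if p < j ∧ j < q then
        FrenkelKontorova.eulerOn g ψ h (f (k * h)) (odds p q) (FrenkelKontorova.eulerOn g ψ h (f (k * h))
          (evens p q) (leafScheme g ψ f p q h bΦ k s)) j else bΦ (k + 1) s j := fun s j => rfl
    refine ⟨fun j => ?_, fun j => ?_, fun s j => ?_⟩
    · by_cases hj : p < j ∧ j < q
      · simp only [heq, if_pos hj]; exact h2.strictMono j
      · simp only [heq, if_neg hj]; exact hb'.strictMono j
    · by_cases hj : p < j ∧ j < q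
      · simp only [heq, if_pos hj]; exact h2.continuous j
      · simp only [heq, if_neg hj]; exact hb'.continuous j
    · by_cases hj : p < j ∧ j < q
      · simp only [heq, if_pos hj]; exact h2.add_one s j
      · simp only [heq, if_neg hj]; exact hb'.add_one s j

/-- The labels in the scheme. -/
noncomputable def schemeLabel (g ψ f : ℝ → ℝ) (p q : ℤ) (h : ℝ) (bΦ : ℕ → ℝ → ℤ → ℝ) (x : ℤ → ℝ)
    (k : ℕ) : ℤ → ℝ := label (leafScheme g ψ f p q h bΦ k) (configScheme g ψ f p q h bΦ x k)

/-- Boundary values are carried by their own leaves, so their labels are frozen. For this reason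
`configScheme` uses these boundary data and not those of the true solution. -/
lemma schemeLabel_of_not_mem (hm : MonoLip g ψ L) (hψ : ∀ x, ψ (x + 1) = ψ x) (hh : 0 ≤ h)
    (hLh : 3 * L * h < 1) (hb : ∀ k, IsFoliated (bΦ k)) (k : ℕ) {j : ℤ} (hj : ¬ (p < j ∧ j < q)) :
    schemeLabel g ψ f p q h bΦ x k j = label (bΦ 0) x j := by
  cases k with
  | zero => rfl
  | succ k =>
    refine (isFoliated_leafScheme hm hψ hh hLh hb (k + 1)).label_eq_iff.2 ?_
    change schemeStep _ _ _ _ _ _ _ _ _ = schemeStep _ _ _ _ _ _ _ _ _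
    rw [schemeStep, schemeStep, if_neg hj, if_neg hj]

/-- Inside the window both leaves and configuration undergo the same two half-steps, each a hull
step. Outside it the labels do not change, which is what a hull step on interior sites demands. -/
lemma exists_hullSteps (hm : MonoLip g ψ L) (hψ : ∀ x, ψ (x + 1) = ψ x) (hh : 0 ≤ h)
    (hLh : 3 * L * h < 1) (hb : ∀ k, IsFoliated (bΦ k)) (x : ℤ → ℝ) (k : ℕ) :
    ∃ l, HullStep (evens p q) (schemeLabel g ψ f p q h bΦ x k) l ∧
      HullStep (odds p q) l (schemeLabel g ψ f p q h bΦ x (k + 1)) := by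
  have hk := isFoliated_leafScheme (p := p) (q := q) (f := f) hm hψ hh hLh hb k
  have h1 := hk.hullStep_eulerOn (c := f (k * h)) hm hψ hh hLh (evens p q)
    (configScheme g ψ f p q h bΦ x k)
  have hk' := hk.eulerOn (c := f (k * h)) hm hψ hh hLh (evens p q)
  have h2 := hk'.hullStep_eulerOn (c := f (k * h)) hm hψ hh hLh (odds p q)
    (FrenkelKontorova.eulerOn g ψ h (f (k * h)) (evens p q) (configScheme g ψ f p q h bΦ x k))
  have hk'' := hk'.eulerOn (c := f (k * h)) hm hψ hh hLh (odds p q)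
  have hk1 := isFoliated_leafScheme (p := p) (q := q) (f := f) hm hψ hh hLh hb (k + 1)
  refine ⟨_, h1, ?_⟩
  have heq : ∀ j, p < j ∧ j < q → schemeLabel g ψ f p q h bΦ x (k + 1) j = label
      (fun s => FrenkelKontorova.eulerOn g ψ h (f (k * h)) (odds p q) (FrenkelKontorova.eulerOn g ψ h
        (f (k * h)) (evens p q) (leafScheme g ψ f p q h bΦ k s)))
      (FrenkelKontorova.eulerOn g ψ h (f (k * h)) (odds p q) (FrenkelKontorova.eulerOn g ψ h
        (f (k * h)) (evens p q) (configScheme g ψ f p q h bΦ x k))) j := by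
    intro j hj
    refine hk1.label_eq_iff.2 ?_
    change schemeStep _ _ _ _ _ _ _ _ _ = schemeStep _ _ _ _ _ _ _ _ _
    rw [schemeStep, schemeStep, if_pos hj, if_pos hj]
    exact (hk''.label_spec _ j).symm
  refine ⟨fun j hj => ?_, fun j hj => ?_, fun j hj => ?_⟩
  · by_cases hin : p < j ∧ j < q
    · rw [heq j hin]; exact h2.eq j hj
    · rw [schemeLabel_of_not_mem hm hψ hh hLh hb (k + 1) hin, h1.eq j (fun hc => hin hc.1)]
      exact (schemeLabel_of_not_mem hm hψ hh hLh hb k hin).symm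
  · rw [heq j hj.1]; exact h2.le j hj
  · rw [heq j hj.1]; exact h2.ge j hj

end SchemeLabels

end Scheme

/-! ### Labels with respect to a foliation -/

namespace Foliation

variable {W V f : ℝ → ℝ} {ρ : ℝ} (F : Foliation W V f ρ)

/-- The images of the leaves under the flow. -/
noncomputable def moving (t s : ℝ) (j : ℤ) : ℝ := (flow W V f t (F.leaf s)).1 j

/-- The labels of a configuration: at each site, the leaf through its value. -/
noncomputable def lab (z : Config) (j : ℤ) : ℝ := (F.pos j).symm (z.1 j)

lemma pos_lab (z : Config) (j : ℤ) : F.pos j (F.lab z j) = z.1 j := (F.pos j).apply_symm_apply _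

lemma leaf_lab (z : Config) (j : ℤ) : (F.leaf (F.lab z j)).1 j = z.1 j := by
  rw [F.leaf_apply, F.pos_lab]

lemma leaf_add_int (s : ℝ) (n : ℤ) : F.leaf (s + n) = addInt n (F.leaf s) := by
  refine Subtype.ext (funext fun j => ?_)
  rw [addInt_apply, F.leaf_apply, F.leaf_apply,
    map_add_int_of_map_add_one (F.map_add_one _ (F.pos_mem j))]

lemma leaf_add_one (s : ℝ) : F.leaf (s + 1) = addInt 1 (F.leaf s) := by
  have := F.leaf_add_int s 1
  rwa [Int.cast_one] at this

lemma leaf_lt {s s' : ℝ} (h : s < s') (j : ℤ) : (F.leaf s).1 j < (F.leaf s').1 j := by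
  rw [F.leaf_apply, F.leaf_apply]; exact (F.pos j).strictMono h

lemma pos_add (m n : ℤ) (s : ℝ) : F.pos (m + n) s = F.pos m (F.pos n s) := by
  have := F.shift_leaf (-n) s
  rw [neg_neg] at this
  rw [← F.leaf_apply, ← F.leaf_apply _ m, ← this, shift_apply, sub_neg_eq_add]

lemma lab_shift (n : ℤ) (z : Config) (j : ℤ) :
    F.lab (shift n z) j = F.pos (-n) (F.lab z (j - n)) := by
  rw [lab, OrderIso.symm_apply_eq, ← F.pos_add, ← sub_eq_add_neg, F.pos_lab, shift_apply]

lemma lab_addInt (n : ℤ) (z : Config) (j : ℤ) : F.lab (addInt n z) j = F.lab z j + n := by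
  rw [lab, OrderIso.symm_apply_eq, map_add_int_of_map_add_one (F.map_add_one _ (F.pos_mem j)),
    F.pos_lab, addInt_apply]

lemma continuous_lab (j : ℤ) : Continuous fun z => F.lab z j :=
  (F.pos j).symm.continuous.comp (continuous_apply_config j)

lemma moving_zero (s : ℝ) (j : ℤ) : F.moving 0 s j = (F.leaf s).1 j := by rw [moving, flow_zero]

lemma moving_one (s : ℝ) (j : ℤ) : F.moving 1 s j = F.pos j (F.step s) := by
  rw [moving, F.flow_leaf, F.leaf_apply]

/-- Uniform continuity of the moving leaves with respect to the label. -/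
lemma exists_moving_close (hA : StandingAssumptions W V f) (T : ℝ) (R : ℕ) {η : ℝ} (hη : 0 < η) :
    ∃ δ > 0, ∀ s s', |s - s'| < δ → ∀ t ∈ Icc 0 T, ∀ j : ℤ, |j| ≤ R →
      |F.moving t s j - F.moving t s' j| ≤ η := by
  obtain ⟨R', ε, hε, h⟩ := exists_flow_close_of_close hA ρ F.width T R hη
  obtain ⟨δ, hδ, hc⟩ := F.equicontinuous ε hε
  refine ⟨δ, hδ, fun s s' hs t ht j hj => h _ _ (F.widthLE s) (F.widthLE s') (fun i _ => ?_) t ht j hj⟩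
  rw [F.leaf_apply, F.leaf_apply]
  exact (hc _ (F.pos_mem i) _ _ hs).le

lemma isFoliated_moving (hA : StandingAssumptions W V f) {t : ℝ} (ht : 0 ≤ t) :
    IsFoliated (F.moving t) where
  strictMono j _ _ h := flow_lt hA (fun j => F.leaf_lt h j) ht j
  continuous j := by
    rw [Metric.continuous_iff]
    intro s ε hε
    obtain ⟨δ, hδ, h⟩ := F.exists_moving_close hA t j.natAbs (half_pos hε)
    refine ⟨δ, hδ, fun s' hs => ?_⟩
    exact (h s' s hs t ⟨ht, le_rfl⟩ j (by rw [Int.natCast_natAbs])).trans_lt (half_lt_self hε)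
  add_one s j := by
    rw [moving, moving, F.leaf_add_one, flow_addInt hA _ _ ht]
    simp

lemma label_moving_zero (hA : StandingAssumptions W V f) (z : Config) :
    label (F.moving 0) z.1 = F.lab z := by
  funext j
  rw [(F.isFoliated_moving hA le_rfl).label_eq_iff, F.moving_zero, F.leaf_lab]

/-- Approximation of the labels along the flow by sequences that evolve by hull steps. -/
theorem exists_hull_approx (hA : StandingAssumptions W V f) (ρ' K T : ℝ) (hT : 0 ≤ T) {κ : ℝ}
    (hκ : 0 < κ) : ∃ R n₀ : ℕ, ∀ n : ℕ, n₀ ≤ n → 0 < n → ∀ z : Config, WidthLE ρ' K z.1 → ∀ p q : ℤ,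
      ∃ l : ℕ → ℤ → ℝ, l 0 = F.lab z ∧
        (∀ k, ∃ l', HullStep (evens p q) (l k) l' ∧ HullStep (odds p q) l' (l (k + 1))) ∧
        ∀ k ≤ n, ∀ j, p + R ≤ j → j + R ≤ q →
          |F.moving (k * (T / n)) (l k j) j - (flow W V f (k * (T / n)) z).1 j| ≤ κ := by
  rcases lt_or_ge K 0 with hK | hK
  · exact ⟨0, 0, fun n _ _ z hz => absurd hz.nonneg (not_le.2 hK)⟩
  have hKF : 0 ≤ F.width := (F.widthLE 0).nonneg
  set G := max (|ρ| + F.width + 1) (|ρ'| + K + 1) with hG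
  have hG0 : 0 ≤ G := le_max_of_le_left (by positivity)
  obtain ⟨L, hL⟩ := hA.admissible.exists_monoLip hG0
  obtain ⟨M₁, -, hM₁⟩ := hA.admissible.exists_trunc_bound hG0
  obtain ⟨M₂, -, hM₂⟩ := hA.admissible.exists_site_bound
  have hg : ∀ p, |trunc G (deriv W) p| ≤ max M₁ M₂ := fun p => (hM₁ p).trans (le_max_left _ _)
  have hψ : ∀ p, |deriv V p| ≤ max M₁ M₂ := fun p => (hM₂ p).trans (le_max_right _ _)
  have hper := hA.admissible.periodic_site
  have hL0 := hL.nonneg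
  obtain ⟨N, hN⟩ := (isCompact_Icc (a := (0 : ℝ)) (b := T)).exists_bound_of_continuousOn
    (f := f) hA.admissible.cont.continuousOn
  have hN0 : 0 ≤ N := (norm_nonneg _).trans (hN 0 ⟨le_rfl, hT⟩)
  have hM0 : 0 ≤ max M₁ M₂ := (abs_nonneg _).trans (hg 0)
  set B := 3 * max M₁ M₂ + N with hB
  have hB0 : 0 ≤ B := by positivity
  have hUB : ∀ U : ℝ → ℤ → ℝ, ∀ t ∈ Icc 0 T, ∀ j,
      |force (trunc G (deriv W)) (deriv V) (f t) (U t) j| ≤ B := fun U t ht j =>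
    (abs_force_le hg hψ _ _).trans (by
      have : |f t| ≤ N := hN t ht
      rw [hB]; linarith)
  set E := Real.exp (35 * L * T) with hE
  have hE0 : 0 < E := Real.exp_pos _
  obtain ⟨n₁, hn₁⟩ := exists_scheme_error hL hg hψ hA.admissible.cont hT
    (show 0 < κ / (4 * E) by positivity)
  obtain ⟨R, hR⟩ := exists_pow_lt_of_lt_one (show 0 < κ / (4 * E * (4 * (B * T) + 1)) by positivity)
    (by norm_num : (1 / 2 : ℝ) < 1)
  have hlim : Tendsto (fun n : ℕ => T / (n : ℝ)) atTop (𝓝 0) :=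
    tendsto_const_nhds.div_atTop tendsto_natCast_atTop_atTop
  obtain ⟨n₂, hn₂⟩ := eventually_atTop.1 ((hlim.const_mul (3 * L)).eventually_lt_const
    (show 3 * L * 0 < 1 by simp))
  refine ⟨R, max n₁ n₂, fun n hn hn0 z hz p q => ?_⟩
  set h := T / (n : ℝ) with hh
  have hh0 : 0 ≤ h := by positivity
  have hLh := hn₂ n ((le_max_right _ _).trans hn)
  have herr := hn₁ n ((le_max_left _ _).trans hn) hn0
  have hfol : ∀ k : ℕ, IsFoliated (F.moving (k * h)) := fun k =>
    F.isFoliated_moving hA (by positivity)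
  set bΦ : ℕ → ℝ → ℤ → ℝ := fun k => F.moving (k * h) with hbΦ
  have hb0 : bΦ 0 = F.moving 0 := by simp [hbΦ]
  refine ⟨schemeLabel (trunc G (deriv W)) (deriv V) f p q h bΦ z.1, ?_,
    fun k => exists_hullSteps hL hper hh0 hLh hfol z.1 k, fun k hk j hpj hjq => ?_⟩
  · rw [schemeLabel]
    change label (bΦ 0) z.1 = _
    rw [hb0, F.label_moving_zero hA]
  have hkT : ∀ k : ℕ, k ≤ n → (k : ℝ) * h ≤ T := fun k hk => by
    have : (n : ℝ) * h = T := by rw [hh]; field_simp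
    rw [← this]; gcongr
  have hsolF : ∀ s, SolvesOn (trunc G (deriv W)) (deriv V) f T (fun t => (flow W V f t (F.leaf s)).1) :=
    fun s => flow_solvesOn_trunc hA (F.widthLE s) (le_max_left _ _) T
  have hsolz : SolvesOn (trunc G (deriv W)) (deriv V) f T (fun t => (flow W V f t z).1) :=
    flow_solvesOn_trunc hA hz (le_max_right _ _) T
  set s := schemeLabel (trunc G (deriv W)) (deriv V) f p q h bΦ z.1 k j with hs
  have e0 := (isFoliated_leafScheme (p := p) (q := q) (f := f) hL hper hh0 hLh hfol k).label_spec
    (configScheme (trunc G (deriv W)) (deriv V) f p q h bΦ z.1 k) j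
  change leafScheme (trunc G (deriv W)) (deriv V) f p q h bΦ k s j = _ at e0
  -- A leaf has exact boundary data, so its weight is zero. For the configuration the boundary data
  -- are wrong, but by at most `2BT`, because both they and the solution move at speed at most `B`.
  -- This error enters with a weight that decays like `2^{-d}` at distance `d` from the boundary,
  -- and `R` makes it negligible.
  have e1 := herr _ (hsolF s) p q (fun _ => 0) (fun _ => le_rfl) (fun _ _ _ => by simp)
    (bΦ 0 s) (fun k => bΦ k s) (fun j _ _ => by rw [hb0]; simp [moving])
    (fun k _ j _ => by change |F.moving (k * h) s j - F.moving (k * h) s j| ≤ 0; simp)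
    k hk j (by omega) (by omega)
  have e2 := herr _ hsolz p q
    (fun j => 2 * (B * T) * ((1 / 2) ^ (j - p).natAbs + (1 / 2) ^ (q - j).natAbs))
    (fun _ => by positivity) (fun j h1 h2 => ?_) z.1 (fun k j => bΦ k (label (bΦ 0) z.1 j) j)
    (fun j _ _ => by simp; positivity) (fun k hk j hj => ?_) k hk j (by omega) (by omega)
  · change |leafScheme (trunc G (deriv W)) (deriv V) f p q h bΦ k s j - F.moving (k * h) s j| ≤ _ at e1
    change |configScheme (trunc G (deriv W)) (deriv V) f p q h bΦ z.1 k j - _| ≤ _ at e2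
    rw [e0] at e1
    have hpow : ∀ m : ℕ, R ≤ m → (1 / 2 : ℝ) ^ m ≤ κ / (4 * E * (4 * (B * T) + 1)) := fun m hm =>
      (pow_le_pow_of_le_one (by norm_num) (by norm_num) hm).trans hR.le
    have h1 := hpow (j - p).natAbs (by omega)
    have h2 := hpow (q - j).natAbs (by omega)
    have e3 : 2 * (B * T) * ((1 / 2 : ℝ) ^ (j - p).natAbs + (1 / 2) ^ (q - j).natAbs) ≤
        κ / (4 * E) := by
      calc _ ≤ 2 * (B * T) * (κ / (4 * E * (4 * (B * T) + 1)) + κ / (4 * E * (4 * (B * T) + 1))) := by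
            gcongr
        _ = κ / (4 * E) * (4 * (B * T) / (4 * (B * T) + 1)) := by field_simp; ring
        _ ≤ κ / (4 * E) * 1 := by
            gcongr
            rw [div_le_one (by positivity)]; linarith
        _ = _ := mul_one _
    have e4 := e2.trans (mul_le_mul_of_nonneg_right (add_le_add_left e3 _) hE0.le)
    have e5 : (κ / (4 * E) + κ / (4 * E)) * E = κ / 2 := by field_simp; ring
    have e6 : (0 + κ / (4 * E)) * E = κ / 4 := by field_simp; ring
    rw [e5] at e4
    rw [e6] at e1
    rw [abs_sub_comm] at e1
    calc _ ≤ _ := abs_sub_le _ (configScheme (trunc G (deriv W)) (deriv V) f p q h bΦ z.1 k j) _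
      _ ≤ κ := by linarith
  · have hp : ∀ a b : ℕ, b ≤ a + 1 → (1 / 2 : ℝ) ^ a ≤ 2 * (1 / 2) ^ b := fun a b hab => by
      have := pow_le_pow_of_le_one (by norm_num : (0 : ℝ) ≤ 1 / 2) (by norm_num) hab
      rw [pow_succ] at this
      linarith
    have h3 := hp (j + 1 - p).natAbs (j - p).natAbs (by omega)
    have h4 := hp (q - (j + 1)).natAbs (q - j).natAbs (by omega)
    have h5 := hp (j - 1 - p).natAbs (j - p).natAbs (by omega)
    have h6 := hp (q - (j - 1)).natAbs (q - j).natAbs (by omega)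
    have hBT : 0 ≤ 2 * (B * T) := by positivity
    constructor <;> nlinarith
  · have hk0 : (0 : ℝ) ≤ k * h := by positivity
    have h1 := hsolz.abs_sub_le (hUB _) le_rfl hk0 (hkT k hk) j
    have h2 := (hsolF (label (bΦ 0) z.1 j)).abs_sub_le (hUB _) le_rfl hk0 (hkT k hk) j
    have h3 : (flow W V f 0 (F.leaf (label (bΦ 0) z.1 j))).1 j = z.1 j := by
      have := (hfol 0).label_spec z.1 j
      exact this.symm ▸ (by simp [hbΦ, moving])
    have h4 : B * (k * h - 0) ≤ B * T := by
      rw [sub_zero]; exact mul_le_mul_of_nonneg_left (hkT k hk) hB0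
    beta_reduce at h1 h2
    rw [h3] at h2
    rw [flow_zero] at h1
    have h5 : |bΦ k (label (bΦ 0) z.1 j) j - (flow W V f (k * h) z).1 j| ≤ 2 * (B * T) := by
      change |(flow W V f (k * h) (F.leaf (label (bΦ 0) z.1 j))).1 j - _| ≤ _
      rw [abs_le] at *
      constructor <;> linarith [h1.1, h1.2, h2.1, h2.2]
    refine h5.trans (le_mul_of_one_le_right (by positivity) ?_)
    rcases hj with rfl | rfl
    · simp
    · simp

end Foliation

/-! ### Sweeps over the even and the odd sites -/

lemma not_mem_evens_succ {p q : ℤ} : ∀ j ∈ evens p q, j + 1 ∉ evens p q ∧ p < j ∧ j < q :=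
  fun _ hj => ⟨fun hc => by
    have h1 := hj.2
    have h2 := hc.2
    rw [Int.even_add_one] at h2
    exact h2 h1, hj.1⟩

lemma not_mem_odds_succ {p q : ℤ} : ∀ j ∈ odds p q, j + 1 ∉ odds p q ∧ p < j ∧ j < q :=
  fun _ hj => ⟨fun hc => by
    have h1 := hj.2
    have h2 := hc.2
    rw [Int.even_add_one, not_not] at h2
    exact h1 h2, hj.1⟩

/-- An update of the even sites followed by an update of the odd sites. -/
def HullSweep (p q : ℤ) (l l' : ℤ → ℝ) : Prop :=
  ∃ m, HullStep (evens p q) l m ∧ HullStep (odds p q) m l'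

lemma HullSweep.monotone {p q : ℤ} {l l' : ℤ → ℝ} (h : HullSweep p q l l') (hl : Monotone l) :
    Monotone l' := by
  obtain ⟨m, h1, h2⟩ := h
  exact h2.monotone (fun j hj => (not_mem_odds_succ j hj).1)
    (h1.monotone (fun j hj => (not_mem_evens_succ j hj).1) hl)

lemma HullSweep.antitone {p q : ℤ} {l l' : ℤ → ℝ} (h : HullSweep p q l l') (hl : Antitone l) :
    Antitone l' := by
  obtain ⟨m, h1, h2⟩ := h
  exact h2.antitone (fun j hj => (not_mem_odds_succ j hj).1)
    (h1.antitone (fun j hj => (not_mem_evens_succ j hj).1) hl)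

lemma HullSweep.comp_monotone {p q : ℤ} {l l' : ℤ → ℝ} (h : HullSweep p q l l') {θ : ℝ → ℝ}
    (hθ : Monotone θ) : HullSweep p q (fun j => θ (l j)) (fun j => θ (l' j)) := by
  obtain ⟨m, h1, h2⟩ := h
  exact ⟨_, h1.comp_monotone hθ, h2.comp_monotone hθ⟩

lemma HullSweep.neg {p q : ℤ} {l l' : ℤ → ℝ} (h : HullSweep p q l l') :
    HullSweep p q (fun j => -l j) (fun j => -l' j) := by
  obtain ⟨m, h1, h2⟩ := h
  exact ⟨_, h1.neg, h2.neg⟩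

lemma HullSweep.tv_le {p q : ℤ} {l l' : ℤ → ℝ} (h : HullSweep p q l l') : tv p q l' ≤ tv p q l := by
  obtain ⟨m, h1, h2⟩ := h
  exact (h2.tv_le not_mem_odds_succ).trans (h1.tv_le not_mem_evens_succ)

lemma HullSweep.cut {ι : Type*} {lo hi : ι → ℤ} {c : ι → ℝ} {B : Finset ι}
    (hB : BlocksDisjoint lo hi B) {p q : ℤ} {l l' : ℤ → ℝ} (h : HullSweep p q l l')
    (h1 : ∀ b ∈ B, l (lo b) ≤ c b ∧ l (hi b) ≤ c b)
    (h2 : ∀ b ∈ B, l' (lo b) ≤ c b ∧ l' (hi b) ≤ c b) :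
    HullSweep p q (cut lo hi c B l) (FrenkelKontorova.cut lo hi c B l') := by
  obtain ⟨m, e, o⟩ := h
  have hm : ∀ j, m j = l j ∨ m j = l' j := fun j => by
    by_cases hj : Even j
    · exact Or.inr (o.eq j fun hc => hc.2 hj).symm
    · exact Or.inl (e.eq j fun hc => hj hc.2)
  have h3 : ∀ b ∈ B, m (lo b) ≤ c b ∧ m (hi b) ≤ c b := fun b hb => by
    constructor
    · rcases hm (lo b) with h | h <;> rw [h]
      exacts [(h1 b hb).1, (h2 b hb).1]
    · rcases hm (hi b) with h | h <;> rw [h]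
      exacts [(h1 b hb).2, (h2 b hb).2]
  exact ⟨_, e.cut hB h1 h3, o.cut hB h3 h2⟩

/-- Decay of the total variation along hull sweeps, when the peaks on certain blocks have been
levelled at the time `r`. -/
lemma tv_add_le_of_hullSweep {ι : Type*} {lo hi peak : ι → ℤ} {c C : ι → ℝ} {B : Finset ι}
    (hB : BlocksDisjoint lo hi B) {p q : ℤ} {l : ℕ → ℤ → ℝ} (hl : ∀ k, HullSweep p q (l k) (l (k + 1)))
    (hpq : ∀ b ∈ B, p ≤ lo b ∧ hi b ≤ q) (hpeak : ∀ b ∈ B, lo b ≤ peak b ∧ peak b ≤ hi b ∧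
      C b ≤ l 0 (peak b)) {r n : ℕ} (hrn : r ≤ n)
    (hend : ∀ k ≤ r, ∀ b ∈ B, l k (lo b) ≤ c b ∧ l k (hi b) ≤ c b)
    (hlev : ∀ b ∈ B, ∀ j, lo b ≤ j → j ≤ hi b → l r j ≤ c b) :
    tv p q (l n) + ∑ b ∈ B, 2 * (C b - c b) ≤ tv p q (l 0) := by
  have h1 : tv p q (l n) ≤ tv p q (l r) := by
    induction n, hrn using Nat.le_induction with
    | base => exact le_rfl
    | succ n _ ih => exact (hl n).tv_le.trans ih
  have h2 : ∀ k ≤ r, tv p q (cut lo hi c B (l k)) ≤ tv p q (cut lo hi c B (l 0)) := by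
    intro k
    induction k with
    | zero => exact fun _ => le_rfl
    | succ k ih => exact fun hk =>
        ((hl k).cut hB (hend k (by omega)) (hend (k + 1) hk)).tv_le.trans (ih (by omega))
  have h3 : cut lo hi c B (l r) = l r := funext fun j => cut_eq_self hB hlev j
  have h4 := tv_cut_add_le hB hpq hpeak (hend 0 (by omega))
  have h5 := h2 r le_rfl
  rw [h3] at h5
  linarith

namespace Foliation

variable {W V f : ℝ → ℝ} {ρ : ℝ} (F : Foliation W V f ρ)

/-- A strict inequality of labels leaves room for a level `r` in between, and the approximating
sequence inherits the inequality once its error is below both distances to the leaf `r`. So any weak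
order relation kept by all sweeps is kept by the flow. -/
lemma exists_hullSweeps_of_label_lt (hA : StandingAssumptions W V f) {z : Config} {t : ℝ} (ht : 0 ≤ t)
    {i j : ℤ} (h : label (F.moving t) (flow W V f t z).1 i < label (F.moving t) (flow W V f t z).1 j) :
    ∃ (p q : ℤ) (l : ℕ → ℤ → ℝ), l 0 = F.lab z ∧ (∀ k, HullSweep p q (l k) (l (k + 1))) ∧
      ∃ k, l k i < l k j := by
  obtain ⟨ρ', K, hz⟩ := z.exists_widthLE
  have hfol := F.isFoliated_moving hA ht
  obtain ⟨r, hi, hj⟩ := exists_between h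
  rw [hfol.label_lt_iff] at hi
  rw [hfol.lt_label_iff] at hj
  set κ := min (F.moving t r i - (flow W V f t z).1 i) ((flow W V f t z).1 j - F.moving t r j) / 2 with hκ
  have hκ0 : 0 < κ := half_pos (lt_min (by linarith) (by linarith))
  have hκ1 : κ < F.moving t r i - (flow W V f t z).1 i :=
    (half_lt_self (lt_min (by linarith) (by linarith))).trans_le (min_le_left _ _)
  have hκ2 : κ < (flow W V f t z).1 j - F.moving t r j :=
    (half_lt_self (lt_min (by linarith) (by linarith))).trans_le (min_le_right _ _)
  obtain ⟨R, n₀, hn⟩ := F.exists_hull_approx hA ρ' K t ht hκ0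
  obtain ⟨l, h0, hl, happ⟩ := hn (n₀ + 1) (by omega) (by omega) z hz (min i j - R) (max i j + R)
  refine ⟨_, _, l, h0, hl, n₀ + 1, ?_⟩
  have e : ((n₀ + 1 : ℕ) : ℝ) * (t / (n₀ + 1 : ℕ)) = t := by
    have : ((n₀ + 1 : ℕ) : ℝ) ≠ 0 := by positivity
    field_simp
  have h1 := happ (n₀ + 1) le_rfl i (by omega) (by omega)
  have h2 := happ (n₀ + 1) le_rfl j (by omega) (by omega)
  rw [e] at h1 h2
  have h3 : l (n₀ + 1) i < r := (hfol.strictMono i).lt_iff_lt.1 (by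
    linarith [(abs_le.1 h1).2])
  have h4 : r < l (n₀ + 1) j := (hfol.strictMono j).lt_iff_lt.1 (by
    linarith [(abs_le.1 h2).1])
  exact h3.trans h4

/-- Monotonicity of the labels is preserved by the flow. -/
theorem monotone_label_flow (hA : StandingAssumptions W V f) {z : Config} (hz : Monotone (F.lab z))
    {t : ℝ} (ht : 0 ≤ t) : Monotone (label (F.moving t) (flow W V f t z).1) := by
  intro i j hij
  by_contra hc
  obtain ⟨p, q, l, h0, hl, k, hk⟩ := F.exists_hullSweeps_of_label_lt hA ht (not_le.1 hc)
  have : ∀ k, Monotone (l k) := fun k => by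
    induction k with
    | zero => rwa [h0]
    | succ k ih => exact (hl k).monotone ih
  exact absurd (this k hij) (not_le.2 hk)

theorem antitone_label_flow (hA : StandingAssumptions W V f) {z : Config} (hz : Antitone (F.lab z))
    {t : ℝ} (ht : 0 ≤ t) : Antitone (label (F.moving t) (flow W V f t z).1) := by
  intro i j hij
  by_contra hc
  obtain ⟨p, q, l, h0, hl, k, hk⟩ := F.exists_hullSweeps_of_label_lt hA ht (not_le.1 hc)
  have : ∀ k, Antitone (l k) := fun k => by
    induction k with
    | zero => rwa [h0]
    | succ k ih => exact (hl k).antitone ih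
  exact absurd (this k hij) (not_le.2 hk)

lemma label_moving_one (hA : StandingAssumptions W V f) (z : Config) (j : ℤ) :
    label (F.moving 1) z.1 j = F.step.symm (F.lab z j) := by
  rw [(F.isFoliated_moving hA zero_le_one).label_eq_iff, F.moving_one, F.step.apply_symm_apply,
    F.pos_lab]

/-- An element of the group moves points by at most their distance plus one. -/
lemma abs_group_sub_le {θ : ℝ ≃o ℝ} (hθ : θ ∈ F.group) (a b : ℝ) : |θ a - θ b| ≤ |a - b| + 1 := by
  wlog hab : b ≤ a generalizing a b with H
  · rw [abs_sub_comm, abs_sub_comm a]; exact H b a (le_of_not_ge hab)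
  have h1 := map_add_int_of_map_add_one (F.map_add_one θ hθ) b ⌈a - b⌉
  have h2 : θ a ≤ θ (b + ⌈a - b⌉) := θ.monotone (by linarith [Int.le_ceil (a - b)])
  have h3 := Int.ceil_lt_add_one (a - b)
  rw [abs_of_nonneg (sub_nonneg.2 (θ.monotone hab)), abs_of_nonneg (sub_nonneg.2 hab)]
  linarith

/-- Adjacent labels of configurations of bounded width differ by a bounded amount. -/
lemma abs_lab_sub_le {ρ' K : ℝ} {z : Config} (hz : WidthLE ρ' K z.1) {θ : ℝ ≃o ℝ} (hθ : θ ∈ F.group)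
    (j : ℤ) : |θ (F.lab z (j + 1)) - θ (F.lab z j)| ≤ |ρ| + F.width + (|ρ'| + K) + 1 := by
  have h1 := (F.widthLE (F.lab z j)).gap j
  have h2 := hz.gap j
  rw [F.leaf_lab] at h1
  have h3 : θ * (F.pos (j + 1))⁻¹ ∈ F.group := mul_mem hθ (inv_mem (F.pos_mem _))
  have h4 := F.abs_group_sub_le h3 (z.1 (j + 1)) ((F.leaf (F.lab z j)).1 (j + 1))
  rw [RelIso.mul_apply, RelIso.mul_apply] at h4
  have h5 : (F.pos (j + 1))⁻¹ (z.1 (j + 1)) = F.lab z (j + 1) := rfl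
  have h6 : (F.pos (j + 1))⁻¹ ((F.leaf (F.lab z j)).1 (j + 1)) = F.lab z j := by
    rw [F.leaf_apply]; exact (F.pos (j + 1)).symm_apply_apply _
  rw [h5, h6] at h4
  refine h4.trans ?_
  have h7 : |z.1 (j + 1) - (F.leaf (F.lab z j)).1 (j + 1)| ≤ |ρ| + F.width + (|ρ'| + K) := by
    rw [abs_le] at *
    constructor <;> linarith [h1.1, h1.2, h2.1, h2.2]
  linarith

end Foliation

/-! ### Decay of the total variation of the labels in one period -/

lemma mul_le_mul_of_sign {σ : ℝ} (hσ : σ = 1 ∨ σ = -1) {θ : ℝ → ℝ} (hθ : Monotone θ) {a b : ℝ}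
    (h : σ * a ≤ σ * b) : σ * θ a ≤ σ * θ b := by
  rcases hσ with rfl | rfl
  · simpa using hθ (by simpa using h)
  · have := hθ (show b ≤ a by linarith)
    linarith

/-- Closeness is assumed only at distance `R` from the ends of the window; the at most `2R`
increments near the ends are bounded crudely by `D`. -/
lemma tv_le_of_close {p q : ℤ} {R : ℕ} (hpq : p ≤ q) {a b : ℤ → ℝ} {ε D : ℝ} (hε : 0 ≤ ε)
    (hclose : ∀ j, p + R ≤ j → j + R ≤ q → |a j - b j| ≤ ε / 2)
    (hD : ∀ j, |a (j + 1) - a j| ≤ D) :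
    tv p q a ≤ tv p q b + ε * (q - p) + 2 * R * D := by
  have hD0 : 0 ≤ D := (abs_nonneg _).trans (hD 0)
  have hterm : ∀ j ∈ Finset.Ico p q, |a (j + 1) - a j| ≤ |b (j + 1) - b j| + ε +
      ((if j ∈ Finset.Ico p (p + R) then D else 0) + (if j ∈ Finset.Ico (q - R) q then D else 0)) := by
    intro j hj
    rw [Finset.mem_Ico] at hj
    have h1 : 0 ≤ if j ∈ Finset.Ico p (p + R) then D else 0 := by split_ifs <;> simp [hD0]
    have h2 : 0 ≤ if j ∈ Finset.Ico (q - R) q then D else 0 := by split_ifs <;> simp [hD0]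
    by_cases h : j < p + R
    · have h3 : (if j ∈ Finset.Ico p (p + R) then D else 0) = D :=
        if_pos (Finset.mem_Ico.2 ⟨hj.1, h⟩)
      linarith [hD j, abs_nonneg (b (j + 1) - b j)]
    by_cases h' : q - R ≤ j
    · have h3 : (if j ∈ Finset.Ico (q - R) q then D else 0) = D :=
        if_pos (Finset.mem_Ico.2 ⟨h', hj.2⟩)
      linarith [hD j, abs_nonneg (b (j + 1) - b j)]
    · have h3 := hclose j (by omega) (by omega)
      have h4 := hclose (j + 1) (by omega) (by omega)
      have h5 : |a (j + 1) - a j| ≤ |b (j + 1) - b j| + |a (j + 1) - b (j + 1)| + |a j - b j| := by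
        calc _ = |(b (j + 1) - b j) + (a (j + 1) - b (j + 1)) - (a j - b j)| := by congr 1; ring
          _ ≤ _ := (abs_sub _ _).trans (add_le_add_left (abs_add_le _ _) _)
      linarith
  have hsum := Finset.sum_le_sum hterm
  rw [Finset.sum_add_distrib, Finset.sum_add_distrib, Finset.sum_add_distrib, Finset.sum_const,
    Int.card_Ico, ← Finset.sum_filter, ← Finset.sum_filter, Finset.sum_const, Finset.sum_const,
    nsmul_eq_mul, nsmul_eq_mul, nsmul_eq_mul] at hsum
  have hc1 : ((Finset.Ico p q).filter (· ∈ Finset.Ico p (p + R))).card ≤ R := by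
    refine (Finset.card_le_card (t := Finset.Ico p (p + R)) fun j hj => (Finset.mem_filter.1 hj).2).trans ?_
    simp
  have hc2 : ((Finset.Ico p q).filter (· ∈ Finset.Ico (q - R) q)).card ≤ R := by
    refine (Finset.card_le_card (t := Finset.Ico (q - R) q) fun j hj => (Finset.mem_filter.1 hj).2).trans ?_
    simp
  have hc1' : (((Finset.Ico p q).filter (· ∈ Finset.Ico p (p + R))).card : ℝ) ≤ R := by exact_mod_cast hc1
  have hc2' : (((Finset.Ico p q).filter (· ∈ Finset.Ico (q - R) q)).card : ℝ) ≤ R := by exact_mod_cast hc2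
  have hq : (((q - p).toNat : ℕ) : ℝ) = q - p := by
    have : ((q - p).toNat : ℤ) = q - p := Int.toNat_of_nonneg (by omega)
    exact_mod_cast this
  rw [hq] at hsum
  have h1 := mul_le_mul_of_nonneg_right hc1' hD0
  have h2 := mul_le_mul_of_nonneg_right hc2' hD0
  unfold tv
  linarith

namespace Foliation

variable {W V f : ℝ → ℝ} {ρ : ℝ} (F : Foliation W V f ρ)

/-- The balance of variation over one period. The labels at time one are taken with respect to the
moved leaves, hence `F.step.symm`. Each block contains a peak of level `c b` that has sunk below the
leaf `c' b` by time `1/m`, while the ends of the block stay below that leaf up to then; twice the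
drop is lost. The sign `σ` handles minima, and `θ` allows labels to be read in any coordinate of the
group. The remaining terms are the errors of the approximation and of the ends of the window. -/
theorem exists_tv_step (hA : StandingAssumptions W V f) (ρ' K : ℝ) {m : ℕ} (hm : 0 < m) {η ε : ℝ}
    (hη : 0 < η) (hε : 0 < ε) : ∃ (R : ℕ) (C : ℝ), 0 ≤ C ∧ ∀ z : Config, WidthLE ρ' K z.1 →
      ∀ p q : ℤ, p ≤ q → ∀ θ ∈ F.group, ∀ σ : ℝ, σ = 1 ∨ σ = -1 →
      ∀ (B : Finset ℤ) (lo hi peak : ℤ → ℤ) (c c' : ℤ → ℝ), BlocksDisjoint lo hi B →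
      (∀ b ∈ B, p + R ≤ lo b ∧ hi b + R ≤ q ∧ lo b ≤ peak b ∧ peak b ≤ hi b) →
      (∀ b ∈ B, σ * c b ≤ σ * F.lab z (peak b)) →
      (∀ b ∈ B, ∀ t ∈ Icc (0 : ℝ) (1 / m), ∀ j, j = lo b ∨ j = hi b →
        η ≤ σ * (F.moving t (c' b) j - (flow W V f t z).1 j)) →
      (∀ b ∈ B, ∀ j, lo b ≤ j → j ≤ hi b →
        η ≤ σ * (F.moving (1 / m) (c' b) j - (flow W V f (1 / m) z).1 j)) →
      tv p q (fun j => θ (F.step.symm (F.lab (flow W V f 1 z) j))) +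
        ∑ b ∈ B, 2 * (σ * θ (c b) - σ * θ (c' b)) ≤ tv p q (fun j => θ (F.lab z j)) + ε * (q - p) + C := by
  rcases lt_or_ge K 0 with hK | hK
  · exact ⟨0, 0, le_rfl, fun z hz => absurd hz.nonneg (not_le.2 hK)⟩
  have hKF : 0 ≤ F.width := (F.widthLE 0).nonneg
  obtain ⟨δ, hδ, hequi⟩ := F.equicontinuous (ε / 2) (half_pos hε)
  obtain ⟨R, n₀, happ⟩ := F.exists_hull_approx hA ρ' K 1 zero_le_one
    (show 0 < min (η / 2) (δ / 2) by positivity)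
  set D := |ρ| + F.width + (|ρ'| + (K + 1)) + 1 with hD
  refine ⟨R, 2 * R * D, by positivity, fun z hz p q hpq θ hθ σ hσ B lo hi peak c c' hB hloc hpeak hend
    hlev => ?_⟩
  set r := n₀ + 1 with hr
  -- The number of steps is a multiple of `m`, so that the levelling time `1/m` is a grid time.
  set n := m * r with hn
  have hn0 : 0 < n := by positivity
  obtain ⟨l, h0, hl, hκ⟩ := happ n (by nlinarith) hn0 z hz p q
  have hn0' : (0 : ℝ) < n := by exact_mod_cast hn0
  have hm0' : (0 : ℝ) < m := by exact_mod_cast hm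
  have htr : (r : ℝ) * (1 / n) = 1 / m := by
    rw [hn]; push_cast
    have : (r : ℝ) ≠ 0 := by rw [hr]; positivity
    field_simp
  have htn : (n : ℝ) * (1 / n) = 1 := by field_simp
  have hrn : r ≤ n := by rw [hn]; exact Nat.le_mul_of_pos_left r hm
  -- the labels at the levels
  have hlow : ∀ k ≤ n, ∀ s j, p + R ≤ j → j + R ≤ q →
      η ≤ σ * (F.moving (k * (1 / n)) s j - (flow W V f (k * (1 / n)) z).1 j) → σ * l k j ≤ σ * s := by
    intro k hk s j h1 h2 h3
    have h4 := (hκ k hk j h1 h2).trans (min_le_left _ _)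
    have hmono := (F.isFoliated_moving hA (t := k * (1 / n)) (by positivity)).strictMono j
    rw [abs_le] at h4
    rcases hσ with rfl | rfl
    · have : l k j < s := hmono.lt_iff_lt.1 (by linarith [h4.2])
      linarith
    · have : s < l k j := hmono.lt_iff_lt.1 (by linarith [h4.1])
      linarith
  have hk1m : ∀ k ≤ r, (k : ℝ) * (1 / n) ∈ Icc (0 : ℝ) (1 / m) := fun k hk =>
    ⟨by positivity, by rw [← htr]; gcongr⟩
  have hθm := θ.monotone
  have htv : ∀ s : ℤ → ℝ, tv p q (fun j => σ * θ (s j)) = tv p q (fun j => θ (s j)) := fun s => by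
    rcases hσ with rfl | rfl
    · simp
    · simpa using tv_neg p q (fun j => θ (s j))
  have hmain := tv_add_le_of_hullSweep (l := fun k j => σ * θ (l k j)) (lo := lo) (hi := hi)
    (peak := peak) (c := fun b => σ * θ (c' b)) (C := fun b => σ * θ (c b)) (r := r) (n := n) hB
    (p := p) (q := q) (fun k => ?_) (fun b hb => by have := hloc b hb; omega)
    (fun b hb => ⟨(hloc b hb).2.2.1, (hloc b hb).2.2.2, ?_⟩) hrn (fun k hk b hb => ?_)
    (fun b hb j h1 h2 => ?_)
  · rw [htv, htv, h0] at hmain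
    have hclose : ∀ j, p + R ≤ j → j + R ≤ q →
        |θ (F.step.symm (F.lab (flow W V f 1 z) j)) - θ (l n j)| ≤ ε / 2 := by
      intro j h1 h2
      have h3 := (hκ n le_rfl j h1 h2).trans (min_le_right _ _)
      rw [htn, F.moving_one, abs_sub_comm] at h3
      -- The approximation controls values, and labels are needed. The map from values at the site
      -- `j` at time one to labels in the coordinate `θ` belongs to the group, so one modulus of
      -- continuity serves for all sites and all `θ`.
      have h4 : θ * (F.pos j * F.step)⁻¹ ∈ F.group :=
        mul_mem hθ (inv_mem (mul_mem (F.pos_mem j) F.step_mem))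
      have h5 := hequi _ h4 _ _ (h3.trans_lt (half_lt_self hδ))
      have e1 : (θ * (F.pos j * F.step)⁻¹) (F.pos j (F.step (l n j))) = θ (l n j) := by
        rw [RelIso.mul_apply]
        exact congrArg θ (RelIso.inv_apply_self (F.pos j * F.step) (l n j))
      have e2 : (θ * (F.pos j * F.step)⁻¹) ((flow W V f 1 z).1 j) =
          θ (F.step.symm (F.lab (flow W V f 1 z) j)) := by
        rw [RelIso.mul_apply, mul_inv_rev]
        rfl
      rw [e1, e2] at h5
      exact h5.le
    have hθ' : θ * F.step⁻¹ ∈ F.group := mul_mem hθ (inv_mem F.step_mem)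
    have := tv_le_of_close (a := fun j => θ (F.step.symm (F.lab (flow W V f 1 z) j)))
      (b := fun j => θ (l n j)) hpq hε.le hclose (D := D)
      (fun j => F.abs_lab_sub_le (flow_widthLE hA hz zero_le_one) hθ' j)
    linarith
  · have h1 := HullSweep.comp_monotone (hl k) hθm
    rcases hσ with rfl | rfl
    · simpa using h1
    · simpa using h1.neg
  · rw [h0]
    exact mul_le_mul_of_sign hσ hθm (hpeak b hb)
  · have hb' := hloc b hb
    exact ⟨mul_le_mul_of_sign hσ hθm (hlow k (hk.trans hrn) _ _ (by omega) (by omega)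
        (hend b hb _ (hk1m k hk) _ (Or.inl rfl))),
      mul_le_mul_of_sign hσ hθm (hlow k (hk.trans hrn) _ _ (by omega) (by omega)
        (hend b hb _ (hk1m k hk) _ (Or.inr rfl)))⟩
  · have hb' := hloc b hb
    refine mul_le_mul_of_sign hσ hθm (hlow r hrn _ _ (by omega) (by omega) ?_)
    rw [htr]
    exact hlev b hb j h1 h2

end Foliation

/-! ### Strict comparison on a window -/

section Window

variable {g ψ f : ℝ → ℝ} {L T : ℝ} {U V : ℝ → ℤ → ℝ} {i k : ℤ}

/-- The maximum principle with weight zero, applied to the difference extended by zero outside the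
window. -/
theorem SolvesOn.le_of_le_window (h : MonoLip g ψ L) (hU : SolvesOn g ψ f T U)
    (hV : SolvesOn g ψ f T V) (h0 : ∀ j, i ≤ j → j ≤ k → U 0 j ≤ V 0 j)
    (hi : ∀ t ∈ Icc 0 T, U t i ≤ V t i) (hk : ∀ t ∈ Icc 0 T, U t k ≤ V t k) :
    ∀ t ∈ Icc 0 T, ∀ j, i ≤ j → j ≤ k → U t j ≤ V t j := by
  classical
  obtain ⟨C, hC⟩ := hU.bdd
  obtain ⟨D, hD⟩ := hV.bdd
  intro t ht
  have hC0 : 0 ≤ C := (abs_nonneg _).trans (hC t ht 0)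
  have hD0 : 0 ≤ D := (abs_nonneg _).trans (hD t ht 0)
  have := lattice_max_principle (J := Ioo i k) (A := fun _ => 0) (B := C + D) (T := T)
    (w := fun t j => if i ≤ j ∧ j ≤ k then U t j - V t j else 0)
    (w' := fun t j => force g ψ (f t) (U t) j - force g ψ (f t) (V t) j) h.nonneg
    (fun _ => le_rfl) (by simp) (fun j hj => ?_) (fun j hj t ht => ?_) (fun j hj t ht hw => ?_)
    (fun j hj => ?_) (fun j hj t ht => ?_) (fun t ht j => ?_) t ht
  · intro j h1 h2
    have := this j
    rw [if_pos ⟨h1, h2⟩, zero_mul] at this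
    linarith
  · have : i ≤ j ∧ j ≤ k := ⟨hj.1.le, hj.2.le⟩
    simp only [this, and_self, if_true]
    exact (hU.continuousOn j).sub (hV.continuousOn j)
  · have : i ≤ j ∧ j ≤ k := ⟨hj.1.le, hj.2.le⟩
    simp only [this, and_self, if_true]
    exact (hU.deriv_right ht j).sub (hV.deriv_right ht j)
  · have e : i ≤ j ∧ j ≤ k := ⟨hj.1.le, hj.2.le⟩
    have e1 : i ≤ j - 1 ∧ j - 1 ≤ k := ⟨by linarith [hj.1, Int.le_sub_one_of_lt hj.1], by linarith [hj.2.le]⟩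
    have e2 : i ≤ j + 1 ∧ j + 1 ≤ k := ⟨by linarith [hj.1.le], Int.add_one_le_of_lt hj.2⟩
    simp only [e, e1, e2, and_self, if_true] at hw ⊢
    exact h.force_sub_le _ _ _ _ hw
  · rw [if_pos ⟨hj.1.le, hj.2.le⟩]
    linarith [h0 j hj.1.le hj.2.le]
  · rw [zero_mul]
    split_ifs with hin
    · rcases eq_or_ne j i with rfl | hji
      · linarith [hi t ht]
      · rcases eq_or_ne j k with rfl | hjk
        · linarith [hk t ht]
        · exact absurd ⟨lt_of_le_of_ne hin.1 hji.symm, lt_of_le_of_ne hin.2 hjk⟩ hj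
    · exact le_rfl
  · split_ifs with hin
    · have h1 := (abs_le.1 (hC t ht j)).2
      have h2 := (abs_le.1 (hD t ht j)).1
      linarith [h0 j hin.1 hin.2]
    · positivity

/-- Strictness spreads from the left end site by site. If the solutions were equal at `j + 1` at
time `t`, the nonnegative difference would reach zero there, so its derivative could not be
positive; but the strict inequality at `j` makes it positive. -/
theorem SolvesOn.lt_of_le_window (hg : StrictMono g) (hU : SolvesOn g ψ f T U)
    (hV : SolvesOn g ψ f T V) (hle : ∀ t ∈ Icc 0 T, ∀ j, i ≤ j → j ≤ k → U t j ≤ V t j)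
    (hi : ∀ t ∈ Icc 0 T, U t i < V t i) {t : ℝ} (ht : t ∈ Ioc 0 T) {j : ℤ} (hij : i ≤ j)
    (hjk : j < k) : U t j < V t j := by
  induction j, hij using Int.leInduction with
  | base => exact hi t ⟨ht.1.le, ht.2⟩
  | succ j hij ih =>
    have ih := ih (by omega)
    have htI : t ∈ Icc 0 T := ⟨ht.1.le, ht.2⟩
    by_contra hc
    have heq : U t (j + 1) = V t (j + 1) :=
      le_antisymm (hle t htI _ (by omega) hjk.le) (not_lt.1 hc)
    have hd := ((hV.hderiv t htI (j + 1)).sub (hU.hderiv t htI (j + 1))).mono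
      (show Ioo 0 t ⊆ Icc 0 T from fun s hs => ⟨hs.1.le, hs.2.le.trans ht.2⟩)
    have hpos : 0 < force g ψ (f t) (V t) (j + 1) - force g ψ (f t) (U t) (j + 1) := by
      unfold force
      rw [heq, add_sub_cancel_right]
      have h1 := hg.monotone (sub_le_sub_right (hle t htI (j + 1 + 1) (by omega) (by omega)) (V t (j + 1)))
      have h2 := hg (sub_lt_sub_left ih (V t (j + 1)))
      linarith
    rw [hasDerivWithinAt_iff_tendsto_slope' (by simp)] at hd
    have hne : (𝓝[Ioo 0 t] t).NeBot := by
      rw [nhdsWithin_Ioo_eq_nhdsLT ht.1]; infer_instance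
    obtain ⟨s, hs, hsm⟩ := ((hd.eventually_const_lt hpos).and self_mem_nhdsWithin).exists
    rw [slope_def_field] at hs
    have h1 := hle s ⟨hsm.1.le, hsm.2.le.trans ht.2⟩ (j + 1) (by omega) hjk.le
    simp only [Pi.sub_apply, heq, sub_self, sub_zero] at hs
    have h2 := div_nonpos_of_nonneg_of_nonpos (sub_nonneg.2 h1) (sub_nonpos.2 hsm.2.le)
    linarith

end Window

/-! ### Sets of times and sites of zero density -/

section Density

open Classical in
/-- The number of sites `n`, `|n| ≤ N`, with `P n`. -/
noncomputable def count (P : ℤ → Prop) (N : ℕ) : ℝ := ((Finset.Icc (-(N : ℤ)) N).filter P).card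

/-- The set of the pairs `(m, n)` with `P m n` has space-time density zero. -/
def ZeroDensity (P : ℕ → ℤ → Prop) : Prop :=
  ∀ ε > 0, ∃ C : ℝ, 0 ≤ C ∧ ∀ N : ℕ,
    ∑ m ∈ Finset.range (N + 1), count (P m) N ≤ ((N : ℝ) + 1) * (ε * (2 * N + 1) + C)

lemma count_nonneg (P : ℤ → Prop) (N : ℕ) : 0 ≤ count P N := Nat.cast_nonneg _

lemma count_mono {P Q : ℤ → Prop} (h : ∀ n, P n → Q n) (N : ℕ) : count P N ≤ count Q N := by
  classical
  unfold count
  gcongr with n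
  exact h n

lemma count_le (P : ℤ → Prop) (N : ℕ) : count P N ≤ 2 * N + 1 := by
  classical
  unfold count
  have h1 := Finset.card_filter_le (Finset.Icc (-(N : ℤ)) N) P
  rw [Int.card_Icc] at h1
  have h2 : ((N : ℤ) + 1 - -(N : ℤ)).toNat = 2 * N + 1 := by omega
  rw [h2] at h1
  exact_mod_cast h1

lemma count_or_le (P Q : ℤ → Prop) (N : ℕ) : count (fun n => P n ∨ Q n) N ≤ count P N + count Q N := by
  classical
  unfold count
  rw [← Nat.cast_add, Nat.cast_le]
  refine (Finset.card_le_card fun n => ?_).trans (Finset.card_union_le _ _)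
  simp only [Finset.mem_union, Finset.mem_filter]
  tauto

variable {P Q : ℕ → ℤ → Prop}

lemma ZeroDensity.mono (hQ : ZeroDensity Q) (h : ∀ m n, P m n → Q m n) : ZeroDensity P :=
  fun ε hε => (hQ ε hε).imp fun _ hC => ⟨hC.1, fun N =>
    (Finset.sum_le_sum fun m _ => count_mono (h m) N).trans (hC.2 N)⟩

lemma zeroDensity_of_forall_not (h : ∀ m n, ¬ P m n) : ZeroDensity P := fun ε hε =>
  ⟨0, le_rfl, fun N => by
    have : ∀ m, count (P m) N = 0 := fun m => by simp [count, h]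
    simp only [this, Finset.sum_const_zero]
    positivity⟩

lemma ZeroDensity.or (hP : ZeroDensity P) (hQ : ZeroDensity Q) :
    ZeroDensity fun m n => P m n ∨ Q m n := by
  intro ε hε
  obtain ⟨C, hC0, hC⟩ := hP (ε / 2) (half_pos hε)
  obtain ⟨D, hD0, hD⟩ := hQ (ε / 2) (half_pos hε)
  refine ⟨C + D, by positivity, fun N => ?_⟩
  calc _ ≤ ∑ m ∈ Finset.range (N + 1), (count (P m) N + count (Q m) N) :=
        Finset.sum_le_sum fun m _ => count_or_le _ _ N
    _ ≤ _ := by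
        rw [Finset.sum_add_distrib]
        linarith [hC N, hD N]

lemma ZeroDensity.biUnion {ι : Type*} (s : Finset ι) {P : ι → ℕ → ℤ → Prop}
    (h : ∀ i ∈ s, ZeroDensity (P i)) : ZeroDensity fun m n => ∃ i ∈ s, P i m n := by
  classical
  induction s using Finset.induction_on with
  | empty => exact zeroDensity_of_forall_not (by simp)
  | insert i s hi ih =>
    refine ((h i (Finset.mem_insert_self _ _)).or
      (ih fun j hj => h j (Finset.mem_insert_of_mem hj))).mono fun m n => ?_
    rintro ⟨j, hj, hP⟩
    rcases Finset.mem_insert.1 hj with rfl | hj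
    · exact Or.inl hP
    · exact Or.inr ⟨j, hj, hP⟩

lemma ZeroDensity.of_succ (hP : ZeroDensity P) (h : ∀ m n, Q (m + 1) n → P m n) : ZeroDensity Q := by
  intro ε hε
  obtain ⟨C, hC0, hC⟩ := hP ε hε
  refine ⟨C + 2, by positivity, fun N => ?_⟩
  rw [Finset.sum_range_succ']
  have h1 : ∑ m ∈ Finset.range N, count (Q (m + 1)) N ≤ ∑ m ∈ Finset.range (N + 1), count (P m) N := by
    rw [Finset.sum_range_succ]
    have := Finset.sum_le_sum fun m (_ : m ∈ Finset.range N) => count_mono (h m) N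
    linarith [count_nonneg (P N) N]
  have h2 := count_le (Q 0) N
  have h3 := hC N
  nlinarith

variable {W V f : ℝ → ℝ}

/-- The translate by `n` of `T_m v` is in `P`, up to an integer. -/
def Visits (W V f : ℝ → ℝ) (v : Config) (P : Set Config) (m : ℕ) (n : ℤ) : Prop :=
  ∃ e : ℤ, addInt e (shift n (flow W V f m v)) ∈ P

/-- The weak `ω`-limit set does not meet the open sets that are visited with density zero. -/
theorem notMem_of_mem_weakOmegaLimit (hA : StandingAssumptions W V f) {v : Config} {O : Set Config}
    (hO : IsOpen O) (hz : ZeroDensity (Visits W V f v O)) {y : Config}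
    (hy : toChain y ∈ weakOmegaLimit W V f (toChain v)) : y ∉ O := by
  classical
  have hO' : IsOpen (toChain '' O) := isOpenMap_toChain _ hO
  -- The complement of the image of `O` is one of the closed sets whose intersection defines the
  -- weak ω-limit set: any open set around it can be missed only during visits to `O`.
  suffices h : toChain y ∈ (toChain '' O)ᶜ from fun hc => h ⟨y, hc, rfl⟩
  refine hy _ ⟨hO'.isClosed_compl, fun U hU hUO => ?_⟩
  have hvis : ∀ (m : ℕ) (n : ℤ), chainFlow W V f m (chainShift n (toChain v)) ∉ U →
      Visits W V f v O m n := by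
    intro m n h
    have h1 : chainFlow W V f m (chainShift n (toChain v)) ∈ toChain '' O := by
      by_contra hc
      exact h (hUO hc)
    rw [chainShift_toChain, chainFlow_toChain hA (Nat.cast_nonneg m),
      flow_shift hA _ _ (Nat.cast_nonneg m), ← mem_preimage, preimage_image_toChain] at h1
    exact h1
  have hbox : ∀ N : ℕ, 1 - (∑ m ∈ Finset.range (N + 1), count (Visits W V f v O m) N) /
      (((N : ℝ) + 1) * (2 * N + 1)) ≤ visitRatio W V f (toChain v) U N := by
    intro N
    have hpos : 0 < ((N : ℝ) + 1) * (2 * N + 1) := by positivity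
    rw [visitRatio, sub_le_iff_le_add, ← add_div, le_div_iff₀ hpos, one_mul]
    have h1 := Finset.card_filter_add_card_filter_not (s := Finset.range (N + 1) ×ˢ Finset.Icc (-(N : ℤ)) N)
      (fun p : ℕ × ℤ => chainFlow W V f (p.1 : ℝ) (chainShift p.2 (toChain v)) ∈ U)
    have h2 : (Finset.range (N + 1) ×ˢ Finset.Icc (-(N : ℤ)) (N : ℤ)).card = (N + 1) * (2 * N + 1) := by
      rw [Finset.card_product, Finset.card_range, Int.card_Icc]
      congr 1
      omega
    have h3 : ((((Finset.range (N + 1) ×ˢ Finset.Icc (-(N : ℤ)) N).filter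
        (fun p : ℕ × ℤ => ¬ chainFlow W V f (p.1 : ℝ) (chainShift p.2 (toChain v)) ∈ U)).card : ℕ) : ℝ) ≤
        ∑ m ∈ Finset.range (N + 1), count (Visits W V f v O m) N := by
      calc _ ≤ ((((Finset.range (N + 1) ×ˢ Finset.Icc (-(N : ℤ)) N).filter
            (fun p : ℕ × ℤ => Visits W V f v O p.1 p.2)).card : ℕ) : ℝ) := by
            gcongr with p
            exact hvis _ _
        _ = _ := by
            simp only [count, Finset.card_filter, Finset.sum_product]
            push_cast
            rfl
    rw [h2] at h1
    have h4 : ((N : ℝ) + 1) * (2 * N + 1) = (((N + 1) * (2 * N + 1) : ℕ) : ℝ) := by push_cast; ring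
    rw [h4, ← h1]
    push_cast
    linarith
  have hle : ∀ N : ℕ, visitRatio W V f (toChain v) U N ≤ 1 := by
    intro N
    have hpos : 0 < ((N : ℝ) + 1) * (2 * N + 1) := by positivity
    rw [visitRatio, div_le_one hpos]
    have h1 := Finset.card_filter_le (Finset.range (N + 1) ×ˢ Finset.Icc (-(N : ℤ)) N)
      (fun p : ℕ × ℤ => chainFlow W V f (p.1 : ℝ) (chainShift p.2 (toChain v)) ∈ U)
    have h2 : (Finset.range (N + 1) ×ˢ Finset.Icc (-(N : ℤ)) (N : ℤ)).card = (N + 1) * (2 * N + 1) := by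
      rw [Finset.card_product, Finset.card_range, Int.card_Icc]
      congr 1
      omega
    rw [h2] at h1
    exact_mod_cast h1
  rw [Metric.tendsto_atTop]
  intro ε hε
  obtain ⟨C, hC0, hC⟩ := hz (ε / 2) (half_pos hε)
  obtain ⟨N₀, hN₀⟩ := exists_nat_gt (2 * C / ε)
  refine ⟨N₀, fun N hN => ?_⟩
  have hpos : 0 < ((N : ℝ) + 1) * (2 * N + 1) := by positivity
  have h1 : (∑ m ∈ Finset.range (N + 1), count (Visits W V f v O m) N) /
      (((N : ℝ) + 1) * (2 * N + 1)) < ε := by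
    rw [div_lt_iff₀ hpos]
    refine (hC N).trans_lt ?_
    have h2 : (N₀ : ℝ) ≤ N := by exact_mod_cast hN
    have h3 : C < ε / 2 * N := by
      rw [div_lt_iff₀ hε] at hN₀
      nlinarith
    have h5 : 0 < (N : ℝ) + 1 := by positivity
    nlinarith
  rw [Real.dist_eq, abs_sub_comm, abs_of_nonneg (sub_nonneg.2 (hle N))]
  linarith [hbox N]

end Density

/-! ### Configurations whose labels are not monotone are visited with density zero -/

/-- By continuity the end sites stay strictly ordered for a short time; comparison on the window, in
its strict form, then carries the strict order to the interior at any positive time. The time `1 /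
m` is chosen to be a grid time later. -/
lemma flow_lt_window {W V f : ℝ → ℝ} (hA : StandingAssumptions W V f) {x y : Config} {a k : ℤ}
    (hle : ∀ j, a ≤ j → j ≤ k → x.1 j ≤ y.1 j) (ha : x.1 a < y.1 a) (hk : x.1 k < y.1 k) :
    ∃ m : ℕ, 0 < m ∧ (∀ t ∈ Icc (0 : ℝ) (1 / m), ∀ j, j = a ∨ j = k →
      (flow W V f t x).1 j < (flow W V f t y).1 j) ∧
      ∀ j, a ≤ j → j ≤ k → (flow W V f (1 / m) x).1 j < (flow W V f (1 / m) y).1 j := by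
  have hx := flow_solvesOn hA x 1
  have hy := flow_solvesOn hA y 1
  have hev : ∀ j, x.1 j < y.1 j → ∀ᶠ t in 𝓝[Icc (0 : ℝ) 1] 0,
      (flow W V f t x).1 j < (flow W V f t y).1 j := by
    intro j hj
    exact ((hx.continuousOn j) 0 (by simp)).eventually_lt ((hy.continuousOn j) 0 (by simp)) (by simpa)
  obtain ⟨r, hr, hball⟩ := Metric.mem_nhdsWithin_iff.1 ((hev a ha).and (hev k hk))
  obtain ⟨m, hm⟩ := exists_nat_one_div_lt hr
  have hcast : (1 : ℝ) / ((m + 1 : ℕ) : ℝ) = 1 / ((m : ℝ) + 1) := by push_cast; rfl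
  have hT1 : (1 : ℝ) / ((m : ℝ) + 1) ≤ 1 := by
    rw [div_le_one (by positivity)]; linarith [(Nat.cast_nonneg m : (0 : ℝ) ≤ m)]
  have hT0 : 0 < (1 : ℝ) / ((m : ℝ) + 1) := by positivity
  have hends : ∀ t ∈ Icc (0 : ℝ) (1 / ((m : ℝ) + 1)), ∀ j, j = a ∨ j = k →
      (flow W V f t x).1 j < (flow W V f t y).1 j := by
    intro t ht j hj
    have := hball ⟨by
      rw [Metric.mem_ball, Real.dist_eq, sub_zero, abs_of_nonneg ht.1]
      linarith [ht.2], ht.1, ht.2.trans hT1⟩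
    rcases hj with rfl | rfl
    exacts [this.1, this.2]
  obtain ⟨ρ₁, K₁, hx0⟩ := x.exists_widthLE
  obtain ⟨ρ₂, K₂, hy0⟩ := y.exists_widthLE
  obtain ⟨G, L, hL, hxG, hyG⟩ := SolvesOn.exists_common_trunc hA.admissible (hx.mono hT1) (hy.mono hT1)
    (by simpa using hx0) (by simpa using hy0)
  have hweak := SolvesOn.le_of_le_window hL hxG hyG (i := a) (k := k) (by simpa using hle)
    (fun t ht => (hends t ht a (Or.inl rfl)).le) (fun t ht => (hends t ht k (Or.inr rfl)).le)
  refine ⟨m + 1, by omega, by rw [hcast]; exact hends, fun j h1 h2 => ?_⟩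
  rw [hcast]
  rcases eq_or_lt_of_le h2 with rfl | h2
  · exact hends _ ⟨hT0.le, le_rfl⟩ j (Or.inr rfl)
  · exact SolvesOn.lt_of_le_window hA.admissible.strictMono (hx.mono hT1) (hy.mono hT1) hweak
      (fun t ht => hends t ht a (Or.inl rfl)) ⟨hT0, le_rfl⟩ h1 h2

namespace Foliation

variable {W V f : ℝ → ℝ} {ρ : ℝ} (F : Foliation W V f ρ)

lemma moving_shift (hA : StandingAssumptions W V f) {t : ℝ} (ht : 0 ≤ t) (s : ℝ) (b j : ℤ) :
    F.moving t s (j - b) = F.moving t (F.pos (-b) s) j := by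
  rw [moving, moving, ← F.shift_leaf, flow_shift hA _ _ ht, shift_apply]

/-- Equicontinuity of the inverses: points that are far apart are not brought arbitrarily close by
any element of the group. -/
lemma exists_group_gap {r : ℝ} (hr : 0 < r) : ∃ c > 0, ∀ θ ∈ F.group, ∀ x y, r ≤ |x - y| →
    c ≤ |θ x - θ y| := by
  obtain ⟨δ, hδ, h⟩ := F.equicontinuous r hr
  refine ⟨δ, hδ, fun θ hθ x y hxy => ?_⟩
  by_contra hc
  have := h _ (inv_mem hθ) _ _ (not_le.1 hc)
  rw [RelIso.inv_apply_self, RelIso.inv_apply_self] at this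
  exact absurd hxy (not_le.2 this)

/-- Near a configuration with an extremum of the labels, the extremum is levelled. -/
lemma exists_levelling (hA : StandingAssumptions W V f) {ρ' K : ℝ} {y : Config} (hy : WidthLE ρ' K y.1)
    (hmono : ¬ Monotone (F.lab y)) (hanti : ¬ Antitone (F.lab y)) :
    ∃ (σ : ℝ) (a b k : ℤ) (m : ℕ) (η c c' : ℝ) (O : Set Config), (σ = 1 ∨ σ = -1) ∧ a ≤ b ∧ b ≤ k ∧
      0 < m ∧ 0 < η ∧ σ * c' < σ * c ∧ IsOpen O ∧ y ∈ O ∧ ∀ z ∈ O, WidthLE ρ' K z.1 →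
        σ * c ≤ σ * F.lab z b ∧
        (∀ t ∈ Icc (0 : ℝ) (1 / m), ∀ j, j = a ∨ j = k →
          η ≤ σ * (F.moving t c' j - (flow W V f t z).1 j)) ∧
        ∀ j, a ≤ j → j ≤ k → η ≤ σ * (F.moving (1 / m) c' j - (flow W V f (1 / m) z).1 j) := by
  obtain ⟨σ, hσ, a, k, b₀, hab₀, hbk₀, ha₀, hk₀⟩ : ∃ σ : ℝ, (σ = 1 ∨ σ = -1) ∧ ∃ a k b₀ : ℤ,
      a < b₀ ∧ b₀ < k ∧ σ * F.lab y a < σ * F.lab y b₀ ∧ σ * F.lab y k < σ * F.lab y b₀ := by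
    obtain ⟨a, b, k, hab, hbk, h | h⟩ := not_monotone_not_antitone_iff_exists_lt_lt.1 ⟨hmono, hanti⟩
    · exact ⟨1, Or.inl rfl, a, k, b, hab, hbk, by linarith [h.1], by linarith [h.2]⟩
    · exact ⟨-1, Or.inr rfl, a, k, b, hab, hbk, by linarith [h.1], by linarith [h.2]⟩
  -- The leaf through the site of extremal label on `[a, k]` lies weakly beyond `y` on the whole
  -- block and strictly beyond it at the ends, which is the setting of `flow_lt_window`.
  obtain ⟨b, hb, hmax⟩ := (Finset.Icc a k).exists_max_image (fun j => σ * F.lab y j)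
    ⟨a, Finset.mem_Icc.2 ⟨le_rfl, by omega⟩⟩
  rw [Finset.mem_Icc] at hb
  have hb₀ := hmax b₀ (Finset.mem_Icc.2 ⟨hab₀.le, hbk₀.le⟩)
  set s := F.lab y b with hs
  have hpos : ∀ j, σ * F.lab y j ≤ σ * s → σ * y.1 j ≤ σ * (F.leaf s).1 j := fun j h => by
    have := mul_le_mul_of_sign hσ (F.pos j).monotone h
    rwa [F.pos_lab, ← F.leaf_apply] at this
  have hneg : ∀ j, σ * F.lab y j < σ * s → σ * y.1 j < σ * (F.leaf s).1 j := fun j h => by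
    refine lt_of_le_of_ne (hpos j h.le) fun he => ?_
    have h1 : y.1 j = (F.leaf s).1 j := by rcases hσ with rfl | rfl <;> linarith
    rw [lab, h1, F.leaf_apply, OrderIso.symm_apply_apply] at h
    exact lt_irrefl _ h
  have hposI : ∀ j, a ≤ j → j ≤ k → σ * y.1 j ≤ σ * (F.leaf s).1 j := fun j h1 h2 =>
    hpos j (hmax j (Finset.mem_Icc.2 ⟨h1, h2⟩))
  have hna := hneg a (ha₀.trans_le hb₀)
  have hnk := hneg k (hk₀.trans_le hb₀)
  obtain ⟨m, hm, hends, hlev⟩ : ∃ m : ℕ, 0 < m ∧ (∀ t ∈ Icc (0 : ℝ) (1 / m), ∀ j, j = a ∨ j = k →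
      0 < σ * (F.moving t s j - (flow W V f t y).1 j)) ∧
      ∀ j, a ≤ j → j ≤ k → 0 < σ * (F.moving (1 / m) s j - (flow W V f (1 / m) y).1 j) := by
    rcases hσ with rfl | rfl
    · obtain ⟨m, hm, h1, h2⟩ := flow_lt_window hA (x := y) (y := F.leaf s) (a := a) (k := k)
        (by simpa using hposI) (by simpa using hna) (by simpa using hnk)
      exact ⟨m, hm, fun t ht j hj => by simpa [moving] using h1 t ht j hj,
        fun j hj hj' => by simpa [moving] using h2 j hj hj'⟩
    · obtain ⟨m, hm, h1, h2⟩ := flow_lt_window hA (x := F.leaf s) (y := y) (a := a) (k := k)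
        (by simpa using hposI) (by simpa using hna) (by simpa using hnk)
      exact ⟨m, hm, fun t ht j hj => by simpa [moving] using h1 t ht j hj,
        fun j hj hj' => by simpa [moving] using h2 j hj hj'⟩
  have hm0 : (0 : ℝ) < 1 / m := by positivity
  have hm1 : (1 : ℝ) / m ≤ 1 := by
    rw [div_le_one (by positivity)]; exact_mod_cast hm
  have hcont : ∀ j, ContinuousOn (fun t => σ * (F.moving t s j - (flow W V f t y).1 j))
      (Icc (0 : ℝ) (1 / m)) := fun j =>
    continuousOn_const.mul (((flow_solvesOn hA (F.leaf s) (1 / m)).continuousOn j).sub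
      ((flow_solvesOn hA y (1 / m)).continuousOn j))
  obtain ⟨t₁, ht₁, hmin₁⟩ := isCompact_Icc.exists_isMinOn ⟨0, left_mem_Icc.2 hm0.le⟩ (hcont a)
  obtain ⟨t₂, ht₂, hmin₂⟩ := isCompact_Icc.exists_isMinOn ⟨0, left_mem_Icc.2 hm0.le⟩ (hcont k)
  obtain ⟨j₃, hj₃, hmin₃⟩ := (Finset.Icc a k).exists_min_image
    (fun j => σ * (F.moving (1 / m) s j - (flow W V f (1 / m) y).1 j)) ⟨b, Finset.mem_Icc.2 hb⟩
  rw [Finset.mem_Icc] at hj₃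
  have p1 := hends t₁ ht₁ a (Or.inl rfl)
  have p2 := hends t₂ ht₂ k (Or.inr rfl)
  have p3 := hlev j₃ hj₃.1 hj₃.2
  obtain ⟨η, hη, l1, l2, l3⟩ : ∃ η > 0, η ≤ σ * (F.moving t₁ s a - (flow W V f t₁ y).1 a) ∧
      η ≤ σ * (F.moving t₂ s k - (flow W V f t₂ y).1 k) ∧
      η ≤ σ * (F.moving (1 / m) s j₃ - (flow W V f (1 / m) y).1 j₃) :=
    ⟨_, lt_min p1 (lt_min p2 p3), min_le_left _ _, (min_le_right _ _).trans (min_le_left _ _),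
      (min_le_right _ _).trans (min_le_right _ _)⟩
  set R := a.natAbs + k.natAbs with hR
  obtain ⟨δ, hδ, hmov⟩ := F.exists_moving_close hA 1 R (show 0 < η / 4 by positivity)
  obtain ⟨R', ε, hε, hflow⟩ := exists_flow_close_of_close hA ρ' K 1 R (show 0 < η / 4 by positivity)
  have hσ2 : σ * σ = 1 := by rcases hσ with rfl | rfl <;> norm_num
  have hσa : |σ| = 1 := by rcases hσ with rfl | rfl <;> norm_num
  -- Both levels lie slightly inside the extremal label `s`. The level `c`, off by `δ/4`, is still
  -- exceeded by the peak of any nearby `z`; the leaf `c'`, off by `δ/2`, still lies beyond the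
  -- levelled block. The drop between them is `δ/4`.
  refine ⟨σ, a, b, k, m, η / 2, s - σ * (δ / 4), s - σ * (δ / 2),
    {z | |F.lab z b - s| < δ / 4} ∩ window y R' ε, hσ, hb.1, hb.2, hm, half_pos hη, ?_,
    (isOpen_lt ((F.continuous_lab b).sub continuous_const).abs continuous_const).inter
      (isOpen_window _ _ _), ⟨by simp [← hs]; positivity, mem_window_self _ _ hε⟩, fun z hz hw => ?_⟩
  · nlinarith
  have herr : ∀ t ∈ Icc (0 : ℝ) 1, ∀ j, a ≤ j → j ≤ k →
      σ * (F.moving t s j - (flow W V f t y).1 j) - η / 2 ≤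
        σ * (F.moving t (s - σ * (δ / 2)) j - (flow W V f t z).1 j) := by
    intro t ht j h1 h2
    have hjR : |j| ≤ (R : ℕ) := by rw [abs_le]; omega
    have e1 := hmov s (s - σ * (δ / 2)) (by
      rw [sub_sub_cancel, abs_mul, hσa, one_mul, abs_of_pos (by positivity)]; linarith) t ht j hjR
    have e2 := hflow z y hw hy (fun j hj => (hz.2 j hj).le) t ht j hjR
    rw [abs_le] at e1 e2
    rcases hσ with rfl | rfl <;> linarith [e1.1, e1.2, e2.1, e2.2]
  refine ⟨?_, fun t ht j hj => ?_, fun j h1 h2 => ?_⟩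
  · have h1 := abs_lt.1 (show |F.lab z b - s| < δ / 4 from hz.1)
    rcases hσ with rfl | rfl <;> linarith [h1.1, h1.2]
  · have hak : a ≤ j ∧ j ≤ k := by omega
    refine le_trans ?_ (herr t ⟨ht.1, ht.2.trans hm1⟩ j hak.1 hak.2)
    rcases hj with rfl | rfl
    · linarith [isMinOn_iff.1 hmin₁ t ht]
    · linarith [isMinOn_iff.1 hmin₂ t ht]
  · refine le_trans ?_ (herr _ ⟨hm0.le, hm1⟩ j h1 h2)
    linarith [hmin₃ j (Finset.mem_Icc.2 ⟨h1, h2⟩)]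

/-- A configuration of which the labels are neither monotone nor antitone has a neighbourhood that
is visited with density zero. -/
theorem exists_open_zeroDensity (hA : StandingAssumptions W V f) {ρ' K : ℝ} {y : Config}
    (hy : WidthLE ρ' K y.1) (hmono : ¬ Monotone (F.lab y)) (hanti : ¬ Antitone (F.lab y)) :
    ∃ O : Set Config, IsOpen O ∧ y ∈ O ∧ ∀ v : Config,
      (∀ m : ℕ, WidthLE ρ' K (flow W V f m v).1) → ZeroDensity (Visits W V f v O) := by
  classical
  obtain ⟨σ, a, b, k, m, η, c, c', O, hσ, hab, hbk, hm, hη, hcc, hO, hyO, hlev⟩ :=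
    F.exists_levelling hA hy hmono hanti
  refine ⟨O, hO, hyO, fun v hv ε hε => ?_⟩
  have hm0 : (0 : ℝ) < 1 / m := by positivity
  obtain ⟨γ, hγ, hgap⟩ := F.exists_group_gap (r := σ * c - σ * c') (by linarith)
  have hσa : ∀ x : ℝ, |σ * x| = |x| := fun x => by rcases hσ with rfl | rfl <;> simp
  have hgap' : ∀ θ ∈ F.group, ∀ x x', σ * x - σ * x' = σ * c - σ * c' →
      γ ≤ σ * θ x - σ * θ x' := by
    intro θ hθ x x' hx
    have h1 : |x - x'| = σ * c - σ * c' := by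
      rw [← hσa, mul_sub, hx, abs_of_pos (by linarith)]
    have h2 := hgap θ hθ x x' h1.ge
    have h3 := mul_le_mul_of_sign hσ θ.monotone (show σ * x' ≤ σ * x by linarith)
    rwa [← hσa, mul_sub, abs_of_nonneg (by linarith)] at h2
  set ℓ := (k - a + 1).toNat with hℓ
  have hℓ1 : (ℓ : ℤ) = k - a + 1 := Int.toNat_of_nonneg (by omega)
  have hℓ0 : (0 : ℝ) < ℓ := by
    have : 0 < ℓ := by omega
    exact_mod_cast this
  -- The error per site and period, divided by the loss `2γ/ℓ` per visit, is exactly `ε`.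
  set ε₁ := 2 * γ * ε / ℓ with hε₁
  have hε₁0 : 0 < ε₁ := by positivity
  obtain ⟨R, C, hC0, htv⟩ := F.exists_tv_step hA ρ' K hm hη hε₁0
  set D := |ρ| + F.width + (|ρ'| + K) + 1 with hD
  have hD0 : 0 ≤ D := by
    have := (F.widthLE 0).nonneg
    have := hy.nonneg
    positivity
  set R' := R + a.natAbs + k.natAbs with hR'
  -- Labels at time `n` are pulled back to time zero by `F.step⁻¹ ^ n`, so that the estimates of
  -- successive periods can be summed.
  set Θ : ℕ → ℝ ≃o ℝ := fun n => F.step⁻¹ ^ n with hΘ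
  have hΘm : ∀ n, Θ n ∈ F.group := fun n => pow_mem (inv_mem F.step_mem) n
  -- the decay of the total variation in one period
  have hstep : ∀ (N n : ℕ), tv (-(N + R' : ℤ)) (N + R') (fun j => Θ (n + 1) (F.lab (flow W V f (n + 1 : ℕ) v) j)) +
      2 * γ / ℓ * count (Visits W V f v O n) N ≤
        tv (-(N + R' : ℤ)) (N + R') (fun j => Θ n (F.lab (flow W V f n v) j)) +
          ε₁ * (2 * (N + R')) + C := by
    intro N n
    set z := flow W V f n v with hz
    set Q := (Finset.Icc (-(N : ℤ)) N).filter (Visits W V f v O n) with hQ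
    -- The blocks of different visits may overlap. By the pigeonhole principle some residue class
    -- modulo the block length `ℓ` contains at least a fraction `1/ℓ` of the visits, and the blocks
    -- of one class are disjoint.
    obtain ⟨r, -, hr⟩ := Finset.exists_le_card_fiber_of_nsmul_le_card_of_maps_to
      (s := Q) (t := Finset.range ℓ) (f := fun n : ℤ => (n % ℓ).toNat) (b := (Q.card : ℝ) / ℓ)
      (fun n _ => Finset.mem_range.2 (by
        have h1 := Int.emod_nonneg n (by omega : (ℓ : ℤ) ≠ 0)
        have h2 := Int.emod_lt_of_pos n (by omega : (0 : ℤ) < ℓ)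
        omega)) ⟨0, Finset.mem_range.2 (by omega)⟩ (by
        rw [Finset.card_range, nsmul_eq_mul, mul_div_cancel₀ _ hℓ0.ne'])
    set B := Q.filter fun n : ℤ => (n % ℓ).toNat = r with hB
    have hBvis : ∀ n' ∈ B, ∃ e : ℤ, addInt e (shift n' z) ∈ O := fun n' hn' =>
      (Finset.mem_filter.1 (Finset.mem_filter.1 hn').1).2
    have hBI : ∀ n' ∈ B, -(N : ℤ) ≤ n' ∧ n' ≤ N := fun n' hn' =>
      Finset.mem_Icc.1 (Finset.mem_filter.1 (Finset.mem_filter.1 hn').1).1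
    choose! e he using hBvis
    have hw : ∀ n' ∈ B, WidthLE ρ' K (addInt (e n') (shift n' z)).1 := fun n' _ =>
      WidthLE.add_const (WidthLE.shift (hv n) n') _
    have hflow : ∀ (n' : ℤ) (t : ℝ), 0 ≤ t → ∀ j, F.moving t ((F.pos (-n')).symm (c' - e n')) (j - n') -
        (flow W V f t z).1 (j - n') =
        F.moving t c' j - (flow W V f t (addInt (e n') (shift n' z))).1 j := by
      intro n' t ht j
      rw [F.moving_shift hA ht, OrderIso.apply_symm_apply, flow_addInt hA _ _ ht, flow_shift hA _ _ ht,
        addInt_apply, shift_apply]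
      have h1 : F.moving t c' j = F.moving t (c' - e n') j + e n' := by
        have := map_add_int_of_map_add_one (h := fun s => F.moving t s j)
          (fun s => (F.isFoliated_moving hA ht).add_one s j) (c' - e n') (e n')
        rwa [sub_add_cancel] at this
      rw [h1]; ring
    have := htv z (hv n) (-(N + R' : ℤ)) (N + R') (by omega) (Θ n) (hΘm n) σ hσ B
      (fun n' => a - n') (fun n' => k - n') (fun n' => b - n')
      (fun n' => (F.pos (-n')).symm (c - e n')) (fun n' => (F.pos (-n')).symm (c' - e n'))
      ?_ (fun n' hn' => ?_) (fun n' hn' => ?_) (fun n' hn' t ht j hj => ?_) (fun n' hn' j h1 h2 => ?_)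
    · have hsum : B.card • (2 * γ) ≤ ∑ n' ∈ B, 2 * (σ * Θ n ((F.pos (-n')).symm (c - e n')) -
          σ * Θ n ((F.pos (-n')).symm (c' - e n'))) := by
        refine Finset.card_nsmul_le_sum _ _ _ fun n' hn' => ?_
        have h1 : Θ n * (F.pos (-n'))⁻¹ ∈ F.group := mul_mem (hΘm n) (inv_mem (F.pos_mem _))
        exact mul_le_mul_of_nonneg_left (hgap' _ h1 (c - e n') (c' - e n') (by ring)) zero_le_two
      rw [nsmul_eq_mul] at hsum
      have h1 : 2 * γ / ℓ * count (Visits W V f v O n) N ≤ B.card * (2 * γ) := by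
        have : count (Visits W V f v O n) N = (Q.card : ℝ) := by
          rw [hQ, count]
        rw [this]
        calc 2 * γ / ℓ * (Q.card : ℝ) = (Q.card : ℝ) / ℓ * (2 * γ) := by ring
          _ ≤ _ := by gcongr
      have h2 : (fun j => Θ n (F.step.symm (F.lab (flow W V f 1 z) j))) =
          fun j => Θ (n + 1) (F.lab (flow W V f (n + 1 : ℕ) v) j) := by
        funext j
        rw [flow_nat_succ hA, hΘ]
        beta_reduce
        rw [pow_succ]
        rfl
      rw [h2] at this
      push_cast at this ⊢
      linarith
    · intro n₁ hn₁ n₂ hn₂ j h1 h2 h3 h4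
      have e1 := (Finset.mem_filter.1 hn₁).2
      have e2 := (Finset.mem_filter.1 hn₂).2
      have g1 := Int.emod_nonneg n₁ (by omega : (ℓ : ℤ) ≠ 0)
      have g2 := Int.emod_nonneg n₂ (by omega : (ℓ : ℤ) ≠ 0)
      have e3 : n₁ % ℓ = n₂ % ℓ := by omega
      have e4 : (ℓ : ℤ) ∣ n₁ - n₂ := Int.ModEq.dvd (Int.ModEq.symm e3)
      beta_reduce at h1 h2 h3 h4
      have e5 := Int.eq_zero_of_abs_lt_dvd e4 (by rw [abs_lt]; omega)
      omega
    · have := hBI n' hn'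
      omega
    · have h1 := (hlev _ (he n' hn') (hw n' hn')).1
      rw [F.lab_addInt, F.lab_shift] at h1
      have h2 := mul_le_mul_of_sign hσ (F.pos (-n')).symm.monotone
        (show σ * (c - e n') ≤ σ * F.pos (-n') (F.lab z (b - n')) by
          rcases hσ with rfl | rfl <;> linarith)
      rwa [OrderIso.symm_apply_apply] at h2
    · have h1 := (hlev _ (he n' hn') (hw n' hn')).2.1 t ht (j + n') (by omega)
      have h2 := hflow n' t ht.1 (j + n')
      rw [add_sub_cancel_right] at h2
      rwa [h2]
    · have h3 := (hlev _ (he n' hn') (hw n' hn')).2.2 (j + n') (by omega) (by omega)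
      have h4 := hflow n' (1 / m) hm0.le (j + n')
      rw [add_sub_cancel_right] at h4
      rwa [h4]
  refine ⟨ℓ / (2 * γ) * (ε₁ * (2 * R') + C + D * (2 + 2 * R')), by positivity, fun N => ?_⟩
  -- Summed over the periods, visits are paid for by the initial variation, of order `N`, and by the
  -- errors. With `N + 1` periods the initial variation contributes only a constant per period,
  -- absorbed by the constant in `ZeroDensity`.
  have hsum : ∀ M : ℕ, 2 * γ / ℓ * ∑ n ∈ Finset.range M, count (Visits W V f v O n) N ≤
      tv (-(N + R' : ℤ)) (N + R') (fun j => Θ 0 (F.lab (flow W V f (0 : ℕ) v) j)) -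
      tv (-(N + R' : ℤ)) (N + R') (fun j => Θ M (F.lab (flow W V f M v) j)) +
        M * (ε₁ * (2 * (N + R')) + C) := by
    intro M
    induction M with
    | zero => simp
    | succ M ih =>
      rw [Finset.sum_range_succ, mul_add]
      have := hstep N M
      push_cast at this ⊢
      linarith
  have h1 := hsum (N + 1)
  have h2 := tv_nonneg (-(N + R' : ℤ)) (N + R')
    (fun j => Θ (N + 1) (F.lab (flow W V f (N + 1 : ℕ) v) j))
  have h3 : tv (-(N + R' : ℤ)) (N + R') (fun j => Θ 0 (F.lab (flow W V f (0 : ℕ) v) j)) ≤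
      2 * (N + R') * D := by
    unfold tv
    refine (Finset.sum_le_card_nsmul _ _ D fun j _ =>
      F.abs_lab_sub_le (hv 0) (hΘm 0) j).trans ?_
    rw [Int.card_Ico, nsmul_eq_mul]
    have : ((N + R' : ℤ) - -(N + R' : ℤ)).toNat = 2 * (N + R') := by omega
    rw [this]; push_cast; exact le_rfl
  have hN : (0 : ℝ) ≤ N := Nat.cast_nonneg N
  have hR0 : (0 : ℝ) ≤ R' := Nat.cast_nonneg R'
  have h4 : 2 * (N + R') * D ≤ ((N : ℝ) + 1) * (D * (2 + 2 * R')) := by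
    nlinarith [mul_nonneg hD0 hN, mul_nonneg (mul_nonneg hD0 hN) hR0]
  set S := ∑ n ∈ Finset.range (N + 1), count (Visits W V f v O n) N with hS
  have h5 : 2 * γ / ℓ * S ≤ ((N : ℝ) + 1) * (ε₁ * (2 * (N + R')) + C + D * (2 + 2 * R')) := by
    push_cast at h1 h2 h3
    linarith
  have h6 : S = ℓ / (2 * γ) * (2 * γ / ℓ * S) := by field_simp
  rw [h6]
  refine (mul_le_mul_of_nonneg_left h5 (by positivity)).trans ?_
  have h7 : ℓ / (2 * γ) * ε₁ = ε := by rw [hε₁]; field_simp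
  have h8 : ℓ / (2 * γ) * (((N : ℝ) + 1) * (ε₁ * (2 * (N + R')) + C + D * (2 + 2 * R'))) =
      ((N : ℝ) + 1) * ((ℓ / (2 * γ) * ε₁) * (2 * N) +
        ℓ / (2 * γ) * (ε₁ * (2 * R') + C + D * (2 + 2 * R'))) := by ring
  rw [h8, h7]
  gcongr
  linarith

end Foliation

/-! ### Compactness -/

lemma isClosed_widthLE (ρ K : ℝ) : IsClosed {z : Config | WidthLE ρ K z.1} := by
  have : {z : Config | WidthLE ρ K z.1} =
      ⋂ (m : ℤ) (n : ℤ), {z | |z.1 m - z.1 n - ((m : ℝ) - n) * ρ| ≤ K} := by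
    ext z; simp [WidthLE]
  rw [this]
  exact isClosed_iInter fun m => isClosed_iInter fun n => isClosed_le
    (((continuous_apply_config m).sub (continuous_apply_config n)).sub continuous_const).abs
    continuous_const

lemma isCompact_widthLE (ρ K M : ℝ) : IsCompact {z : Config | WidthLE ρ K z.1 ∧ |z.1 0| ≤ M} := by
  have hind : IsInducing (Subtype.val : Config → ℤ → ℝ) := IsInducing.subtypeVal
  rw [hind.isCompact_iff]
  have himage : Subtype.val '' {z : Config | WidthLE ρ K z.1 ∧ |z.1 0| ≤ M} =
      {u : ℤ → ℝ | WidthLE ρ K u ∧ |u 0| ≤ M} := by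
    ext u
    constructor
    · rintro ⟨z, hz, rfl⟩; exact hz
    · intro hu; exact ⟨⟨u, ρ, K, hu.1⟩, hu, rfl⟩
  rw [himage]
  refine (isCompact_univ_pi fun j : ℤ =>
    isCompact_Icc (a := -(M + K + |(j : ℝ) * ρ|)) (b := M + K + |(j : ℝ) * ρ|)).of_isClosed_subset ?_ ?_
  · have : {u : ℤ → ℝ | WidthLE ρ K u ∧ |u 0| ≤ M} =
        (⋂ (m : ℤ) (n : ℤ), {u : ℤ → ℝ | |u m - u n - ((m : ℝ) - n) * ρ| ≤ K}) ∩ {u | |u 0| ≤ M} := by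
      ext u; simp [WidthLE]
    rw [this]
    refine (isClosed_iInter fun m => isClosed_iInter fun n => isClosed_le ?_ continuous_const).inter
      (isClosed_le (continuous_apply 0).abs continuous_const)
    exact (((continuous_apply m).sub (continuous_apply n)).sub continuous_const).abs
  · intro u hu j _
    have h1 := abs_le.1 (hu.1 j 0)
    have h2 := abs_le.1 hu.2
    have h3 := neg_abs_le ((j : ℝ) * ρ)
    have h4 := le_abs_self ((j : ℝ) * ρ)
    push_cast at h1
    rw [sub_zero] at h1
    constructor <;> linarith [h1.1, h1.2, h2.1, h2.2]

variable {W V f : ℝ → ℝ}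

lemma exists_flow_displacement (hA : StandingAssumptions W V f) (ρ K : ℝ) : ∃ B, ∀ z : Config,
    WidthLE ρ K z.1 → ∀ t ∈ Icc (0 : ℝ) 1, ∀ j, |(flow W V f t z).1 j - z.1 j| ≤ B := by
  rcases lt_or_ge K 0 with hK | hK
  · exact ⟨0, fun z hz => absurd hz.nonneg (not_le.2 hK)⟩
  have hG : 0 ≤ |ρ| + K + 1 := by positivity
  obtain ⟨M₁, h0, hM₁⟩ := hA.admissible.exists_trunc_bound hG
  obtain ⟨M₂, -, hM₂⟩ := hA.admissible.exists_site_bound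
  obtain ⟨N, hN⟩ := (isCompact_Icc (a := (0 : ℝ)) (b := 1)).exists_bound_of_continuousOn
    (f := f) hA.admissible.cont.continuousOn
  have hN0 : 0 ≤ N := (norm_nonneg _).trans (hN 0 (by simp))
  refine ⟨3 * max M₁ M₂ + N, fun z hz t ht j => ?_⟩
  have h := (flow_solvesOn_trunc hA hz le_rfl 1).abs_sub_le (B := 3 * max M₁ M₂ + N) (fun s hs i =>
    (abs_force_le (fun p => (hM₁ p).trans (le_max_left _ _)) (fun p => (hM₂ p).trans (le_max_right _ _))
      _ _).trans (by
        have : |f s| ≤ N := hN s hs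
        linarith)) le_rfl ht.1 ht.2 j
  rw [flow_zero, sub_zero] at h
  refine h.trans (mul_le_of_le_one_right ?_ ht.2)
  have : 0 ≤ max M₁ M₂ := h0.trans (le_max_left _ _)
  positivity

lemma continuousOn_flow (hA : StandingAssumptions W V f) (ρ K : ℝ) {t : ℝ} (ht : 0 ≤ t) (j : ℤ) :
    ContinuousOn (fun z => (flow W V f t z).1 j) {z : Config | WidthLE ρ K z.1} := by
  intro z hz
  rw [ContinuousWithinAt, Metric.tendsto_nhds]
  intro ε hε
  obtain ⟨R', δ, hδ, h⟩ := exists_flow_close_of_close hA ρ K t j.natAbs (half_pos hε)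
  filter_upwards [self_mem_nhdsWithin, mem_nhdsWithin_of_mem_nhds (window_mem_nhds z R' hδ)]
    with u hu huw
  exact (h u z hu hz (fun i hi => (huw i hi).le) t ⟨ht, le_rfl⟩ j
    (by rw [Int.natCast_natAbs])).trans_lt (half_lt_self hε)

lemma widthLE_addInt_shift {ρ K : ℝ} {z : Config} (hz : WidthLE ρ K z.1) (e n : ℤ) :
    WidthLE ρ K (addInt e (shift n z)).1 := WidthLE.add_const (WidthLE.shift hz n) _

namespace Foliation

variable {ρ : ℝ} (F : Foliation W V f ρ)

/-- The configurations with monotone or antitone labels. -/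
def Monotonic : Set Config := {z | Monotone (F.lab z) ∨ Antitone (F.lab z)}

lemma isClosed_monotonic : IsClosed F.Monotonic := by
  have h1 : IsClosed {z | Monotone (F.lab z)} := by
    have : {z | Monotone (F.lab z)} = ⋂ (i : ℤ) (j : ℤ) (_ : i ≤ j), {z | F.lab z i ≤ F.lab z j} := by
      ext z; simp [Monotone]
    rw [this]
    exact isClosed_iInter fun i => isClosed_iInter fun j => isClosed_iInter fun _ =>
      isClosed_le (F.continuous_lab i) (F.continuous_lab j)
  have h2 : IsClosed {z | Antitone (F.lab z)} := by
    have : {z | Antitone (F.lab z)} = ⋂ (i : ℤ) (j : ℤ) (_ : i ≤ j), {z | F.lab z j ≤ F.lab z i} := by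
      ext z; simp [Antitone]
    rw [this]
    exact isClosed_iInter fun i => isClosed_iInter fun j => isClosed_iInter fun _ =>
      isClosed_le (F.continuous_lab j) (F.continuous_lab i)
  exact h1.union h2

theorem zeroDensity_of_isCompact (hA : StandingAssumptions W V f) {ρ' K : ℝ} {S : Set Config}
    (hS : IsCompact S) (hw : ∀ z ∈ S, WidthLE ρ' K z.1) (hmono : Disjoint S F.Monotonic) {v : Config}
    (hv : ∀ m : ℕ, WidthLE ρ' K (flow W V f m v).1) : ZeroDensity (Visits W V f v S) := by
  have hex : ∀ z : Config, ∃ O : Set Config, IsOpen O ∧ (z ∈ S → z ∈ O) ∧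
      ZeroDensity (Visits W V f v O) := fun z => by
    by_cases hz : z ∈ S
    · have hnot := disjoint_left.1 hmono hz
      obtain ⟨O, hO, hzO, h⟩ := F.exists_open_zeroDensity hA (hw z hz) (fun h => hnot (Or.inl h))
        (fun h => hnot (Or.inr h))
      exact ⟨O, hO, fun _ => hzO, h v hv⟩
    · exact ⟨∅, isOpen_empty, fun h => absurd h hz, zeroDensity_of_forall_not fun m n ⟨e, he⟩ => he⟩
  choose O hO hmem hzd using hex
  obtain ⟨t, -, ht⟩ := hS.elim_nhds_subcover O fun z hz => (hO z).mem_nhds (hmem z hz)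
  refine (ZeroDensity.biUnion t fun z _ => hzd z).mono fun m n ⟨e, he⟩ => ?_
  obtain ⟨z, hz, hzO⟩ := mem_iUnion₂.1 (ht he)
  exact ⟨z, hz, e, hzO⟩

/-- The elements of the weak `ω`-limit sets have a preimage with monotone labels. -/
theorem exists_monotonic_preimage (hA : StandingAssumptions W V f) {ρ' K : ℝ} {v : Config}
    (hv : ∀ m : ℕ, WidthLE ρ' K (flow W V f m v).1) {y : Config}
    (hy : toChain y ∈ weakOmegaLimit W V f (toChain v)) :
    ∃ z ∈ F.Monotonic, flow W V f 1 z = y := by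
  obtain ⟨B, hB⟩ := exists_flow_displacement hA ρ' K
  -- The candidates for a preimage of `y` up to accuracy `1/(k+1)`: a decreasing sequence of compact
  -- sets. If one of them missed `Monotonic`, it would be visited with density zero; hence so would,
  -- one period later, the window of `y`, which is impossible for a limit point.
  set Z : ℕ → Set Config := fun k => {z | WidthLE ρ' K z.1 ∧
    ∀ j : ℤ, |j| ≤ k → |(flow W V f 1 z).1 j - y.1 j| ≤ 1 / ((k : ℝ) + 1)} with hZ
  have hZcl : ∀ k, IsClosed (Z k) := by
    intro k
    have : Z k = ⋂ (j : ℤ), {z | WidthLE ρ' K z.1} ∩ (fun z => (flow W V f 1 z).1 j) ⁻¹'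
        {r | |j| ≤ k → |r - y.1 j| ≤ 1 / ((k : ℝ) + 1)} := by
      ext z
      simp only [hZ, mem_ofPred_eq, mem_iInter, mem_inter_iff, mem_preimage]
      exact ⟨fun h j => ⟨h.1, h.2 j⟩, fun h => ⟨(h 0).1, fun j => (h j).2⟩⟩
    rw [this]
    refine isClosed_iInter fun j => (continuousOn_flow hA ρ' K zero_le_one j).preimage_isClosed_of_isClosed
      (isClosed_widthLE ρ' K) ?_
    by_cases hj : |j| ≤ (k : ℤ)
    · simp only [hj, true_imp_iff]
      exact isClosed_le (continuous_id.sub continuous_const).abs continuous_const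
    · simp [hj]
  have hZco : ∀ k, IsCompact (Z k) := fun k =>
    (isCompact_widthLE ρ' K (|y.1 0| + 1 + B)).of_isClosed_subset (hZcl k) fun z hz => ⟨hz.1, by
      have h1 := hz.2 0 (by simp)
      have h2 := hB z hz.1 1 (by simp) 0
      have h3 : (1 : ℝ) / ((k : ℝ) + 1) ≤ 1 := by
        rw [div_le_one (by positivity)]
        have : (0 : ℝ) ≤ k := Nat.cast_nonneg k
        linarith
      have h4 := neg_abs_le (y.1 0)
      have h5 := le_abs_self (y.1 0)
      rw [abs_le] at h1 h2 ⊢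
      constructor <;> linarith [h1.1, h1.2, h2.1, h2.2]⟩
  have hne : ∀ k, (Z k ∩ F.Monotonic).Nonempty := by
    intro k
    by_contra hc
    have hzd := F.zeroDensity_of_isCompact hA (hZco k) (fun z hz => hz.1)
      (disjoint_iff_inter_eq_empty.2 (not_nonempty_iff_eq_empty.1 hc)) hv
    have hε : (0 : ℝ) < 1 / ((k : ℝ) + 1) := by positivity
    refine notMem_of_mem_weakOmegaLimit hA (isOpen_window y k _)
      (hzd.of_succ (Q := Visits W V f v (window y k (1 / ((k : ℝ) + 1)))) fun m n ⟨e, he⟩ => ⟨e, ?_⟩) hy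
      (mem_window_self y k hε)
    refine ⟨widthLE_addInt_shift (hv m) e n, fun j hj => ?_⟩
    rw [flow_addInt hA _ _ zero_le_one, flow_shift hA _ _ zero_le_one, ← flow_nat_succ hA]
    exact (he j hj).le
  have hanti : ∀ k, Z (k + 1) ⊆ Z k := fun k z hz => ⟨hz.1, fun j hj => by
    refine (hz.2 j (hj.trans (by simp))).trans ?_
    push_cast
    gcongr
    linarith⟩
  obtain ⟨z, hz⟩ := IsCompact.nonempty_iInter_of_sequence_nonempty_isCompact_isClosed
    (fun k => Z k ∩ F.Monotonic) (fun k => inter_subset_inter_left _ (hanti k)) hne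
    ((hZco 0).inter_right F.isClosed_monotonic) (fun k => (hZcl k).inter F.isClosed_monotonic)
  rw [mem_iInter] at hz
  refine ⟨z, (hz 0).2, Subtype.ext (funext fun j => ?_)⟩
  by_contra hc
  have hpos : 0 < |(flow W V f 1 z).1 j - y.1 j| := abs_pos.2 (sub_ne_zero.2 hc)
  obtain ⟨n, hn⟩ := exists_nat_one_div_lt hpos
  have h1 := (hz (max n j.natAbs)).1.2 j (by rw [Int.abs_eq_natAbs]; exact_mod_cast le_max_right _ _)
  have h2 : (1 : ℝ) / ((max n j.natAbs : ℕ) + 1) ≤ 1 / ((n : ℝ) + 1) := by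
    have : (n : ℝ) ≤ (max n j.natAbs : ℕ) := by exact_mod_cast le_max_left _ _
    gcongr
  linarith

end Foliation

/-! ### Configurations of the mean spacing of the foliation -/

/-- Double counting over all translates of a window of length `L`: a window whose base point is not
in `Q` contains at most `D` points of `P`. The term `L * L` accounts for the ends of `[-N, N]`. -/
lemma mul_count_le {P Q : ℤ → Prop} {L D : ℕ} (h : ∀ n, ¬ Q n → ∀ S ⊆ Finset.range L,
    (∀ a ∈ S, P (n + a)) → S.card ≤ D) (N : ℕ) :
    L * count P N ≤ L * L + D * (2 * N + 1) + L * count Q N := by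
  classical
  have h1 : ∀ a ∈ Finset.range L, count P N - L ≤
      ∑ n ∈ Finset.Icc (-(N : ℤ)) N, if P (n + a) then (1 : ℝ) else 0 := by
    intro a ha
    rw [Finset.mem_range] at ha
    have h2 : ((Finset.Icc (-(N : ℤ)) N).filter P).card ≤
        ((Finset.Icc (-(N : ℤ)) N).filter fun n => P (n + a)).card + L := by
      calc _ ≤ (((Finset.Icc (-(N : ℤ)) N).filter fun n => P (n + a)).image (fun n => n + (a : ℤ)) ∪
            Finset.Ico (-(N : ℤ)) (-(N : ℤ) + a)).card := by
            refine Finset.card_le_card fun n hn => ?_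
            rw [Finset.mem_filter, Finset.mem_Icc] at hn
            rw [Finset.mem_union, Finset.mem_image, Finset.mem_Ico]
            by_cases hna : n < -(N : ℤ) + a
            · exact Or.inr ⟨hn.1.1, hna⟩
            · refine Or.inl ⟨n - a, Finset.mem_filter.2 ⟨Finset.mem_Icc.2 ⟨by omega, by omega⟩, ?_⟩,
                by ring⟩
              rw [sub_add_cancel]; exact hn.2
        _ ≤ _ := (Finset.card_union_le _ _).trans (add_le_add Finset.card_image_le (by simp; omega))
    have h3 : count P N ≤ (((Finset.Icc (-(N : ℤ)) N).filter fun n => P (n + a)).card : ℝ) + L := by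
      unfold count
      exact_mod_cast h2
    rw [← Finset.sum_filter, Finset.sum_const, nsmul_eq_mul, mul_one]
    linarith
  have h2 : ∀ n ∈ Finset.Icc (-(N : ℤ)) N, ∑ a ∈ Finset.range L, (if P (n + a) then (1 : ℝ) else 0) ≤
      D + L * (if Q n then 1 else 0) := by
    intro n _
    rw [← Finset.sum_filter, Finset.sum_const, nsmul_eq_mul, mul_one]
    by_cases hq : Q n
    · rw [if_pos hq]
      have : ((Finset.range L).filter fun a : ℕ => P (n + a)).card ≤ L := by
        simpa using Finset.card_filter_le (Finset.range L) fun a : ℕ => P (n + a)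
      have : (((Finset.range L).filter fun a : ℕ => P (n + a)).card : ℝ) ≤ L := by exact_mod_cast this
      linarith [(Nat.cast_nonneg D : (0 : ℝ) ≤ D)]
    · rw [if_neg hq, mul_zero, add_zero]
      exact_mod_cast h n hq _ (Finset.filter_subset _ _) fun a ha => (Finset.mem_filter.1 ha).2
  have h3 := Finset.sum_le_sum h1
  have h4 := Finset.sum_le_sum h2
  rw [Finset.sum_comm] at h3
  have h5 := h3.trans h4
  rw [Finset.sum_const, Finset.card_range, nsmul_eq_mul, Finset.sum_add_distrib, Finset.sum_const,
    Int.card_Icc, nsmul_eq_mul, ← Finset.mul_sum, ← Finset.sum_filter, Finset.sum_const, nsmul_eq_mul,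
    mul_one] at h5
  have h6 : (((N : ℤ) + 1 - -(N : ℤ)).toNat : ℝ) = 2 * N + 1 := by
    have : ((N : ℤ) + 1 - -(N : ℤ)).toNat = 2 * N + 1 := by omega
    rw [this]; push_cast; rfl
  have h7 : count Q N = (((Finset.Icc (-(N : ℤ)) N).filter Q).card : ℝ) := by
    unfold count
    rfl
  rw [h6, ← h7] at h5
  linarith

namespace Foliation

variable {ρ : ℝ} (F : Foliation W V f ρ)

/-- The labels of configurations of the mean spacing of the foliation are bounded. -/
lemma abs_lab_sub_le_of_widthLE {K : ℝ} {z : Config} (hz : WidthLE ρ K z.1) (i j : ℤ) :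
    |F.lab z i - F.lab z j| ≤ F.width + K + 1 := by
  have h1 := F.widthLE (F.lab z j) i j
  have h2 := hz i j
  rw [F.leaf_lab] at h1
  have h4 := F.abs_group_sub_le (inv_mem (F.pos_mem i)) (z.1 i) ((F.leaf (F.lab z j)).1 i)
  have h6 : (F.pos i)⁻¹ ((F.leaf (F.lab z j)).1 i) = F.lab z j := by
    rw [F.leaf_apply]; exact (F.pos i).symm_apply_apply _
  rw [h6] at h4
  refine (show |F.lab z i - F.lab z j| ≤ _ from h4).trans ?_
  have h7 : |z.1 i - (F.leaf (F.lab z j)).1 i| ≤ F.width + K := by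
    rw [abs_le] at *
    constructor <;> linarith [h1.1, h1.2, h2.1, h2.2]
  linarith

/-- For monotone labels the sum telescopes, and labels at the spacing of the foliation differ by a
bounded amount. The bound does not depend on `L`, so only boundedly many increments can exceed a
given size. -/
lemma sum_abs_lab_sub_le {K : ℝ} {z : Config} (hz : WidthLE ρ K z.1) (hm : z ∈ F.Monotonic) (j : ℤ)
    (L : ℕ) : ∑ a ∈ Finset.range L, |F.lab z (j + 1 - a) - F.lab z (j - a)| ≤ F.width + K + 1 := by
  have htel := Finset.sum_range_sub' (fun a : ℕ => F.lab z (j + 1 - a)) L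
  have hshift : ∀ a : ℕ, F.lab z (j + 1 - (a + 1 : ℕ)) = F.lab z (j - a) := fun a => by
    congr 1; push_cast; ring
  simp only [hshift] at htel
  have hb := abs_le.1 (F.abs_lab_sub_le_of_widthLE hz (j + 1 - (0 : ℕ)) (j + 1 - L))
  rcases hm with hm | hm
  · have : ∀ a ∈ Finset.range L, |F.lab z (j + 1 - a) - F.lab z (j - a)| =
        F.lab z (j + 1 - a) - F.lab z (j - a) := fun a _ =>
      abs_of_nonneg (sub_nonneg.2 (hm (by omega)))
    rw [Finset.sum_congr rfl this, htel]
    exact hb.2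
  · have : ∀ a ∈ Finset.range L, |F.lab z (j + 1 - a) - F.lab z (j - a)| =
        -(F.lab z (j + 1 - a) - F.lab z (j - a)) := fun a _ =>
      abs_of_nonpos (sub_nonpos.2 (hm (by omega)))
    rw [Finset.sum_congr rfl this, Finset.sum_neg_distrib, htel]
    linarith [hb.1]

/-- The weak `ω`-limit sets in `𝒳_ρ` consist of leaves. -/
theorem eq_leaf_of_mem_weakOmegaLimit (hA : StandingAssumptions W V f) {K : ℝ} {v : Config}
    (hv : ∀ m : ℕ, WidthLE ρ K (flow W V f m v).1) {y : Config}
    (hy : toChain y ∈ weakOmegaLimit W V f (toChain v)) : ∃ s, y = F.leaf s := by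
  classical
  suffices h : ∀ j, F.lab y (j + 1) = F.lab y j by
    refine ⟨F.lab y 0, Subtype.ext (funext fun j => ?_)⟩
    have hc : F.lab y j = F.lab y 0 := by
      induction j using Int.induction_on with
      | zero => rfl
      | succ n ih => rw [h, ih]
      | pred n ih => rw [← ih, ← h, sub_add_cancel]
    rw [← hc, F.leaf_lab]
  intro j
  by_contra hne
  set c := |F.lab y (j + 1) - F.lab y j| / 2 with hc
  have hpos : 0 < |F.lab y (j + 1) - F.lab y j| := abs_pos.2 (sub_ne_zero.2 hne)
  have hc0 : 0 < c := half_pos hpos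
  have hK0 : 0 ≤ K := (hv 0).nonneg
  set jump : Config → ℝ := fun z => |F.lab z (j + 1) - F.lab z j| with hjump
  have hjc : Continuous jump := ((F.continuous_lab _).sub (F.continuous_lab _)).abs
  have hjadd : ∀ e z, jump (addInt e z) = jump z := fun e z => by
    simp only [hjump, F.lab_addInt, add_sub_add_right_eq_sub]
  refine notMem_of_mem_weakOmegaLimit hA (O := {z | c < jump z}) (isOpen_lt continuous_const hjc) ?_ hy
    (half_lt_self hpos)
  obtain ⟨δ, hδ, hequi⟩ := F.equicontinuous c hc0
  obtain ⟨D, hD⟩ := exists_nat_gt ((F.width + K + 1) / δ)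
  rw [div_lt_iff₀ hδ] at hD
  intro ε hε
  -- With at most `D` jumps in a window of `L` sites, jumps have density at most `D / L < ε / 2`.
  -- Windows with more jumps belong to the compact set `S` below, which avoids `Monotonic` and so is
  -- visited with density zero.
  obtain ⟨L, hL⟩ := exists_nat_gt (D / (ε / 2))
  rw [div_lt_iff₀ (by positivity)] at hL
  have hL0 : (0 : ℝ) < L := by
    have : (0 : ℝ) ≤ D := Nat.cast_nonneg D
    by_contra hcon
    nlinarith
  -- the configurations with too many jumps
  set S : Set Config := {z | (WidthLE ρ K z.1 ∧ |z.1 0| ≤ 1) ∧ ∃ A ∈ (Finset.range L).powerset,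
    D < A.card ∧ ∀ a ∈ A, c ≤ jump (shift a z)} with hS
  have hScl : IsClosed {z : Config | ∃ A ∈ (Finset.range L).powerset,
      D < A.card ∧ ∀ a ∈ A, c ≤ jump (shift a z)} := by
    have : {z : Config | ∃ A ∈ (Finset.range L).powerset, D < A.card ∧ ∀ a ∈ A, c ≤ jump (shift a z)} =
        ⋃ A ∈ (Finset.range L).powerset.filter (fun A => D < A.card),
          ⋂ a ∈ A, {z | c ≤ jump (shift (a : ℤ) z)} := by
      ext z
      simp only [mem_ofPred_eq, mem_iUnion, mem_iInter, Finset.mem_filter, exists_prop, and_assoc]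
    rw [this]
    exact Set.Finite.isClosed_biUnion (Finset.finite_toSet _) fun A _ => isClosed_biInter fun a _ =>
      isClosed_le continuous_const (hjc.comp (continuous_shift _))
  have hSco : IsCompact S := (isCompact_widthLE ρ K 1).inter_right hScl
  have hSm : Disjoint S F.Monotonic := by
    rw [disjoint_left]
    rintro z ⟨⟨hz, -⟩, A, hA', hcard, hjumps⟩ hm
    -- A jump of a translate of `z` is the image of a jump of `z` under `F.pos (-a)`; equicontinuity
    -- bounds the latter from below uniformly in `a`.
    have h1 : ∀ a ∈ A, δ ≤ |F.lab z (j + 1 - a) - F.lab z (j - a)| := by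
      intro a ha
      by_contra hlt
      have h2 := hequi _ (F.pos_mem (-a)) _ _ (not_le.1 hlt)
      have h3 := hjumps a ha
      simp only [hjump, F.lab_shift] at h3
      linarith
    have h2 := Finset.card_nsmul_le_sum A _ δ h1
    have h3 := Finset.sum_le_sum_of_subset_of_nonneg (Finset.mem_powerset.1 hA')
      (f := fun a : ℕ => |F.lab z (j + 1 - a) - F.lab z (j - a)|) (fun _ _ _ => abs_nonneg _)
    have h4 := F.sum_abs_lab_sub_le hz hm j L
    rw [nsmul_eq_mul] at h2
    have h5 : (D : ℝ) ≤ A.card := by exact_mod_cast hcard.le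
    nlinarith
  obtain ⟨C, hC0, hC⟩ := F.zeroDensity_of_isCompact hA hSco (fun z hz => hz.1.1) hSm hv (ε / 2)
    (half_pos hε)
  refine ⟨C + L, by positivity, fun N => ?_⟩
  have hcount : ∀ m : ℕ, count (Visits W V f v {z | c < jump z} m) N ≤
      (ε / 2 * (2 * N + 1) + L) + count (Visits W V f v S m) N := by
    intro m
    have h1 := mul_count_le (P := Visits W V f v {z | c < jump z} m) (Q := Visits W V f v S m)
      (L := L) (D := D) (fun n hn A hAL hA' => ?_) N
    · have hN : (0 : ℝ) ≤ 2 * N + 1 := by positivity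
      have h2 : (D : ℝ) * (2 * N + 1) ≤ L * (ε / 2 * (2 * N + 1)) := by
        rw [← mul_assoc]; exact mul_le_mul_of_nonneg_right hL.le hN
      have h3 : L * count (Visits W V f v {z | c < jump z} m) N ≤
          L * ((ε / 2 * (2 * N + 1) + L) + count (Visits W V f v S m) N) := by linarith
      exact le_of_mul_le_mul_left h3 hL0
    · by_contra hcard
      set z := shift n (flow W V f m v) with hz
      refine hn ⟨-⌊z.1 0⌋, ⟨widthLE_addInt_shift (hv m) _ n, ?_⟩, A, Finset.mem_powerset.2 hAL,
        not_le.1 hcard, fun a ha => ?_⟩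
      · rw [addInt_apply]
        push_cast
        rw [abs_le]
        constructor <;> linarith [Int.floor_le (z.1 0), Int.lt_floor_add_one (z.1 0)]
      · obtain ⟨e, he⟩ := hA' a ha
        have he' : c < jump (addInt e (shift (n + a) (flow W V f m v))) := he
        rw [hjadd, add_comm, ← shift_shift] at he'
        rw [shift_addInt, hjadd]
        exact he'.le
  have h1 := Finset.sum_le_sum fun m (_ : m ∈ Finset.range (N + 1)) => hcount m
  rw [Finset.sum_add_distrib, Finset.sum_const, Finset.card_range, nsmul_eq_mul] at h1
  have h2 := hC N
  push_cast at h1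
  linarith

end Foliation

/-! ### A local strictness property, backward in time -/

section Backward

variable {g ψ φ : ℝ → ℝ} {y x : ℝ → ℤ → ℝ} {δ Λ G M : ℝ}

lemma abs_le_of_monotone (hg : Monotone g) {p : ℝ} (hp : |p| ≤ G) : |g p| ≤ |g G| + |g (-G)| := by
  have h1 := hg (abs_le.1 hp).1
  have h2 := hg (abs_le.1 hp).2
  have h3 := le_abs_self (g G)
  have h4 := neg_abs_le (g (-G))
  have h5 := abs_nonneg (g G)
  have h6 := abs_nonneg (g (-G))
  rw [abs_le]
  constructor <;> linarith

/-- Backward in time, gaps with bounded outer gaps from below grow at a bounded rate. -/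
lemma gap_le_of_backward (hg : Monotone g) (hψ : ∀ r, |ψ r| ≤ M)
    (hy : ∀ t ∈ Icc (0 : ℝ) 1, ∀ j, HasDerivWithinAt (fun s => y s j)
      (-force g ψ (φ t) (y t) j) (Icc 0 1) t)
    (hyG : ∀ t ∈ Icc (0 : ℝ) 1, ∀ j, -G ≤ y t (j + 1) - y t j) {P D : ℝ} (hD1 : 1 ≤ D)
    (hD : 2 * g (P + 1) - 2 * g (-G) + 2 * M < D) {k : ℤ} (h0 : y 0 (k + 1) - y 0 k ≤ P) :
    ∀ t ∈ Icc (0 : ℝ) (1 / D), y t (k + 1) - y t k ≤ P + 1 := by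
  have hD0 : 0 < D := by linarith
  have hle1 : 1 / D ≤ 1 := by rwa [div_le_one hD0]
  have key : ∀ t ∈ Icc (0 : ℝ) (1 / D), y t (k + 1) - y t k ≤ P + D * t := by
    intro t ht
    refine image_le_of_deriv_right_lt_deriv_boundary (f := fun t => y t (k + 1) - y t k)
      (B := fun t => P + D * t)
      (f' := fun t => -force g ψ (φ t) (y t) (k + 1) - -force g ψ (φ t) (y t) k) (B' := fun _ => D)
      (fun s hs => ?_) (fun s hs => ?_) (by simpa using h0) (fun s => ?_) (fun s hs he => ?_) ht
    · have hs' : s ∈ Icc (0 : ℝ) 1 := ⟨hs.1, hs.2.trans hle1⟩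
      exact ((hy s hs' _).sub (hy s hs' _)).continuousWithinAt.mono (Icc_subset_Icc_right hle1)
    · have hs' : s ∈ Icc (0 : ℝ) 1 := ⟨hs.1, hs.2.le.trans hle1⟩
      have hs1 : s < 1 := hs.2.trans_le hle1
      exact ((hy s hs' _).sub (hy s hs' _)).mono_of_mem_nhdsWithin
        (mem_of_superset (Icc_mem_nhdsGE hs1) (Icc_subset_Icc_left hs.1))
    · simpa using ((hasDerivAt_id s).const_mul D).const_add P
    · have hs' : s ∈ Icc (0 : ℝ) 1 := ⟨hs.1, hs.2.le.trans hle1⟩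
      have e1 := hg (hyG s hs' (k + 1))
      have e2 := hg (hyG s hs' (k - 1))
      rw [sub_add_cancel] at e2
      have e3 := (abs_le.1 (hψ (y s (k + 1)))).1
      have e4 := (abs_le.1 (hψ (y s k))).2
      have e5 : y s (k + 1) - y s k ≤ P + 1 := by
        rw [he]
        have : D * s ≤ D * (1 / D) := mul_le_mul_of_nonneg_left hs.2.le hD0.le
        rw [mul_one_div_cancel hD0.ne'] at this
        linarith
      have e6 := hg e5
      simp only [force, add_sub_cancel_right]
      linarith
  intro t ht
  have : D * t ≤ D * (1 / D) := mul_le_mul_of_nonneg_left ht.2 hD0.le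
  rw [mul_one_div_cancel hD0.ne'] at this
  linarith [key t ht]

/-- Lower bound for the difference of the forces at a site next to a large difference. -/
lemma le_force_sub_force (hδ : 0 < δ) (hslope : ∀ p q, q ≤ p → δ * (p - q) ≤ g p - g q)
    (hΛ : 0 ≤ Λ) (hlipG : ∀ p q, |p| ≤ G → |q| ≤ G → |g p - g q| ≤ Λ * |p - q|)
    (hlipψ : ∀ p q, |ψ p - ψ q| ≤ Λ * |p - q|) (c : ℝ) {u v : ℤ → ℝ} {j : ℤ} {a κ : ℝ}
    (h0 : |u (j - 1) - v (j - 1)| ≤ 2 * κ) (h1 : |u j - v j| ≤ 2 * κ) (h2 : a ≤ u (j + 1) - v (j + 1))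
    (hκ : 2 * κ ≤ a) (hu : |u j - u (j - 1)| ≤ G) (hv : |v j - v (j - 1)| ≤ G) :
    δ * (a - 2 * κ) - 6 * Λ * κ ≤ force g ψ c u j - force g ψ c v j := by
  have h1' := abs_le.1 h1
  have g1 := hslope (u (j + 1) - u j) (v (j + 1) - v j) (by linarith [h1'.2])
  have g2 := hlipG _ _ hu hv
  have g3 := hlipψ (u j) (v j)
  have g4 : |u j - u (j - 1) - (v j - v (j - 1))| ≤ 4 * κ := by
    rw [show u j - u (j - 1) - (v j - v (j - 1)) = (u j - v j) - (u (j - 1) - v (j - 1)) by ring]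
    exact (abs_sub _ _).trans (by linarith)
  have g5 := (abs_le.1 (g2.trans (mul_le_mul_of_nonneg_left g4 hΛ))).2
  have g6 := (abs_le.1 (g3.trans (mul_le_mul_of_nonneg_left h1 hΛ))).1
  have g7 : δ * (a - 2 * κ) ≤ δ * (u (j + 1) - u j - (v (j + 1) - v j)) :=
    mul_le_mul_of_nonneg_left (by linarith [h1'.2]) hδ.le
  unfold force
  linarith

/-- Upper bound for the difference of the forces at a site with nonpositive differences around. -/
lemma force_sub_force_le (hslope : ∀ p q, q ≤ p → δ * (p - q) ≤ g p - g q)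
    (hδ : 0 ≤ δ) (hΛ : δ ≤ Λ) (hlipG : ∀ p q, |p| ≤ G → |q| ≤ G → |g p - g q| ≤ Λ * |p - q|)
    (hlipψ : ∀ p q, |ψ p - ψ q| ≤ Λ * |p - q|) (c : ℝ) {u v : ℤ → ℝ} {j : ℤ}
    (h1 : u (j + 1) ≤ v (j + 1)) (h0 : u j ≤ v j) (hm : u (j - 1) ≤ v (j - 1))
    (hu1 : |u (j + 1) - u j| ≤ G) (hv1 : |v (j + 1) - v j| ≤ G)
    (hu : |u j - u (j - 1)| ≤ G) (hv : |v j - v (j - 1)| ≤ G) :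
    force g ψ c u j - force g ψ c v j ≤ δ * (u (j + 1) - v (j + 1)) - 3 * Λ * (u j - v j) := by
  have q0 : 0 ≤ (Λ - δ) * (v j - u j) := mul_nonneg (by linarith) (by linarith)
  have q1 : 0 ≤ (Λ - δ) * (v (j + 1) - u (j + 1)) := mul_nonneg (by linarith) (by linarith)
  have q2 : 0 ≤ Λ * (v j - u j) := mul_nonneg (hδ.trans hΛ) (by linarith)
  have q3 : 0 ≤ Λ * (v (j - 1) - u (j - 1)) := mul_nonneg (hδ.trans hΛ) (by linarith)
  have t1 : g (u (j + 1) - u j) - g (v (j + 1) - v j) ≤ δ * (u (j + 1) - v (j + 1)) - Λ * (u j - v j) := by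
    rcases le_total (u (j + 1) - u j) (v (j + 1) - v j) with h | h
    · have := hslope _ _ h
      linarith
    · have h2 := (abs_le.1 (hlipG _ _ hu1 hv1)).2
      rw [abs_of_nonneg (by linarith)] at h2
      linarith
  have t2 : -(g (u j - u (j - 1)) - g (v j - v (j - 1))) ≤ -Λ * (u j - v j) := by
    rcases le_total (v j - v (j - 1)) (u j - u (j - 1)) with h | h
    · have h2 := hslope _ _ h
      have h3 := mul_nonneg hδ (sub_nonneg.2 h)
      linarith
    · have h2 := (abs_le.1 (hlipG _ _ hu hv)).1
      rw [abs_of_nonpos (by linarith)] at h2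
      linarith
  have t3 := (abs_le.1 (hlipψ (u j) (v j))).2
  rw [abs_of_nonpos (by linarith)] at t3
  unfold force
  linarith

set_option maxHeartbeats 800000 in
/-- Two neighbouring labels that agree cannot be adjacent to a larger label, at the end of a time
interval during which the labels were monotone. -/
theorem exists_not_flat (hδ : 0 < δ) (hslope : ∀ p q, q ≤ p → δ * (p - q) ≤ g p - g q)
    (hlip : ∀ G : ℝ, ∃ L, 0 ≤ L ∧ ∀ p q, |p| ≤ G → |q| ≤ G → |g p - g q| ≤ L * |p - q|)
    (hψ : ∀ r, |ψ r| ≤ M) (hψL : ∃ L, 0 ≤ L ∧ ∀ p q, |ψ p - ψ q| ≤ L * |p - q|) (G₀ P : ℝ) {a : ℝ}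
    (ha : 0 < a) : ∃ ε > 0, ∀ (φ : ℝ → ℝ) (y x : ℝ → ℤ → ℝ),
      (∀ t ∈ Icc (0 : ℝ) 1, ∀ j, HasDerivWithinAt (fun s => y s j)
        (-force g ψ (φ t) (y t) j) (Icc 0 1) t) →
      (∀ t ∈ Icc (0 : ℝ) 1, ∀ j, HasDerivWithinAt (fun s => x s j)
        (-force g ψ (φ t) (x t) j) (Icc 0 1) t) →
      (∀ t ∈ Icc (0 : ℝ) 1, ∀ j, |x t (j + 1) - x t j| ≤ G₀) →
      (∀ t ∈ Icc (0 : ℝ) 1, ∀ j, -G₀ ≤ y t (j + 1) - y t j) →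
      (∀ t ∈ Icc (0 : ℝ) 1, ∀ j, y t (j + 1) ≤ x t (j + 1) → y t j ≤ x t j) →
      (∀ k, -2 ≤ k → k ≤ 2 → y 0 (k + 1) - y 0 k ≤ P) →
      |y 0 0 - x 0 0| ≤ ε → |y 0 1 - x 0 1| ≤ ε → 2 * a ≤ y 0 2 - x 0 2 → False := by
  have hmono : Monotone g := fun q p hqp => by
    have := hslope p q hqp
    have : 0 ≤ δ * (p - q) := mul_nonneg hδ.le (sub_nonneg.2 hqp)
    linarith
  have hM : 0 ≤ M := (abs_nonneg _).trans (hψ 0)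
  -- Only lower bounds on the gaps of `y` are available throughout. Upper bounds near the origin are
  -- recovered from the final values by `gap_le_of_backward` at the rate `D`, so that no constant
  -- depends on the width of `y`.
  set D := |2 * g (P + 1) - 2 * g (-G₀) + 2 * M| + 1 with hDdef
  have hD1 : 1 ≤ D := by have := abs_nonneg (2 * g (P + 1) - 2 * g (-G₀) + 2 * M); linarith
  have hD : 2 * g (P + 1) - 2 * g (-G₀) + 2 * M < D := by
    have := le_abs_self (2 * g (P + 1) - 2 * g (-G₀) + 2 * M); linarith
  have hD0 : 0 < D := by linarith
  set G := max G₀ (P + 1) with hG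
  obtain ⟨L₁, hL₁, hlipG⟩ := hlip G
  obtain ⟨L₂, hL₂, hlipψ⟩ := hψL
  set Λ := δ + L₁ + L₂ with hΛ
  have hΛ0 : 0 < Λ := by positivity
  have hlipG' : ∀ p q, |p| ≤ G → |q| ≤ G → |g p - g q| ≤ Λ * |p - q| := fun p q hp hq =>
    (hlipG p q hp hq).trans (mul_le_mul_of_nonneg_right (by linarith) (abs_nonneg _))
  have hlipψ' : ∀ p q, |ψ p - ψ q| ≤ Λ * |p - q| := fun p q =>
    (hlipψ p q).trans (mul_le_mul_of_nonneg_right (by linarith) (abs_nonneg _))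
  set C := 4 * (|g G| + |g (-G)|) + 2 * M + 1 with hC
  have hC0 : 0 < C := by positivity
  -- Chosen so that `δ * (a - 2 * κ) - 6 * Λ * κ = δ * a / 2`. This becomes the speed `c` at which
  -- the difference at the site `1` decreases backward in time, as long as displacements stay below
  -- `κ`, that is, up to time `r`.
  set κ := δ * a / (2 * (2 * δ + 6 * Λ)) with hκ
  have hκ0 : 0 < κ := by positivity
  have hκeq : κ * (2 * δ + 6 * Λ) = δ * a / 2 := by rw [hκ]; field_simp
  have hκa : 2 * κ ≤ a := by
    have : 2 * κ * δ ≤ a * δ := by nlinarith [mul_pos hκ0 hδ, mul_pos hκ0 hΛ0]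
    exact le_of_mul_le_mul_right this hδ
  set r := min (1 / D) (κ / C) with hr
  have hr0 : 0 < r := lt_min (by positivity) (by positivity)
  have hrD : r ≤ 1 / D := min_le_left _ _
  have hr1 : r ≤ 1 := hrD.trans (by rwa [div_le_one hD0])
  have hrC : C * r ≤ κ := by
    have : r ≤ κ / C := min_le_right _ _
    rwa [le_div_iff₀ hC0, mul_comm] at this
  set c := δ * a / 2 with hc
  have hc0 : 0 < c := by positivity
  set E := Real.exp (-(3 * Λ)) with hE
  have hE0 : 0 < E := Real.exp_pos _
  -- The second term gives `ε / c ≤ r / 2`, so that half of the time is left after the difference at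
  -- the site `1` has become negative. The third makes the initial error at most half of the
  -- quadratic gain collected by time `r`.
  set ε := min κ (min (c * r / 2) (δ * E * c * r ^ 2 / (16 * (1 + C / c)))) with hε
  have hε0 : 0 < ε := lt_min hκ0 (lt_min (by positivity) (by positivity))
  have hεκ : ε ≤ κ := min_le_left _ _
  have hεr : ε ≤ c * r / 2 := (min_le_right _ _).trans (min_le_left _ _)
  have hεE : ε * (1 + C / c) ≤ δ * E * c * r ^ 2 / 16 := by
    have h1 : ε ≤ δ * E * c * r ^ 2 / (16 * (1 + C / c)) := (min_le_right _ _).trans (min_le_right _ _)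
    rw [le_div_iff₀ (by positivity)] at h1
    linarith
  refine ⟨ε, hε0, fun φ y x hy hx hxG hyG hord hP hw0 hw1 hw2 => ?_⟩
  have hI : ∀ t ∈ Icc (0 : ℝ) r, t ∈ Icc (0 : ℝ) 1 := fun t ht => ⟨ht.1, ht.2.trans hr1⟩
  have hygap : ∀ t ∈ Icc (0 : ℝ) r, ∀ k, -2 ≤ k → k ≤ 2 → |y t (k + 1) - y t k| ≤ G := by
    intro t ht k h1 h2
    have h3 := gap_le_of_backward hmono hψ hy hyG hD1 hD (hP k h1 h2) t ⟨ht.1, ht.2.trans hrD⟩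
    have h4 := hyG t (hI t ht) k
    have h5 : G₀ ≤ G := le_max_left _ _
    have h6 : P + 1 ≤ G := le_max_right _ _
    rw [abs_le]
    constructor <;> linarith
  have hxgap : ∀ t ∈ Icc (0 : ℝ) r, ∀ k, |x t (k + 1) - x t k| ≤ G := fun t ht k =>
    (hxG t (hI t ht) k).trans (le_max_left _ _)
  have hygap' : ∀ t ∈ Icc (0 : ℝ) r, ∀ k, -1 ≤ k → k ≤ 3 → |y t k - y t (k - 1)| ≤ G := by
    intro t ht k h1 h2
    have := hygap t ht (k - 1) (by omega) (by omega)
    rwa [sub_add_cancel] at this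
  have hxgap' : ∀ t ∈ Icc (0 : ℝ) r, ∀ k, |x t k - x t (k - 1)| ≤ G := by
    intro t ht k
    have := hxgap t ht (k - 1)
    rwa [sub_add_cancel] at this
  set w : ℝ → ℤ → ℝ := fun t j => y t j - x t j with hw
  set w' : ℝ → ℤ → ℝ := fun t j => -force g ψ (φ t) (y t) j - -force g ψ (φ t) (x t) j with hw'
  have hderiv : ∀ t ∈ Icc (0 : ℝ) 1, ∀ j, HasDerivWithinAt (fun s => w s j) (w' t j) (Icc 0 1) t :=
    fun t ht j => (hy t ht j).sub (hx t ht j)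
  have hcont : ∀ j, ContinuousOn (fun s => w s j) (Icc 0 r) := fun j t ht =>
    (hderiv t (hI t ht) j).continuousWithinAt.mono (Icc_subset_Icc_right hr1)
  have hright : ∀ t ∈ Ico (0 : ℝ) r, ∀ j, HasDerivWithinAt (fun s => w s j) (w' t j) (Ici t) t :=
    fun t ht j => (hderiv t (hI t ⟨ht.1, ht.2.le⟩) j).mono_of_mem_nhdsWithin
      (mem_of_superset (Icc_mem_nhdsGE (ht.2.trans_le hr1)) (Icc_subset_Icc_left ht.1))
  -- displacement bounds
  have hdisp : ∀ j, -1 ≤ j → j ≤ 2 → ∀ t ∈ Icc (0 : ℝ) r, |w t j - w 0 j| ≤ C * t := by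
    intro j h1 h2 t ht
    have := norm_image_sub_le_of_norm_deriv_le_segment' (f := fun s => w s j) (f' := fun s => w' s j)
      (C := C) (fun s hs => (hderiv s (hI s hs) j).mono (Icc_subset_Icc_right hr1)) (fun s hs => ?_) t ht
    · simpa using this
    · have hs' : s ∈ Icc (0 : ℝ) r := ⟨hs.1, hs.2.le⟩
      have e1 := abs_le.1 (abs_le_of_monotone hmono (hygap s hs' j (by omega) h2))
      have e2 := abs_le.1 (abs_le_of_monotone hmono (hygap' s hs' j (by omega) (by omega)))
      have e3 := abs_le.1 (abs_le_of_monotone hmono (hxgap s hs' j))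
      have e4 := abs_le.1 (abs_le_of_monotone hmono (hxgap' s hs' j))
      have e5 := abs_le.1 (hψ (y s j))
      have e6 := abs_le.1 (hψ (x s j))
      rw [Real.norm_eq_abs, abs_le]
      simp only [hw', force]
      constructor <;> linarith [e1.1, e1.2, e2.1, e2.2, e3.1, e3.2, e4.1, e4.2, e5.1, e5.2, e6.1, e6.2]
  have hCt : ∀ t ∈ Icc (0 : ℝ) r, C * t ≤ κ := fun t ht =>
    (mul_le_mul_of_nonneg_left ht.2 hC0.le).trans hrC
  -- the label at the site 1
  have hw1' : ∀ t ∈ Icc (0 : ℝ) r, w t 1 ≤ ε - c * t := by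
    intro t ht
    refine image_le_of_deriv_right_le_deriv_boundary (f := fun s => w s 1) (f' := fun s => w' s 1)
      (B := fun t => ε - c * t) (B' := fun _ => -c) (hcont 1) (fun s hs => hright s hs 1) (by simpa [hw] using (abs_le.1 hw1).2)
      (by fun_prop) (fun s hs => ?_) (fun s hs => ?_) ht
    · simpa using (((hasDerivAt_id s).const_mul c).const_sub ε).hasDerivWithinAt
    · have hs' : s ∈ Icc (0 : ℝ) r := ⟨hs.1, hs.2.le⟩
      have d0 := abs_le.1 (hdisp 0 (by norm_num) (by norm_num) s hs')
      have d1 := abs_le.1 (hdisp 1 (by norm_num) (by norm_num) s hs')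
      have d2 := abs_le.1 (hdisp 2 (by norm_num) (by norm_num) s hs')
      have hCs := hCt s hs'
      have i0 := abs_le.1 hw0
      have i1 := abs_le.1 hw1
      have b0 : |w s 0| ≤ 2 * κ := by
        rw [abs_le]; simp only [hw] at *; constructor <;> linarith [d0.1, d0.2, i0.1, i0.2]
      have b1 : |w s 1| ≤ 2 * κ := by
        rw [abs_le]; simp only [hw] at *; constructor <;> linarith [d1.1, d1.2, i1.1, i1.2]
      have b2 : a ≤ w s 2 := by simp only [hw] at *; linarith [d2.1]
      have := le_force_sub_force (Λ := Λ) (G := G) hδ hslope hΛ0.le hlipG' hlipψ' (φ s)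
        (u := y s) (v := x s) (j := 1) (by simpa [hw] using b0) b1 b2 hκa
        (by simpa using hygap s hs' 0 (by norm_num) (by norm_num)) (by simpa using hxgap s hs' 0)
      have h3 : w' s 1 = -(force g ψ (φ s) (y s) 1 - force g ψ (φ s) (x s) 1) := by
        simp only [hw']; ring
      rw [h3]
      linarith
  -- the label at the site 0
  have hτ : ε / c ≤ r := by
    rw [div_le_iff₀ hc0]
    nlinarith
  have hτ0 : 0 < ε / c := by positivity
  -- From time `ε / c` on the difference at the site `1` is nonpositive, and by monotonicity of the
  -- labels so are those at `0` and `-1`.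
  have hneg : ∀ t ∈ Icc (ε / c) r, w t 1 ≤ 0 ∧ w t 0 ≤ 0 ∧ w t (-1) ≤ 0 := by
    intro t ht
    have ht' : t ∈ Icc (0 : ℝ) r := ⟨hτ0.le.trans ht.1, ht.2⟩
    have h1 := hw1' t ht'
    have h2 : ε ≤ c * t := by
      have := ht.1
      rwa [div_le_iff₀ hc0, mul_comm] at this
    have h3 : w t 1 ≤ 0 := by linarith
    have h4 := hord t (hI t ht') 0 (by simpa [hw] using h3)
    have h5 := hord t (hI t ht') (-1) (by simpa using h4)
    exact ⟨h3, sub_nonpos.2 h4, sub_nonpos.2 h5⟩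
  -- The negative difference at the site `1` drives the one at `0` upward in reversed time, at a
  -- rate at least `δ * (c * s - ε)` up to the term absorbed by the integrating factor. The
  -- resulting bound on `-w s 0` is negative at `s = r`, which contradicts `hneg`.
  have hfin := image_le_of_deriv_right_le_deriv_boundary (a := ε / c) (b := r)
    (f := fun s => -w s 0 * Real.exp (-(3 * Λ) * s))
    (f' := fun s => -w' s 0 * Real.exp (-(3 * Λ) * s) +
      -w s 0 * (Real.exp (-(3 * Λ) * s) * (-(3 * Λ))))
    (B := fun s => ε * (1 + C / c) - δ * E / (2 * c) * (c * s - ε) ^ 2)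
    (B' := fun s => -(δ * E * (c * s - ε)))
    (((hcont 0).mono (Icc_subset_Icc_left hτ0.le)).neg.mul (by fun_prop)) (fun s hs => ?_) ?_
    (by fun_prop) (fun s hs => ?_) (fun s hs => ?_) (right_mem_Icc.2 hτ)
  · have h1 := (hneg r (right_mem_Icc.2 hτ)).2.1
    have h2 : 0 ≤ -w r 0 * Real.exp (-(3 * Λ) * r) := mul_nonneg (by linarith) (Real.exp_pos _).le
    have h3 : c * r / 2 ≤ c * r - ε := by linarith
    have h4 : (c * r / 2) ^ 2 ≤ (c * r - ε) ^ 2 := by gcongr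
    have h5 : δ * E / (2 * c) * (c * r / 2) ^ 2 ≤ δ * E / (2 * c) * (c * r - ε) ^ 2 := by gcongr
    have h6 : δ * E / (2 * c) * (c * r / 2) ^ 2 = δ * E * c * r ^ 2 / 8 := by field_simp; ring
    have h7 : 0 < δ * E * c * r ^ 2 := by positivity
    linarith
  · have hs' : s ∈ Ico (0 : ℝ) r := ⟨hτ0.le.trans hs.1, hs.2⟩
    have h1 := ((hasDerivAt_id s).const_mul (-(3 * Λ))).exp
    have h2 := (hright s hs' 0).neg.mul (h1.hasDerivWithinAt (s := Ici s))
    exact h2.congr_deriv (by simp)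
  · have h1 := (abs_le.1 (hdisp 0 (by norm_num) (by norm_num) (ε / c) ⟨hτ0.le, hτ⟩)).1
    have h2 := (abs_le.1 hw0).1
    have h3 : -w (ε / c) 0 ≤ ε * (1 + C / c) := by
      have : ε * (1 + C / c) = ε + C * (ε / c) := by field_simp
      rw [this]
      simp only [hw] at *
      linarith
    have h4 : 0 ≤ -w (ε / c) 0 := by linarith [(hneg (ε / c) (left_mem_Icc.2 hτ)).2.1]
    have h5 : Real.exp (-(3 * Λ) * (ε / c)) ≤ 1 := by
      rw [Real.exp_le_one_iff]
      have : 0 ≤ 3 * Λ * (ε / c) := by positivity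
      linarith
    have h6 : c * (ε / c) - ε = 0 := by field_simp; ring
    rw [h6]
    calc _ ≤ -w (ε / c) 0 * 1 := mul_le_mul_of_nonneg_left h5 h4
      _ ≤ _ := by linarith
  · have h1 : HasDerivAt (fun s => ε * (1 + C / c) - δ * E / (2 * c) * (c * s - ε) ^ 2)
        (-(δ * E / (2 * c) * (2 * (c * s - ε) * c))) s := by
      have := (((((hasDerivAt_id s).const_mul c).sub_const ε).pow 2).const_mul
        (δ * E / (2 * c))).const_sub (ε * (1 + C / c))
      simpa using this
    exact h1.hasDerivWithinAt.congr_deriv (by field_simp)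
  · have hs' : s ∈ Icc (ε / c) r := ⟨hs.1, hs.2.le⟩
    have hs0 : s ∈ Icc (0 : ℝ) r := ⟨hτ0.le.trans hs.1, hs.2.le⟩
    obtain ⟨n1, n0, nm⟩ := hneg s hs'
    have k1 := hw1' s hs0
    have hes : ε ≤ c * s := by
      have := hs.1
      rwa [div_le_iff₀ hc0, mul_comm] at this
    have t4 : -w' s 0 ≤ δ * w s 1 - 3 * Λ * w s 0 := by
      have := force_sub_force_le (Λ := Λ) (G := G) hslope hδ.le (by linarith) hlipG' hlipψ' (φ s)
        (u := y s) (v := x s) (j := 0) (by simpa [hw] using n1) (by simpa [hw] using n0)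
        (by simpa [hw] using nm) (hygap s hs0 0 (by norm_num) (by norm_num)) (hxgap s hs0 0)
        (hygap' s hs0 0 (by norm_num) (by norm_num)) (hxgap' s hs0 0)
      have h3 : -w' s 0 = force g ψ (φ s) (y s) 0 - force g ψ (φ s) (x s) 0 := by
        simp only [hw']; ring
      rw [h3]
      exact this
    have hX : 0 < Real.exp (-(3 * Λ) * s) := Real.exp_pos _
    have hEX : E ≤ Real.exp (-(3 * Λ) * s) := by
      rw [hE, Real.exp_le_exp]
      have : s ≤ 1 := hs0.2.trans hr1
      nlinarith
    have hcs : 0 ≤ δ * (c * s - ε) := mul_nonneg hδ.le (by linarith)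
    have hk1 := mul_le_mul_of_nonneg_left k1 hδ.le
    calc _ = (-w' s 0 + 3 * Λ * w s 0) * Real.exp (-(3 * Λ) * s) := by ring
      _ ≤ (δ * w s 1) * Real.exp (-(3 * Λ) * s) := by gcongr; linarith
      _ ≤ -(δ * (c * s - ε)) * Real.exp (-(3 * Λ) * s) := by gcongr; linarith
      _ ≤ -(δ * (c * s - ε)) * E :=
          mul_le_mul_of_nonpos_left hEX (by linarith)
      _ = _ := by ring

end Backward

/-! ### Strict monotonicity of the labels on the attractor -/

/-- The lattice equation keeps its form under `u ↦ -u` and `j ↦ -j`. One case of `exists_not_flat`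
therefore covers jumps up and down, on the left and on the right. -/
lemma force_reflect {g ψ : ℝ → ℝ} {ς : ℝ} (hς : ς = 1 ∨ ς = -1) {e : ℤ} (he : e = 1 ∨ e = -1) (b : ℝ)
    (u : ℤ → ℝ) (c i : ℤ) :
    force (fun p => ς * e * g (ς * e * p)) (fun r => ς * ψ (ς * r)) (ς * b) (fun i => ς * u (c + e * i)) i =
      ς * force g ψ b u (c + e * i) := by
  unfold force
  beta_reduce
  rcases he with rfl | rfl
  · rw [show c + 1 * (i + 1) = c + 1 * i + 1 by ring, show c + 1 * (i - 1) = c + 1 * i - 1 by ring]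
    rcases hς with rfl | rfl <;> norm_num <;> ring_nf
  · rw [show c + -1 * (i + 1) = c + -1 * i - 1 by ring, show c + -1 * (i - 1) = c + -1 * i + 1 by ring]
    rcases hς with rfl | rfl <;> (norm_num; ring_nf)

namespace Foliation

variable {W V f : ℝ → ℝ} {ρ : ℝ} (F : Foliation W V f ρ)

lemma abs_moving_sub_le (hA : StandingAssumptions W V f) {t : ℝ} (ht : 0 ≤ t) (s : ℝ) {i j : ℤ}
    (hij : |i - j| ≤ 1) : |F.moving t s i - F.moving t s j| ≤ |ρ| + F.width + 1 := by
  have h1 := flow_widthLE hA (F.widthLE s) ht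
  have hcase : i = j ∨ i = j + 1 ∨ j = i + 1 := by rw [abs_le] at hij; omega
  rcases hcase with rfl | rfl | rfl
  · rw [sub_self, abs_zero]
    have := (F.widthLE s).nonneg
    positivity
  · have := h1.gap j
    rw [← add_assoc] at this
    exact this
  · have := h1.gap i
    rw [← add_assoc] at this
    rw [abs_sub_comm]
    exact this

/-- The images of the configurations with monotone labels. -/
def MonotonicImage : Set Config := {y | ∃ z ∈ F.Monotonic, flow W V f 1 z = y}

lemma hasDerivWithinAt_reverse (hA : StandingAssumptions W V f) {ς : ℝ} (hς : ς = 1 ∨ ς = -1) {e : ℤ}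
    (he : e = 1 ∨ e = -1) (z : Config) (c : ℤ) {t : ℝ} (ht : t ∈ Icc (0 : ℝ) 1) (i : ℤ) :
    HasDerivWithinAt (fun s => ς * (flow W V f (1 - s) z).1 (c + e * i))
      (-force (fun p => ς * e * deriv W (ς * e * p)) (fun r => ς * deriv V (ς * r)) (ς * f (1 - t))
        (fun i => ς * (flow W V f (1 - t) z).1 (c + e * i)) i) (Icc 0 1) t := by
  rw [force_reflect hς he]
  have h1 := (flow_solvesOn hA z 1).hderiv (1 - t) ⟨by linarith [ht.2], by linarith [ht.1]⟩ (c + e * i)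
  have h2 : HasDerivWithinAt (fun s : ℝ => 1 - s) (-1) (Icc 0 1) t :=
    ((hasDerivAt_id t).const_sub 1).hasDerivWithinAt
  have h3 := (h1.comp (h := fun s : ℝ => 1 - s) t h2
    (fun s hs => ⟨by linarith [hs.2], by linarith [hs.1]⟩)).const_mul ς
  exact h3.congr_deriv (by ring)

/-- A nearby time-one image of a configuration with monotone labels is run backward together with
the leaf through the flat pair, and `exists_not_flat` applies. The approximation may have any
spacing and width, so only data of `v` near `c` may enter the constants. -/
theorem not_flat_of_mem_closure (hA : StandingAssumptions W V f) {v : Config}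
    (hv : v ∈ closure F.MonotonicImage) {ς : ℝ} (hς : ς = 1 ∨ ς = -1) {e : ℤ} (he : e = 1 ∨ e = -1)
    (c : ℤ) (h01 : F.lab v c = F.lab v (c + e)) : ¬ ς * F.lab v (c + e) < ς * F.lab v (c + e * 2) := by
  intro h12
  obtain ⟨δ, hδ, hslope⟩ := hA.admissible.slope
  obtain ⟨M, -, hM⟩ := hA.admissible.exists_site_bound
  have hς1 : |ς| = 1 := by rcases hς with rfl | rfl <;> simp
  have hςς : ∀ r : ℝ, ς * (ς * r) = r := fun r => by rcases hς with rfl | rfl <;> simp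
  have hςe : ς * (e : ℝ) = 1 ∨ ς * (e : ℝ) = -1 := by
    rcases hς with rfl | rfl <;> rcases he with rfl | rfl <;> simp
  have hςe1 : ∀ p : ℝ, |ς * e * p| = |p| := fun p => by
    rcases hςe with h | h <;> rw [h] <;> simp
  set s := F.lab v c with hs
  set G₀ := |ρ| + F.width + 1 with hG₀
  set d := ς * (v.1 (c + e * 2) - (F.leaf s).1 (c + e * 2)) with hd
  have hd0 : 0 < d := by
    have h1 : ς * s < ς * F.lab v (c + e * 2) := by rw [h01]; exact h12
    have h2 := F.leaf_lab v (c + e * 2)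
    rw [hd, ← h2]
    rcases hς with rfl | rfl
    · have := F.leaf_lt (show s < F.lab v (c + e * 2) by linarith) (c + e * 2)
      linarith
    · have := F.leaf_lt (show F.lab v (c + e * 2) < s by linarith) (c + e * 2)
      linarith
  -- An upper bound for the final gaps of every configuration within `1` of `v` on the sites used;
  -- it depends only on `v`.
  set P := 2 * ∑ i ∈ Finset.Icc (-3 : ℤ) 3, |v.1 (c + e * i)| + 2 with hP
  obtain ⟨ε, hε, hmain⟩ := exists_not_flat (g := fun p => ς * e * deriv W (ς * e * p))
    (ψ := fun r => ς * deriv V (ς * r)) (M := M) hδ (fun p q hqp => by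
      rcases hςe with h | h <;> simp only [h]
      · simpa using hslope p q hqp
      · have := hslope (-q) (-p) (by linarith)
        simp only [neg_mul, one_mul] at this ⊢
        linarith)
    (fun G => by
      obtain ⟨L, hL, h⟩ := hA.admissible.lip G
      refine ⟨L, hL, fun p q hp hq => ?_⟩
      rw [← mul_sub, hςe1]
      refine (h _ _ (by rwa [hςe1]) (by rwa [hςe1])).trans ?_
      rw [← mul_sub, hςe1])
    (fun r => by rw [abs_mul, hς1, one_mul]; exact hM _)
    (by
      obtain ⟨L, hL, h⟩ := hA.admissible.lip_site
      refine ⟨L, hL, fun p q => ?_⟩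
      rw [← mul_sub, abs_mul, hς1, one_mul]
      refine (h _ _).trans ?_
      rw [← mul_sub, abs_mul, hς1, one_mul])
    G₀ P (show 0 < d / 4 by positivity)
  set ε' := min ε (min 1 (d / 2)) with hε'
  have hε'0 : 0 < ε' := lt_min hε (lt_min one_pos (half_pos hd0))
  have hε'1 : ε' ≤ 1 := (min_le_right _ _).trans (min_le_left _ _)
  have hε'd : ε' ≤ d / 2 := (min_le_right _ _).trans (min_le_right _ _)
  have hO : IsOpen (window v (c.natAbs + 3) ε' ∩
      {y | ς * F.lab y (c + e) < ς * F.lab y (c + e * 2)}) :=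
    (isOpen_window _ _ _).inter (isOpen_lt (continuous_const.mul (F.continuous_lab _))
      (continuous_const.mul (F.continuous_lab _)))
  obtain ⟨y, ⟨hyw, hy12⟩, z, hz, rfl⟩ := mem_closure_iff.1 hv _ hO ⟨mem_window_self _ _ hε'0, h12⟩
  have hclose : ∀ i : ℤ, -3 ≤ i → i ≤ 3 → |(flow W V f 1 z).1 (c + e * i) - v.1 (c + e * i)| < ε' := by
    intro i h1 h2
    refine hyw _ ?_
    have h3 := neg_abs_le c
    have h4 := le_abs_self c
    rw [Nat.cast_add, Int.natCast_natAbs, Nat.cast_ofNat, abs_le]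
    generalize |c| = a at h3 h4 ⊢
    rcases he with rfl | rfl <;> constructor <;> linarith
  -- the labels along the orbit are monotone
  have hlab : ∀ t, 0 ≤ t → Monotone fun i : ℤ => ς * label (F.moving t) (flow W V f t z).1 (c + e * i) := by
    have hdich : (∀ t, 0 ≤ t → Monotone fun i : ℤ =>
        ς * label (F.moving t) (flow W V f t z).1 (c + e * i)) ∨
        (∀ t, 0 ≤ t → Antitone fun i : ℤ =>
          ς * label (F.moving t) (flow W V f t z).1 (c + e * i)) := by
      have key : ∀ (l : ℝ → ℤ → ℝ), ((∀ t, 0 ≤ t → Monotone (l t)) ∨ (∀ t, 0 ≤ t → Antitone (l t))) →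
          (∀ t, 0 ≤ t → Monotone fun i : ℤ => ς * l t (c + e * i)) ∨
          (∀ t, 0 ≤ t → Antitone fun i : ℤ => ς * l t (c + e * i)) := by
        intro l hl
        rcases hl with h | h <;> rcases hς with rfl | rfl <;> rcases he with rfl | rfl
        · exact Or.inl fun t ht i j hij => by have := h t ht (show c + 1 * i ≤ c + 1 * j by omega); linarith
        · exact Or.inr fun t ht i j hij => by have := h t ht (show c + -1 * j ≤ c + -1 * i by omega); linarith
        · exact Or.inr fun t ht i j hij => by have := h t ht (show c + 1 * i ≤ c + 1 * j by omega); linarith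
        · exact Or.inl fun t ht i j hij => by have := h t ht (show c + -1 * j ≤ c + -1 * i by omega); linarith
        · exact Or.inr fun t ht i j hij => by have := h t ht (show c + 1 * i ≤ c + 1 * j by omega); linarith
        · exact Or.inl fun t ht i j hij => by have := h t ht (show c + -1 * j ≤ c + -1 * i by omega); linarith
        · exact Or.inl fun t ht i j hij => by have := h t ht (show c + 1 * i ≤ c + 1 * j by omega); linarith
        · exact Or.inr fun t ht i j hij => by have := h t ht (show c + -1 * j ≤ c + -1 * i by omega); linarith
      refine key (fun t => label (F.moving t) (flow W V f t z).1) ?_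
      rcases hz with hz | hz
      · exact Or.inl fun t ht => F.monotone_label_flow hA hz ht
      · exact Or.inr fun t ht => F.antitone_label_flow hA hz ht
    -- The strict inequality between the two outer labels is an open condition, so it holds for the
    -- approximation and fixes the direction of monotonicity.
    refine hdich.resolve_right fun h => ?_
    have h1 := h 1 zero_le_one (show (1 : ℤ) ≤ 2 by norm_num)
    simp only [F.label_moving_one hA, mul_one] at h1
    have h2 := mul_le_mul_of_sign hς F.step.monotone h1
    rw [OrderIso.apply_symm_apply, OrderIso.apply_symm_apply] at h2
    exact absurd hy12 (not_lt.2 h2)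
  have hlabel : ∀ t, 0 ≤ t → ∀ (r : ℝ) (j : ℤ), ς * label (F.moving t) (flow W V f t z).1 j ≤ ς * r ↔
      ς * (flow W V f t z).1 j ≤ ς * F.moving t r j := by
    intro t ht r j
    have hfol := F.isFoliated_moving hA ht
    rcases hς with rfl | rfl
    · simpa using hfol.label_le_iff
    · simpa using hfol.le_label_iff
  have hlabel' : ∀ t, 0 ≤ t → ∀ (r : ℝ) (j : ℤ), ς * r ≤ ς * label (F.moving t) (flow W V f t z).1 j ↔
      ς * F.moving t r j ≤ ς * (flow W V f t z).1 j := by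
    intro t ht r j
    have hfol := F.isFoliated_moving hA ht
    rcases hς with rfl | rfl
    · simpa using hfol.le_label_iff
    · simpa using hfol.label_le_iff
  have hmov : ∀ t, 0 ≤ t → ∀ (r : ℝ) (i : ℤ),
      |F.moving t r (c + e * (i + 1)) - F.moving t r (c + e * i)| ≤ G₀ := fun t ht r i => by
    refine F.abs_moving_sub_le hA ht r ?_
    rw [show c + e * (i + 1) - (c + e * i) = e by ring]
    rcases he with rfl | rfl <;> simp
  have hx0 : ∀ j, F.moving 1 (F.step.symm s) j = (F.leaf s).1 j := fun j => by
    rw [F.moving_one, OrderIso.apply_symm_apply, F.leaf_apply]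
  refine hmain (fun t => ς * f (1 - t)) (fun t i => ς * (flow W V f (1 - t) z).1 (c + e * i))
    (fun t i => ς * F.moving (1 - t) (F.step.symm s) (c + e * i))
    (fun t ht i => hasDerivWithinAt_reverse hA hς he z c ht i)
    (fun t ht i => hasDerivWithinAt_reverse hA hς he _ c ht i) (fun t ht i => ?_) (fun t ht i => ?_)
    (fun t ht i hi => ?_) (fun k h1 h2 => ?_) ?_ ?_ ?_
  · rw [← mul_sub, abs_mul, hς1, one_mul]
    exact hmov _ (by linarith [ht.2]) _ _
  -- With increasing labels the next value is at least that of the leaf through the present one, and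
  -- the gaps of leaves are bounded by `G₀`.
  · have ht' : 0 ≤ 1 - t := by linarith [ht.2]
    have h1 := hlab _ ht' (show i ≤ i + 1 by omega)
    have h2 := (hlabel' _ ht' _ _).1 h1
    have h3 := (F.isFoliated_moving hA ht').label_spec (flow W V f (1 - t) z).1 (c + e * i)
    have h4 := hmov _ ht' (label (F.moving (1 - t)) (flow W V f (1 - t) z).1 (c + e * i)) i
    rw [h3] at h4
    rw [abs_le] at h4
    rcases hς with rfl | rfl <;> linarith [h4.1, h4.2]
  · have ht' : 0 ≤ 1 - t := by linarith [ht.2]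
    exact (hlabel _ ht' _ _).1 ((hlab _ ht' (show i ≤ i + 1 by omega)).trans ((hlabel _ ht' _ _).2 hi))
  · have e1 := abs_lt.1 (hclose k (by omega) (by omega))
    have e2 := abs_lt.1 (hclose (k + 1) (by omega) (by omega))
    have e3 := Finset.single_le_sum (f := fun i : ℤ => |v.1 (c + e * i)|) (fun _ _ => abs_nonneg _)
      (Finset.mem_Icc.2 ⟨by omega, by omega⟩ : k ∈ Finset.Icc (-3 : ℤ) 3)
    have e4 := Finset.single_le_sum (f := fun i : ℤ => |v.1 (c + e * i)|) (fun _ _ => abs_nonneg _)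
      (Finset.mem_Icc.2 ⟨by omega, by omega⟩ : k + 1 ∈ Finset.Icc (-3 : ℤ) 3)
    beta_reduce at e3 e4
    have e5 := abs_le.1 e3
    have e6 := abs_le.1 e4
    rw [sub_zero]
    rcases hς with rfl | rfl <;> linarith [e1.1, e1.2, e2.1, e2.2, e5.1, e5.2, e6.1, e6.2]
  · have h1 := hclose 0 (by norm_num) (by norm_num)
    have h2 := F.leaf_lab v c
    simp only [mul_zero, add_zero, sub_zero] at h1 ⊢
    rw [hx0, h2, ← mul_sub, abs_mul, hς1, one_mul]
    exact h1.le.trans (min_le_left _ _)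
  · have h1 := hclose 1 (by norm_num) (by norm_num)
    have h2 := F.leaf_lab v (c + e)
    rw [← h01] at h2
    simp only [mul_one, sub_zero] at h1 ⊢
    rw [hx0, h2, ← mul_sub, abs_mul, hς1, one_mul]
    exact h1.le.trans (min_le_left _ _)
  · have h1 := abs_lt.1 (hclose 2 (by norm_num) (by norm_num))
    simp only [sub_zero]
    rw [hx0]
    rcases hς with rfl | rfl <;> linarith [h1.1, h1.2]

theorem monotonicImage_subset (hA : StandingAssumptions W V f) : F.MonotonicImage ⊆ F.Monotonic := by
  rintro _ ⟨z, hz, rfl⟩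
  have hlab : ∀ j, F.lab (flow W V f 1 z) j = F.step (label (F.moving 1) (flow W V f 1 z).1 j) :=
    fun j => by rw [F.label_moving_one hA, OrderIso.apply_symm_apply]
  rcases hz with hz | hz
  · refine Or.inl fun i j hij => ?_
    rw [hlab, hlab]
    exact F.step.monotone (F.monotone_label_flow hA hz zero_le_one hij)
  · refine Or.inr fun i j hij => ?_
    rw [hlab, hlab]
    exact F.step.monotone (F.antitone_label_flow hA hz zero_le_one hij)

/-- Labels in the closure of the images are strictly monotone or constant. -/
theorem strict_of_mem_closure (hA : StandingAssumptions W V f) {v : Config}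
    (hv : v ∈ closure F.MonotonicImage) :
    StrictMono (F.lab v) ∨ StrictAnti (F.lab v) ∨ ∀ j, F.lab v j = F.lab v 0 := by
  -- Two adjacent equal labels force the next one, in either direction, to be equal too. So one flat
  -- pair makes all labels constant.
  have hprop : ∀ {e : ℤ}, e = 1 ∨ e = -1 → ∀ c, F.lab v c = F.lab v (c + e) →
      F.lab v (c + e) = F.lab v (c + e * 2) := by
    intro e he c h
    have h1 := F.not_flat_of_mem_closure hA hv (Or.inl rfl) he c h
    have h2 := F.not_flat_of_mem_closure hA hv (Or.inr rfl) he c h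
    exact le_antisymm (by linarith) (by linarith)
  by_cases hex : ∃ c, F.lab v c = F.lab v (c + 1)
  · right; right
    obtain ⟨c, hc⟩ := hex
    have hall : ∀ j, F.lab v j = F.lab v (j + 1) := by
      intro j
      refine Int.inductionOn' (motive := fun j => F.lab v j = F.lab v (j + 1)) j c hc
        (fun k _ hk => ?_) (fun k _ hk => ?_)
      · have := hprop (Or.inl rfl) k hk
        rw [this]; congr 1; ring
      · have := hprop (e := -1) (Or.inr rfl) (k + 1) (by rw [add_neg_cancel_right]; exact hk.symm)
        rw [add_neg_cancel_right, show k + 1 + -1 * 2 = k - 1 by ring] at this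
        rw [sub_add_cancel, this]
    intro j
    induction j using Int.induction_on with
    | zero => rfl
    | succ n ih => rw [← hall, ih]
    | pred n ih => rw [hall, sub_add_cancel, ih]
  · push Not at hex
    rcases closure_minimal (F.monotonicImage_subset hA) F.isClosed_monotonic hv with h | h
    · exact Or.inl (strictMono_int_of_lt_succ fun j => lt_of_le_of_ne (h (by omega)) (hex j))
    · exact Or.inr (Or.inl (strictAnti_int_of_succ_lt fun j =>
        lt_of_le_of_ne (h (by omega)) (hex j).symm))

/-- The quotient map is open, so a point of a closure in `Chain` lifts to the closure of the
preimage. -/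
theorem mem_closure_of_mem_attractor (hA : StandingAssumptions W V f) {v : Config}
    (hv : toChain v ∈ attractor W V f) : v ∈ closure F.MonotonicImage := by
  refine closure_mono ?_ (isOpenMap_toChain.preimage_closure_subset_closure_preimage hv)
  intro y hy
  obtain ⟨x, hx⟩ := mem_iUnion.1 hy
  obtain ⟨w, rfl⟩ := toChain_surjective x
  obtain ⟨ρ', K, hw⟩ := w.exists_widthLE
  exact F.exists_monotonic_preimage hA (fun m => flow_widthLE hA hw (Nat.cast_nonneg m)) hx

end Foliation

/-- A piecewise linear function that is positive at the sites after one where it is nonnegative has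
at most one zero. -/
lemma eq_of_interpolation_eq_zero {d : ℤ → ℝ} (hd : ∀ i j, i < j → 0 ≤ d i → 0 < d j) {x y : ℝ}
    (hx : d ⌊x⌋ + Int.fract x * (d (⌊x⌋ + 1) - d ⌊x⌋) = 0)
    (hy : d ⌊y⌋ + Int.fract y * (d (⌊y⌋ + 1) - d ⌊y⌋) = 0) : x = y := by
  wlog h : x < y generalizing x y with H
  · rcases lt_trichotomy x y with h' | h' | h'
    exacts [absurd h' h, h', (H hy hx h').symm]
  exfalso
  have r0 := Int.fract_nonneg x
  have r1 := Int.fract_lt_one x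
  have q0 := Int.fract_nonneg y
  have q1 := Int.fract_lt_one y
  have hstep := hd ⌊x⌋ (⌊x⌋ + 1) (by omega)
  have hpos : 0 < d (⌊x⌋ + 1) := by
    by_contra hc
    have h2 : d ⌊x⌋ < 0 := by
      by_contra hc'
      exact hc (hstep (not_lt.1 hc'))
    nlinarith
  have hneg : d ⌊x⌋ ≤ 0 := by
    by_contra hc
    nlinarith
  rcases eq_or_lt_of_le (Int.floor_mono h.le) with he | hlt
  · have hx' := Int.floor_add_fract x
    have hy' := Int.floor_add_fract y
    rw [← he] at hy hy'
    have hfr : Int.fract x < Int.fract y := by linarith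
    nlinarith [mul_pos (sub_pos.2 hfr) (show 0 < d (⌊x⌋ + 1) - d ⌊x⌋ by linarith)]
  · have h1 : 0 < d ⌊y⌋ := by
      rcases eq_or_lt_of_le (Int.add_one_le_of_lt hlt) with he | hlt'
      · rwa [← he]
      · exact hd _ _ hlt' hpos.le
    have h2 : 0 < d (⌊y⌋ + 1) := hd _ _ (by omega) h1.le
    nlinarith

/-- The classes of leaves form the support of the measure, which is closed; passing to the closure
adds nothing to the leaves found in the ω-limit sets. -/
theorem eq_leaf_of_mem_attractorOfSpacing {W V f : ℝ → ℝ} {ρ : ℝ} {μ : Measure Chain}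
    (hA : StandingAssumptions W V f) (F : Foliation W V f ρ)
    (hF : ∀ u, toChain u ∈ μ.support ↔ ∃ s, u = F.leaf s) {u : Config}
    (hu : toChain u ∈ attractorOfSpacing W V f ρ) : ∃ s, u = F.leaf s := by
  rw [← hF]
  refine closure_minimal ?_ Measure.isClosed_support hu.1
  intro y hy
  obtain ⟨x, ⟨w, rfl, K, hw⟩, hx⟩ := mem_iUnion₂.1 hy
  obtain ⟨y, rfl⟩ := toChain_surjective y
  rw [hF]
  exact F.eq_leaf_of_mem_weakOmegaLimit hA (fun m => flow_widthLE hA hw (Nat.cast_nonneg m)) hx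

end FrenkelKontorova

theorem mainTheorem6 (W V f : ℝ → ℝ) (hA : FrenkelKontorova.StandingAssumptions W V f)
    (ρ : ℝ) (hρ : FrenkelKontorova.IsDepinned W V f ρ)
    (u : FrenkelKontorova.Config)
    (hu : FrenkelKontorova.toChain u ∈ FrenkelKontorova.attractorOfSpacing W V f ρ)
    (v : FrenkelKontorova.Config)
    (hv : FrenkelKontorova.toChain v ∈ FrenkelKontorova.attractor W V f) (huv : v ≠ u) :
    (FrenkelKontorova.intersections u v).encard ≤ 1 := by
  obtain ⟨μ, hμ, hsurj⟩ := hρ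
  obtain ⟨F, hF⟩ := FrenkelKontorova.exists_foliation hA hμ hsurj
  obtain ⟨s, rfl⟩ := FrenkelKontorova.eq_leaf_of_mem_attractorOfSpacing hA F hF hu
  have hstrict := F.strict_of_mem_closure hA (F.mem_closure_of_mem_attractor hA hv)
  have hlt : ∀ j, s < F.lab v j ↔ (F.leaf s).1 j < v.1 j := fun j => by
    rw [F.leaf_apply, ← F.pos_lab v j, (F.pos j).lt_iff_lt]
  have hgt : ∀ j, F.lab v j < s ↔ v.1 j < (F.leaf s).1 j := fun j => by
    rw [F.leaf_apply, ← F.pos_lab v j, (F.pos j).lt_iff_lt]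
  have hle : ∀ j, s ≤ F.lab v j ↔ (F.leaf s).1 j ≤ v.1 j := fun j => by
    rw [← not_lt, ← not_lt, hgt]
  have hge : ∀ j, F.lab v j ≤ s ↔ v.1 j ≤ (F.leaf s).1 j := fun j => by
    rw [← not_lt, ← not_lt, hlt]
  -- The sign of `v - u` at a site is that of the label of `v` minus `s`. Strictly monotone labels
  -- pass `s` at most once, and constant labels equal to `s` would give `v = u`.
  have hup : (∀ i j : ℤ, i < j → 0 ≤ v.1 i - (F.leaf s).1 i → 0 < v.1 j - (F.leaf s).1 j) ∨
      ∀ i j : ℤ, i < j → 0 ≤ (F.leaf s).1 i - v.1 i → 0 < (F.leaf s).1 j - v.1 j := by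
    simp only [sub_nonneg, sub_pos, ← hle, ← hlt, ← hge, ← hgt]
    rcases hstrict with h | h | h
    · exact Or.inl fun i j hij hi => hi.trans_lt (h hij)
    · exact Or.inr fun i j hij hi => (h hij).trans_le hi
    · have hne : F.lab v 0 ≠ s := fun h0 => huv (Subtype.ext (funext fun j => by
        rw [← F.leaf_lab v j, h, h0]))
      rcases lt_or_gt_of_ne hne with h1 | h1
      · exact Or.inr fun i j _ _ => by rw [h]; exact h1
      · exact Or.inl fun i j _ _ => by rw [h]; exact h1
  rw [Set.encard_le_one_iff]
  intro x y hx hy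
  simp only [FrenkelKontorova.intersections, Set.mem_ofPred_eq, FrenkelKontorova.graph] at hx hy
  rcases hup with h | h
  · exact FrenkelKontorova.eq_of_interpolation_eq_zero h (by linarith) (by linarith)
  · exact FrenkelKontorova.eq_of_interpolation_eq_zero h (by linarith) (by linarith)
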